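/- Let $A$ be a unital associative algebra over $\mathbb{C}$. Bimodules over $A$ are assumed to have the same action of $\mathbb{C}$ from both sides. For an $A$-bimodule $L$ that is finitely generated projective as a left module, let $L^\circ={}_A\mathrm{Hom}(L,A)$, let $\mathrm{ev}:L\otimes_A L^\circ\to A$ be $\mathrm{ev}(e\otimes\alpha)=\alpha(e)$, and let $\mathrm{coev}:A\to L^\circ\otimes_A L$ be $\mathrm{coev}(a)=a\cdot\sum_i e_i\otimes e^i$ for a dual basis $(e^i,e_i)$ of $L$; $L$ is a left line module if $\mathrm{ev}$ and $\mathrm{coev}$ are both bijective. Equivalently (and this is part of the assertion), $L$ is the first bimodule of a strict Morita context $(A,A,L,F,\mu_1,\mu_2)$, i.e. there are an $A$-bimodule $F$ and surjective bimodule maps $\mu_1:L\otimes_A F\to A$, $\mu_2:F\otimes_A L\to A$ with $\mu_1\otimes\mathrm{id}=\mathrm{id}\otimes\mu_2$ on $L\otimes_A F\otimes_A L$ and $\mu_2\otimes\mathrm{id}=\mathrm{id}\otimes\mu_1$ on $F\otimes_A L\otimes_A F$. A Hopf–Galois $\mathbb{C}\mathbb{Z}$-extension of $A$ is a unital $\mathbb{C}$-algebra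 $C$ that is a right comodule algebra, with coaction $\rho:C\to C\otimes\mathbb{C}\mathbb{Z}$, over the group Hopf algebra $\mathbb{C}\mathbb{Z}$ of $\mathbb{Z}$, together with an injective unital algebra map $A\to C$ whose image is $\{c\in C:\rho(c)=c\otimes 1\}$, such that the canonical map $C\otimes_A C\to C\otimes\mathbb{C}\mathbb{Z}$, $c'\otimes c\mapsto (c'\otimes 1)\rho(c)$, is bijective. Write $C_n=\{c\in C:\rho(c)=c\otimes \underline{n}\}$, where $\underline{n}$ is the basis element of $\mathbb{C}\mathbb{Z}$ corresponding to $n\in\mathbb{Z}$. Then there are bijections between the following three collections: (a) $\mathbb{C}$-linear autoequivalences of the category ${}_A\mathbb{M}$ of left $A$-modules, up to natural isomorphism; (b) left line modules over $A$, up to isomorphism of $A$-bimodules; (c) Hopf–Galois $\mathbb{C}\mathbb{Z}$-extensions of $A$, up to isomorphisms of comodule algebras that are the identity on $A$. The bijection between (b) and (a) sends the class of $L$ to the class of the functor $L\otimes_A-$ (which is a $\mathbb{C}$-linear autoequivalence). The bijection from (b) to (c) sends the class of $L$ to the class of the $\mathbb{Z}$-graded tensor algebra $T_{\mathbb{Z}}(L)=\bigoplus_{n\in\mathbb{Z}}L^n$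 (which is a Hopf–Galois $\mathbb{C}\mathbb{Z}$-extension of $A$), where $L^0=A$, $L^n=L^{\otimes_A n}$ and $L^{-n}=(L^\circ)^{\otimes_A n}$ for $n>0$, the product is $\otimes_A$ on factors of the same sign and is given by successive contraction of the adjacent factors with $\mathrm{ev}$ or $\mathrm{coev}^{-1}$ on factors of opposite sign, and the coaction is $x\mapsto x\otimes\underline{n}$ for $x\in L^n$. Its inverse sends the class of $C$ to the class of the bimodule $C_1$ (which is a left line module). -/

import Mathlib

open CategoryTheory
open scoped TensorProduct DirectSum

universe u v w

namespace NCLine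

/-! ## The tensor product over a noncommutative algebra -/

section BalancedTensor

variable (A : Type u) [Ring A]

/-- The subgroup of `E ⊗ F` generated by the elements `e.a ⊗ f - e ⊗ a.f`. -/
def balancedRel (E : Type v) (F : Type w) [AddCommGroup E] [Module Aᵐᵒᵖ E]
    [AddCommGroup F] [Module A F] : AddSubgroup (E ⊗[ℤ] F) :=
  AddSubgroup.closure
    {z | ∃ (e : E) (a : A) (f : F), z = (MulOpposite.op a • e) ⊗ₜ[ℤ] f - e ⊗ₜ[ℤ] (a • f)}

/-- The tensor product `E ⊗_A F` of a right `A`-module `E` and a left `A`-module `F`. -/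
def BalTensor (E : Type v) (F : Type w) [AddCommGroup E] [Module Aᵐᵒᵖ E]
    [AddCommGroup F] [Module A F] : Type (max v w) :=
  (E ⊗[ℤ] F) ⧸ balancedRel A E F

end BalancedTensor

namespace BalTensor

section Basic

variable {A : Type u} [Ring A] {E : Type v} {F : Type w} [AddCommGroup E] [Module Aᵐᵒᵖ E]
  [AddCommGroup F] [Module A F]

noncomputable instance : AddCommGroup (BalTensor A E F) :=
  inferInstanceAs (AddCommGroup ((E ⊗[ℤ] F) ⧸ balancedRel A E F))

variable (A E F) in
/-- The biadditive map `(e, f) ↦ e ⊗ f`. -/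
noncomputable def mk : E →+ F →+ BalTensor A E F where
  toFun e :=
    { toFun := fun f => QuotientAddGroup.mk (e ⊗ₜ[ℤ] f)
      map_zero' := by rw [TensorProduct.tmul_zero]; rfl
      map_add' := fun f f' => by rw [TensorProduct.tmul_add]; rfl }
  map_zero' := by
    ext f
    change (QuotientAddGroup.mk ((0 : E) ⊗ₜ[ℤ] f) : (E ⊗[ℤ] F) ⧸ balancedRel A E F) = _
    rw [TensorProduct.zero_tmul]; rfl
  map_add' e e' := by
    ext f
    change (QuotientAddGroup.mk ((e + e') ⊗ₜ[ℤ] f) : (E ⊗[ℤ] F) ⧸ balancedRel A E F) = _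
    rw [TensorProduct.add_tmul]; rfl

variable (A) in
/-- The pure tensor `e ⊗ f`. -/
noncomputable abbrev tmul (e : E) (f : F) : BalTensor A E F := mk A E F e f

theorem smul_tmul (a : A) (e : E) (f : F) :
    tmul A (MulOpposite.op a • e) f = tmul A e (a • f) := by
  refine (QuotientAddGroup.eq (s := balancedRel A E F)).2 ?_
  rw [← neg_mem_iff]
  refine AddSubgroup.subset_closure ⟨e, a, f, ?_⟩
  abel

@[elab_as_elim]
theorem induction {p : BalTensor A E F → Prop} (h0 : p 0) (ht : ∀ e f, p (tmul A e f))
    (ha : ∀ x y, p x → p y → p (x + y)) (x : BalTensor A E F) : p x := by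
  obtain ⟨z, rfl⟩ := QuotientAddGroup.mk_surjective (s := balancedRel A E F) x
  induction z with
  | zero => exact h0
  | tmul e f => exact ht e f
  | add x y hx hy => exact ha _ _ hx hy

/-- A balanced biadditive map on `E × F` gives an additive map on `E ⊗_A F`. -/
noncomputable def lift {G : Type*} [AddCommGroup G] (φ : E →+ F →+ G)
    (h : ∀ e (a : A) f, φ (MulOpposite.op a • e) f = φ e (a • f)) : BalTensor A E F →+ G :=
  QuotientAddGroup.lift (balancedRel A E F)
    (TensorProduct.liftAddHom φ (fun r m n => by simp))
    (by
      refine (AddSubgroup.closure_le _).2 ?_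
      rintro _ ⟨e, a, f, rfl⟩
      change TensorProduct.liftAddHom φ _ _ = 0
      rw [map_sub, TensorProduct.liftAddHom_tmul, TensorProduct.liftAddHom_tmul, h, sub_self])

@[simp]
theorem lift_tmul {G : Type*} [AddCommGroup G] (φ : E →+ F →+ G)
    (h : ∀ e (a : A) f, φ (MulOpposite.op a • e) f = φ e (a • f)) (e : E) (f : F) :
    lift φ h (tmul A e f) = φ e f := rfl

theorem hom_ext {G : Type*} [AddCommGroup G] {φ ψ : BalTensor A E F →+ G}
    (h : ∀ e f, φ (tmul A e f) = ψ (tmul A e f)) : φ = ψ := by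
  ext x
  induction x using BalTensor.induction with
  | h0 => rw [map_zero, map_zero]
  | ht e f => exact h e f
  | ha x y hx hy => rw [map_add, map_add, hx, hy]

/-- `id ⊗ g` for a left module map `g`. -/
noncomputable def mapRight {F' : Type*} [AddCommGroup F'] [Module A F'] (g : F →ₗ[A] F') :
    BalTensor A E F →+ BalTensor A E F' :=
  lift ((AddMonoidHom.compHom' g.toAddMonoidHom).comp (mk A E F')) (fun e a f => by
    change tmul A _ (g f) = tmul A _ (g (a • f))
    rw [map_smul, smul_tmul])

@[simp]
theorem mapRight_tmul {F' : Type*} [AddCommGroup F'] [Module A F'] (g : F →ₗ[A] F')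
    (e : E) (f : F) : mapRight (E := E) g (tmul A e f) = tmul A e (g f) := rfl

end Basic

section Left

variable {A : Type u} [Ring A] {E : Type v} {F : Type w} [AddCommGroup E] [Module A E]
  [Module Aᵐᵒᵖ E] [SMulCommClass A Aᵐᵒᵖ E] [AddCommGroup F] [Module A F]

/-- Left multiplication by `a` on `E ⊗_A F`. -/
noncomputable def leftMul (a : A) : BalTensor A E F →+ BalTensor A E F :=
  lift ((mk A E F).comp (DistribSMul.toAddMonoidHom E a)) (fun e b f => by
    change tmul A (a • MulOpposite.op b • e) f = tmul A (a • e) (b • f)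
    rw [smul_comm, smul_tmul])

/-- `a.(e ⊗ f) = (a.e) ⊗ f`. -/
noncomputable instance : Module A (BalTensor A E F) where
  smul a x := leftMul a x
  smul_zero a := map_zero (leftMul a)
  smul_add a := map_add (leftMul a)
  one_smul x := by
    refine DFunLike.congr_fun (f := leftMul (1 : A)) (g := AddMonoidHom.id _) ?_ x
    refine hom_ext fun e f => ?_
    change tmul A ((1 : A) • e) f = tmul A e f
    rw [one_smul]
  mul_smul a b x := by
    refine DFunLike.congr_fun (f := leftMul (a * b)) (g := (leftMul a).comp (leftMul b)) ?_ x
    refine hom_ext fun e f => ?_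
    change tmul A ((a * b) • e) f = tmul A (a • b • e) f
    rw [mul_smul]
  add_smul a b x := by
    refine DFunLike.congr_fun (f := leftMul (a + b)) (g := leftMul a + leftMul b) ?_ x
    refine hom_ext fun e f => ?_
    change tmul A ((a + b) • e) f = tmul A (a • e) f + tmul A (b • e) f
    rw [add_smul, tmul, map_add, AddMonoidHom.add_apply]
  zero_smul x := by
    refine DFunLike.congr_fun (f := leftMul (0 : A)) (g := 0) ?_ x
    refine hom_ext fun e f => ?_
    change tmul A ((0 : A) • e) f = 0
    rw [zero_smul, tmul, map_zero, AddMonoidHom.zero_apply]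

theorem smul_left (a : A) (e : E) (f : F) : a • tmul A e f = tmul A (a • e) f := rfl

end Left

section Right

variable {A : Type u} [Ring A] {E : Type v} {F : Type w} [AddCommGroup E]
  [Module Aᵐᵒᵖ E] [AddCommGroup F] [Module A F] [Module Aᵐᵒᵖ F] [SMulCommClass A Aᵐᵒᵖ F]

/-- Right multiplication by `a` on `E ⊗_A F`. -/
noncomputable def rightMul (a : Aᵐᵒᵖ) : BalTensor A E F →+ BalTensor A E F :=
  lift ((AddMonoidHom.compHom' (DistribSMul.toAddMonoidHom F a)).comp (mk A E F))
    (fun e b f => by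
      change tmul A (MulOpposite.op b • e) (a • f) = tmul A e (a • b • f)
      rw [← smul_comm b a f, smul_tmul])

/-- `(e ⊗ f).a = e ⊗ (f.a)`. -/
noncomputable instance : Module Aᵐᵒᵖ (BalTensor A E F) where
  smul a x := rightMul a x
  smul_zero a := map_zero (rightMul a)
  smul_add a := map_add (rightMul a)
  one_smul x := by
    refine DFunLike.congr_fun (f := rightMul (1 : Aᵐᵒᵖ)) (g := AddMonoidHom.id _) ?_ x
    refine hom_ext fun e f => ?_
    change tmul A e ((1 : Aᵐᵒᵖ) • f) = tmul A e f
    rw [one_smul]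
  mul_smul a b x := by
    refine DFunLike.congr_fun (f := rightMul (a * b)) (g := (rightMul a).comp (rightMul b)) ?_ x
    refine hom_ext fun e f => ?_
    change tmul A e ((a * b) • f) = tmul A e (a • b • f)
    rw [mul_smul]
  add_smul a b x := by
    refine DFunLike.congr_fun (f := rightMul (a + b)) (g := rightMul a + rightMul b) ?_ x
    refine hom_ext fun e f => ?_
    change tmul A e ((a + b) • f) = tmul A e (a • f) + tmul A e (b • f)
    rw [add_smul, tmul, map_add]
  zero_smul x := by
    refine DFunLike.congr_fun (f := rightMul (0 : Aᵐᵒᵖ)) (g := 0) ?_ x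
    refine hom_ext fun e f => ?_
    change tmul A e ((0 : Aᵐᵒᵖ) • f) = 0
    rw [zero_smul, tmul, map_zero]

theorem smul_right (a : Aᵐᵒᵖ) (e : E) (f : F) : a • tmul A e f = tmul A e (a • f) := rfl

end Right

instance {A : Type u} [Ring A] {E : Type v} {F : Type w} [AddCommGroup E] [Module A E]
    [Module Aᵐᵒᵖ E] [SMulCommClass A Aᵐᵒᵖ E] [AddCommGroup F] [Module A F] [Module Aᵐᵒᵖ F]
    [SMulCommClass A Aᵐᵒᵖ F] : SMulCommClass A Aᵐᵒᵖ (BalTensor A E F) where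
  smul_comm a b x := by
    induction x using BalTensor.induction with
    | h0 => simp
    | ht e f => rfl
    | ha x y hx hy => rw [smul_add, smul_add, smul_add, smul_add, hx, hy]

end BalTensor

/-! ## Bimodules -/

/-- An `A`-bimodule over the `ℂ`-algebra `A`: commuting left and right actions of `A`, for which
scalars in `ℂ` act in the same way from both sides. -/
structure Bimod (A : Type u) [Ring A] [Algebra ℂ A] where
  carrier : Type u
  [addCommGroup : AddCommGroup carrier]
  [leftModule : Module A carrier]
  [rightModule : Module Aᵐᵒᵖ carrier]
  [smulComm : SMulCommClass A Aᵐᵒᵖ carrier]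
  central : ∀ (c : ℂ) (x : carrier),
    algebraMap ℂ A c • x = MulOpposite.op (algebraMap ℂ A c) • x

namespace Bimod

variable {A : Type u} [Ring A] [Algebra ℂ A]

instance : CoeSort (Bimod A) (Type u) := ⟨Bimod.carrier⟩

attribute [instance] Bimod.addCommGroup Bimod.leftModule Bimod.rightModule Bimod.smulComm

/-- `E` and `F` are isomorphic as `A`-bimodules: there is a left and right linear bijection. -/
def Isomorphic (E F : Bimod A) : Prop :=
  ∃ f : E ≃ₗ[A] F, ∀ (a : A) (x : E), f (MulOpposite.op a • x) = MulOpposite.op a • f x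

variable (A) in
/-- The algebra `A` as an `A`-bimodule. -/
def unit : Bimod A where
  carrier := A
  central c x := Algebra.commutes c x

/-- The bimodule `E ⊗_A F`. -/
noncomputable def tensor (E F : Bimod A) : Bimod A where
  carrier := BalTensor A E F
  central c x := by
    induction x using BalTensor.induction with
    | h0 => simp
    | ht e f =>
      rw [BalTensor.smul_left, BalTensor.smul_right, E.central, BalTensor.smul_tmul, F.central]
    | ha x y hx hy => rw [smul_add, smul_add, hx, hy]

/-- The pure tensors `e ⊗ f` of `E ⊗_A F`. -/
noncomputable def tm {E F : Bimod A} : E →+ F →+ E.tensor F := BalTensor.mk A E F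

theorem tm_smul {E F : Bimod A} (a : A) (e : E) (f : F) :
    tm (MulOpposite.op a • e) f = tm e (a • f) := BalTensor.smul_tmul a e f

theorem smul_tm {E F : Bimod A} (a : A) (e : E) (f : F) : a • tm e f = tm (a • e) f := rfl

theorem op_smul_tm {E F : Bimod A} (a : Aᵐᵒᵖ) (e : E) (f : F) : a • tm e f = tm e (a • f) := rfl

/-- Balanced biadditive maps on bimodules. -/
noncomputable def tlift {E F : Bimod A} {G : Type*} [AddCommGroup G] (φ : E →+ F →+ G)
    (h : ∀ e (a : A) f, φ (MulOpposite.op a • e) f = φ e (a • f)) : E.tensor F →+ G :=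
  BalTensor.lift φ h

theorem tlift_tm {E F : Bimod A} {G : Type*} [AddCommGroup G] (φ : E →+ F →+ G)
    (h : ∀ e (a : A) f, φ (MulOpposite.op a • e) f = φ e (a • f)) (e : E) (f : F) :
    tlift φ h (tm e f) = φ e f := rfl

@[elab_as_elim]
theorem tensor_induction {E F : Bimod A} {p : E.tensor F → Prop} (h0 : p 0)
    (ht : ∀ e f, p (tm e f)) (ha : ∀ x y, p x → p y → p (x + y)) (x : E.tensor F) : p x :=
  BalTensor.induction h0 ht ha x

/-- `E^{⊗ n}`, with `E^{⊗ 0} = A` and `E^{⊗ (n + 1)} = E ⊗_A E^{⊗ n}`. -/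
noncomputable def pow (E : Bimod A) : ℕ → Bimod A
  | 0 => unit A
  | n + 1 => tensor E (pow E n)

/-- The identification of `A` with `E^{⊗ 0}`. -/
def pone (E : Bimod A) : A →+ E.pow 0 := AddMonoidHom.id A

/-- The pure tensors `e ⊗ x` of `E^{⊗ (n + 1)} = E ⊗_A E^{⊗ n}`. -/
noncomputable def pcons {E : Bimod A} {n : ℕ} : E →+ E.pow n →+ E.pow (n + 1) :=
  tm (E := E) (F := E.pow n)

theorem pcons_smul {E : Bimod A} {n : ℕ} (a : A) (e : E) (x : E.pow n) :
    pcons (MulOpposite.op a • e) x = pcons e (a • x) := tm_smul a e x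

theorem smul_pcons {E : Bimod A} {n : ℕ} (a : A) (e : E) (x : E.pow n) :
    a • pcons e x = pcons (a • e) x := rfl

theorem op_smul_pcons {E : Bimod A} {n : ℕ} (a : Aᵐᵒᵖ) (e : E) (x : E.pow n) :
    a • pcons e x = pcons e (a • x) := rfl

theorem smul_pone {E : Bimod A} (a b : A) : a • pone E b = pone E (a * b) := rfl

theorem op_smul_pone {E : Bimod A} (a b : A) :
    MulOpposite.op a • pone E b = pone E (b * a) := rfl

/-- Balanced biadditive maps on `E × E^{⊗ n}`. -/
noncomputable def plift {E : Bimod A} {n : ℕ} {G : Type*} [AddCommGroup G]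
    (φ : E →+ E.pow n →+ G)
    (h : ∀ e (a : A) x, φ (MulOpposite.op a • e) x = φ e (a • x)) : E.pow (n + 1) →+ G :=
  tlift (E := E) (F := E.pow n) φ h

theorem plift_pcons {E : Bimod A} {n : ℕ} {G : Type*} [AddCommGroup G]
    (φ : E →+ E.pow n →+ G)
    (h : ∀ e (a : A) x, φ (MulOpposite.op a • e) x = φ e (a • x)) (e : E) (x : E.pow n) :
    plift φ h (pcons e x) = φ e x := rfl

@[elab_as_elim]
theorem pzero_induction {E : Bimod A} {p : E.pow 0 → Prop} (h : ∀ a, p (pone E a))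
    (x : E.pow 0) : p x := h x

@[elab_as_elim]
theorem psucc_induction {E : Bimod A} {n : ℕ} {p : E.pow (n + 1) → Prop} (h0 : p 0)
    (ht : ∀ e (x : E.pow n), p (pcons e x)) (ha : ∀ x y, p x → p y → p (x + y))
    (x : E.pow (n + 1)) : p x :=
  tensor_induction (E := E) (F := E.pow n) h0 ht ha x

/-- The left action `(a.α)(e) = α(e.a)` on the left dual. -/
instance dualLeftModule (E : Bimod A) : Module A (E →ₗ[A] A) where
  smul a α :=
    { toFun := fun e => α (MulOpposite.op a • e)
      map_add' := fun x y => by rw [smul_add, map_add]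
      map_smul' := fun b x => by rw [← smul_comm, map_smul, RingHom.id_apply] }
  one_smul α := by
    ext e
    change α (MulOpposite.op (1 : A) • e) = α e
    rw [MulOpposite.op_one, one_smul]
  mul_smul a b α := by
    ext e
    change α (MulOpposite.op (a * b) • e) = α (MulOpposite.op b • MulOpposite.op a • e)
    rw [MulOpposite.op_mul, mul_smul]
  smul_zero a := by ext e; rfl
  smul_add a α β := by ext e; rfl
  add_smul a b α := by
    ext e
    change α (MulOpposite.op (a + b) • e)
      = α (MulOpposite.op a • e) + α (MulOpposite.op b • e)
    rw [MulOpposite.op_add, add_smul, map_add]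
  zero_smul α := by
    ext e
    change α (MulOpposite.op (0 : A) • e) = 0
    rw [MulOpposite.op_zero, zero_smul, map_zero]

/-- The left dual `E° = _A Hom(E, A)`, with `(α.a)(e) = α(e) a` and `(a.α)(e) = α(e.a)`. -/
def dual (E : Bimod A) : Bimod A where
  carrier := E →ₗ[A] A
  leftModule := dualLeftModule E
  smulComm := ⟨fun a b α => by ext e; rfl⟩
  central c α := by
    ext e
    change α (MulOpposite.op (algebraMap ℂ A c) • e) = α e * algebraMap ℂ A c
    rw [← E.central, map_smul, smul_eq_mul, Algebra.commutes]

/-- The value of an element of the dual. -/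
def app {E : Bimod A} (α : E.dual) (e : E) : A := (show E →ₗ[A] A from α) e

theorem dual_ext {E : Bimod A} {α β : E.dual} (h : ∀ e, app α e = app β e) : α = β :=
  LinearMap.ext (f := (show E →ₗ[A] A from α)) (g := (show E →ₗ[A] A from β)) h

theorem app_smul {E : Bimod A} (α : E.dual) (a : A) (e : E) : app α (a • e) = a * app α e :=
  map_smul (show E →ₗ[A] A from α) a e

theorem app_op_smul {E : Bimod A} (α : E.dual) (a : A) (e : E) :
    app (MulOpposite.op a • α) e = app α e * a := rfl

theorem smul_app {E : Bimod A} (α : E.dual) (a : A) (e : E) :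
    app (a • α) e = app α (MulOpposite.op a • e) := rfl

/-- `e ↦ α(e)` as a biadditive map. -/
def appHom (E : Bimod A) : E →+ E.dual →+ A where
  toFun e :=
    { toFun := fun α => app α e
      map_zero' := rfl
      map_add' := fun _ _ => rfl }
  map_zero' := by ext α; exact map_zero (show E →ₗ[A] A from α)
  map_add' e e' := by ext α; exact map_add (show E →ₗ[A] A from α) e e'

/-- The evaluation `ev : E ⊗_A E° → A`, `ev(e ⊗ α) = α(e)`. -/
noncomputable def ev (E : Bimod A) : E.tensor E.dual →+ A :=
  tlift (appHom E) (fun _ _ _ => rfl)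

/-- A (finite) dual basis of the left module `E`. -/
structure DualBasis (E : Bimod A) where
  n : ℕ
  vec : Fin n → E
  cov : Fin n → E.dual
  sum_eq : ∀ e : E, ∑ i, app (cov i) e • vec i = e

/-- `E` is finitely generated projective as a left `A`-module. -/
def IsFGP (E : Bimod A) : Prop := Nonempty E.DualBasis

/-- The coevaluation `a ↦ a.∑ e_i ⊗ e^i` computed with the dual basis `b`. -/
noncomputable def DualBasis.coev {E : Bimod A} (b : E.DualBasis) : A →+ E.dual.tensor E where
  toFun a := a • ∑ i, tm (b.cov i) (b.vec i)
  map_zero' := zero_smul _ _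
  map_add' a a' := add_smul a a' _

theorem DualBasis.coev_apply {E : Bimod A} (b : E.DualBasis) (a : A) :
    b.coev a = ∑ i, tm (a • b.cov i) (b.vec i) := Finset.smul_sum

/-- The coevaluation does not depend on the dual basis. -/
theorem DualBasis.coev_eq {E : Bimod A} (b b' : E.DualBasis) : b.coev = b'.coev := by
  ext a
  change a • ∑ i, tm (b.cov i) (b.vec i)
    = a • ∑ i, tm (b'.cov i) (b'.vec i)
  congr 1
  have h1 : ∀ i, tm (b.cov i) (b.vec i)
      = ∑ j, tm (MulOpposite.op (app (b'.cov j) (b.vec i)) • b.cov i) (b'.vec j) := by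
    intro i
    conv_lhs => rw [← b'.sum_eq (b.vec i)]
    rw [map_sum]
    exact Finset.sum_congr rfl fun j _ => (tm_smul _ _ _).symm
  have h2 : ∀ j, ∑ i, MulOpposite.op (app (b'.cov j) (b.vec i)) • b.cov i = b'.cov j := by
    intro j
    refine dual_ext fun e => ?_
    change appHom E e (∑ i, MulOpposite.op (app (b'.cov j) (b.vec i)) • b.cov i) = _
    rw [map_sum]
    conv_rhs => rw [← b.sum_eq e]
    change _ = (show E →ₗ[A] A from b'.cov j) (∑ i, app (b.cov i) e • b.vec i)
    rw [map_sum]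
    exact Finset.sum_congr rfl fun i _ => (app_smul (b'.cov j) _ _).symm
  rw [Finset.sum_congr rfl fun i _ => h1 i, Finset.sum_comm]
  refine Finset.sum_congr rfl fun j _ => ?_
  conv_rhs => rw [← h2 j]
  rw [map_sum, AddMonoidHom.finsetSum_apply]

/-- The coevaluation `coev : A → E° ⊗_A E`. -/
noncomputable def coev (E : Bimod A) (h : E.IsFGP) : A →+ E.dual.tensor E :=
  (Classical.choice h).coev

/-- Weak left line modules: finitely generated projective on the left, with `coev` bijective. -/
structure IsWeakLeftLine (E : Bimod A) : Prop where
  fgp : E.IsFGP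
  coev_bijective : Function.Bijective (E.coev fgp)

/-- Left line modules: weak left line modules for which `ev` is bijective. -/
structure IsLeftLine (E : Bimod A) : Prop extends IsWeakLeftLine E where
  ev_bijective : Function.Bijective E.ev

/-- The functor `E ⊗_A - : _A𝕄 → _A𝕄`. -/
noncomputable def tensorFunctor (E : Bimod A) : ModuleCat.{u} A ⥤ ModuleCat.{u} A where
  obj M := ModuleCat.of A (BalTensor A E M)
  map f := ModuleCat.ofHom
    { toFun := BalTensor.mapRight (E := E) f.hom
      map_add' := map_add _
      map_smul' := fun a x => by
        induction x using BalTensor.induction with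
        | h0 => simp
        | ht e m => rfl
        | ha x y hx hy => rw [smul_add, map_add, hx, hy, map_add, smul_add] }
  map_id M := by
    ext x
    change BalTensor.mapRight _ x = x
    induction x using BalTensor.induction with
    | h0 => simp
    | ht e m => rfl
    | ha x y hx hy => rw [map_add, hx, hy]
  map_comp f g := by
    ext x
    change BalTensor.mapRight _ x = BalTensor.mapRight _ (BalTensor.mapRight _ x)
    induction x using BalTensor.induction with
    | h0 => simp
    | ht e m => rfl
    | ha x y hx hy => rw [map_add, hx, hy, map_add, map_add]

end Bimod

/-! ## Morita contexts -/

/-- A Morita self-context `(A, A, E, F, μ₁, μ₂)`. -/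
structure MoritaContext (A : Type u) [Ring A] [Algebra ℂ A] where
  E : Bimod A
  F : Bimod A
  /-- `μ₁ : E ⊗_A F → A` -/
  μ₁ : E.tensor F →+ A
  /-- `μ₂ : F ⊗_A E → A` -/
  μ₂ : F.tensor E →+ A
  μ₁_left : ∀ (a : A) x, μ₁ (a • x) = a * μ₁ x
  μ₁_right : ∀ (a : A) x, μ₁ (MulOpposite.op a • x) = μ₁ x * a
  μ₂_left : ∀ (a : A) x, μ₂ (a • x) = a * μ₂ x
  μ₂_right : ∀ (a : A) x, μ₂ (MulOpposite.op a • x) = μ₂ x * a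
  assoc₁ : ∀ (e : E) (f : F) (e' : E),
    μ₁ (Bimod.tm e f) • e' = MulOpposite.op (μ₂ (Bimod.tm f e')) • e
  assoc₂ : ∀ (f : F) (e : E) (f' : F),
    μ₂ (Bimod.tm f e) • f' = MulOpposite.op (μ₁ (Bimod.tm e f')) • f

namespace MoritaContext

variable {A : Type u} [Ring A] [Algebra ℂ A]

/-- Strict Morita contexts. -/
def IsStrict (M : MoritaContext A) : Prop :=
  Function.Surjective M.μ₁ ∧ Function.Surjective M.μ₂

/-- `E^n`, where `E^n = E ⊗_A ⋯ ⊗_A E` (`n` factors) for `n ≥ 0` (so that `E^0 = A`) and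
`E^{-n} = F ⊗_A ⋯ ⊗_A F` (`n` factors) for `n > 0`. -/
noncomputable def piece (M : MoritaContext A) : ℤ → Bimod A
  | .ofNat n => M.E.pow n
  | .negSucc n => M.F.pow (n + 1)

/-- The `ℤ`-graded bimodule `⨁_n E^n`. -/
def TensorAlg (M : MoritaContext A) : Type u := ⨁ n : ℤ, (M.piece n : Type u)

namespace TensorAlg

variable (M : MoritaContext A)

noncomputable instance : AddCommGroup M.TensorAlg :=
  inferInstanceAs (AddCommGroup (⨁ n : ℤ, (M.piece n : Type u)))

noncomputable instance : Module A M.TensorAlg :=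
  inferInstanceAs (Module A (⨁ n : ℤ, (M.piece n : Type u)))

noncomputable instance : Module Aᵐᵒᵖ M.TensorAlg :=
  inferInstanceAs (Module Aᵐᵒᵖ (⨁ n : ℤ, (M.piece n : Type u)))

/-- The inclusion of the degree `n` piece. -/
noncomputable def inc (n : ℤ) : M.piece n →+ M.TensorAlg :=
  DirectSum.of (fun n : ℤ => (M.piece n : Type u)) n

/-- The inclusion of `E^{⊗ n}`, in degree `n`. -/
noncomputable def incPos (n : ℕ) : M.E.pow n →+ M.TensorAlg := inc M (Int.ofNat n)

/-- The inclusion of `F^{⊗ n}`, in degree `-n`. -/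
noncomputable def incNeg : (n : ℕ) → M.F.pow n →+ M.TensorAlg
  | 0 => inc M (Int.ofNat 0)
  | n + 1 => inc M (Int.negSucc n)

theorem inc_smul (n : ℤ) (a : A) (x : M.piece n) : inc M n (a • x) = a • inc M n x :=
  map_smul (DirectSum.lof A ℤ (fun n : ℤ => (M.piece n : Type u)) n) a x

theorem inc_op_smul (n : ℤ) (a : Aᵐᵒᵖ) (x : M.piece n) : inc M n (a • x) = a • inc M n x :=
  map_smul (DirectSum.lof Aᵐᵒᵖ ℤ (fun n : ℤ => (M.piece n : Type u)) n) a x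

theorem incPos_smul (n : ℕ) (a : A) (x : M.E.pow n) : incPos M n (a • x) = a • incPos M n x :=
  inc_smul M (Int.ofNat n) a x

theorem incPos_op_smul (n : ℕ) (a : Aᵐᵒᵖ) (x : M.E.pow n) :
    incPos M n (a • x) = a • incPos M n x := inc_op_smul M (Int.ofNat n) a x

theorem incNeg_smul (n : ℕ) (a : A) (x : M.F.pow n) :
    incNeg M n (a • x) = a • incNeg M n x := by
  cases n with
  | zero => exact inc_smul M (Int.ofNat 0) a x
  | succ n => exact inc_smul M (Int.negSucc n) a x

theorem incNeg_op_smul (n : ℕ) (a : Aᵐᵒᵖ) (x : M.F.pow n) :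
    incNeg M n (a • x) = a • incNeg M n x := by
  cases n with
  | zero => exact inc_op_smul M (Int.ofNat 0) a x
  | succ n => exact inc_op_smul M (Int.negSucc n) a x

variable {M} in
@[elab_as_elim]
theorem inc_induction {p : M.TensorAlg → Prop} (h0 : p 0) (hinc : ∀ n x, p (inc M n x))
    (hadd : ∀ x y, p x → p y → p (x + y)) (x : M.TensorAlg) : p x :=
  DirectSum.induction_on (motive := p) x h0 hinc hadd

variable {M} in
@[elab_as_elim]
theorem induction {p : M.TensorAlg → Prop} (h0 : p 0) (hpos : ∀ n x, p (incPos M n x))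
    (hneg : ∀ n x, p (incNeg M n x)) (hadd : ∀ x y, p x → p y → p (x + y))
    (x : M.TensorAlg) : p x := by
  refine DirectSum.induction_on (motive := p) x h0 (fun n x => ?_) hadd
  cases n with
  | ofNat n => exact hpos n x
  | negSucc n => exact hneg (n + 1) x

/-- The product of `E` with `E^n`: it is `⊗` if `n ≥ 0`, and `e.(f ⊗ x) = μ₁(e ⊗ f).x` on
`E^{-n-1} = F ⊗ F^{⊗ n}`. -/
noncomputable def actE₀ : (n : ℤ) → M.E →+ M.piece n →+ M.TensorAlg
  | .ofNat n => (AddMonoidHom.compHom (incPos M (n + 1))).comp Bimod.pcons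
  | .negSucc n =>
    { toFun := fun e => Bimod.plift
        (((AddMonoidHom.compHom (incNeg M n)).comp (smulAddHom A (M.F.pow n))).comp
          (M.μ₁.comp (Bimod.tm e)))
        (fun f a x => by
          change incNeg M n (M.μ₁ (Bimod.tm e (MulOpposite.op a • f)) • x)
            = incNeg M n (M.μ₁ (Bimod.tm e f) • a • x)
          rw [← Bimod.op_smul_tm, M.μ₁_right, mul_smul])
      map_zero' := by
        refine BalTensor.hom_ext fun f x => ?_
        change incNeg M n (M.μ₁ (Bimod.tm 0 f) • x) = 0
        rw [map_zero, AddMonoidHom.zero_apply, map_zero, zero_smul, map_zero]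
      map_add' := fun e e' => by
        refine BalTensor.hom_ext fun f x => ?_
        change incNeg M n (M.μ₁ (Bimod.tm (e + e') f) • x)
          = incNeg M n (M.μ₁ (Bimod.tm e f) • x) + incNeg M n (M.μ₁ (Bimod.tm e' f) • x)
        rw [map_add, AddMonoidHom.add_apply, map_add, add_smul, map_add] }

/-- The product of `F` with `E^n`: `f.a = f ⊗ a` on `E^0 = A`, and
`f.(e ⊗ x) = μ₂(f ⊗ e).x` on `E^{n+1} = E ⊗ E^{⊗ n}`, and `⊗` in negative degrees. -/
noncomputable def actF₀ : (n : ℤ) → M.F →+ M.piece n →+ M.TensorAlg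
  | .ofNat 0 => (AddMonoidHom.compHom (incNeg M 1)).comp
    (Bimod.pcons (E := M.F) (n := 0))
  | .ofNat (n + 1) =>
    { toFun := fun f => Bimod.plift
        (((AddMonoidHom.compHom (incPos M n)).comp (smulAddHom A (M.E.pow n))).comp
          (M.μ₂.comp (Bimod.tm f)))
        (fun e a x => by
          change incPos M n (M.μ₂ (Bimod.tm f (MulOpposite.op a • e)) • x)
            = incPos M n (M.μ₂ (Bimod.tm f e) • a • x)
          rw [← Bimod.op_smul_tm, M.μ₂_right, mul_smul])
      map_zero' := by
        refine BalTensor.hom_ext fun f x => ?_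
        change incPos M n (M.μ₂ (Bimod.tm 0 f) • x) = 0
        rw [map_zero, AddMonoidHom.zero_apply, map_zero, zero_smul, map_zero]
      map_add' := fun e e' => by
        refine BalTensor.hom_ext fun f x => ?_
        change incPos M n (M.μ₂ (Bimod.tm (e + e') f) • x)
          = incPos M n (M.μ₂ (Bimod.tm e f) • x) + incPos M n (M.μ₂ (Bimod.tm e' f) • x)
        rw [map_add, AddMonoidHom.add_apply, map_add, add_smul, map_add] }
  | .negSucc n => (AddMonoidHom.compHom (incNeg M (n + 2))).comp Bimod.pcons

/-- Left multiplication by the elements of `E` in degree `1`. -/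
noncomputable def actE : M.E →+ AddMonoid.End M.TensorAlg where
  toFun e := DirectSum.toAddMonoid fun n => actE₀ M n e
  map_zero' := DirectSum.addHom_ext fun n x => by
    rw [DirectSum.toAddMonoid_of, map_zero]; rfl
  map_add' e e' := DirectSum.addHom_ext fun n x => by
    rw [DirectSum.toAddMonoid_of, map_add, AddMonoidHom.add_apply]
    change _ = DirectSum.toAddMonoid (fun n => actE₀ M n e) _
      + DirectSum.toAddMonoid (fun n => actE₀ M n e') _
    rw [DirectSum.toAddMonoid_of, DirectSum.toAddMonoid_of]

/-- Left multiplication by the elements of `F` in degree `-1`. -/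
noncomputable def actF : M.F →+ AddMonoid.End M.TensorAlg where
  toFun f := DirectSum.toAddMonoid fun n => actF₀ M n f
  map_zero' := DirectSum.addHom_ext fun n x => by
    rw [DirectSum.toAddMonoid_of, map_zero]; rfl
  map_add' e e' := DirectSum.addHom_ext fun n x => by
    rw [DirectSum.toAddMonoid_of, map_add, AddMonoidHom.add_apply]
    change _ = DirectSum.toAddMonoid (fun n => actF₀ M n e) _
      + DirectSum.toAddMonoid (fun n => actF₀ M n e') _
    rw [DirectSum.toAddMonoid_of, DirectSum.toAddMonoid_of]

theorem actE_inc (e : M.E) (n : ℤ) (x : M.piece n) : actE M e (inc M n x) = actE₀ M n e x :=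
  DirectSum.toAddMonoid_of (fun n => actE₀ M n e) n x

theorem actF_inc (f : M.F) (n : ℤ) (x : M.piece n) : actF M f (inc M n x) = actF₀ M n f x :=
  DirectSum.toAddMonoid_of (fun n => actF₀ M n f) n x

theorem actE_incPos (e : M.E) (n : ℕ) (x : M.E.pow n) :
    actE M e (incPos M n x) = incPos M (n + 1) (Bimod.pcons e x) := actE_inc M e (Int.ofNat n) x

theorem actE_incNeg (e : M.E) (n : ℕ) (f : M.F) (x : M.F.pow n) :
    actE M e (incNeg M (n + 1) (Bimod.pcons f x)) = M.μ₁ (Bimod.tm e f) • incNeg M n x := by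
  rw [← incNeg_smul]
  exact actE_inc M e (Int.negSucc n) (Bimod.pcons f x)

theorem actF_incNeg (f : M.F) (n : ℕ) (x : M.F.pow n) :
    actF M f (incNeg M n x) = incNeg M (n + 1) (Bimod.pcons f x) := by
  cases n with
  | zero => exact actF_inc M f (Int.ofNat 0) x
  | succ n => exact actF_inc M f (Int.negSucc n) x

theorem actF_incPos (f : M.F) (n : ℕ) (e : M.E) (x : M.E.pow n) :
    actF M f (incPos M (n + 1) (Bimod.pcons e x)) = M.μ₂ (Bimod.tm f e) • incPos M n x := by
  rw [← incPos_smul]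
  exact actF_inc M f (Int.ofNat (n + 1)) (Bimod.pcons e x)

/-- Induction over homogeneous pure tensors. -/
theorem induction' {p : M.TensorAlg → Prop} (h0 : p 0) (hA : ∀ a : A, p (incPos M 0 (Bimod.pone _ a)))
    (hpos : ∀ n e x, p (incPos M (n + 1) (Bimod.pcons e x)))
    (hneg : ∀ n f x, p (incNeg M (n + 1) (Bimod.pcons f x)))
    (hadd : ∀ x y, p x → p y → p (x + y)) (x : M.TensorAlg) : p x := by
  induction x using TensorAlg.induction with
  | h0 => exact h0
  | hpos n x =>
    cases n with
    | zero =>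
      induction x using Bimod.pzero_induction with
      | h a => exact hA a
    | succ n =>
      induction x using Bimod.psucc_induction with
      | h0 => rw [map_zero]; exact h0
      | ht e x => exact hpos n e x
      | ha x y hx hy => rw [map_add]; exact hadd _ _ hx hy
  | hneg n x =>
    cases n with
    | zero =>
      induction x using Bimod.pzero_induction with
      | h a => exact hA a
    | succ n =>
      induction x using Bimod.psucc_induction with
      | h0 => rw [map_zero]; exact h0
      | ht e x => exact hneg n e x
      | ha x y hx hy => rw [map_add]; exact hadd _ _ hx hy
  | hadd x y hx hy => exact hadd _ _ hx hy

/-- Left multiplication by the elements of `A`. -/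
noncomputable def actA : A →+* AddMonoid.End M.TensorAlg := Module.toAddMonoidEnd A M.TensorAlg

theorem actE_smul (a : A) (e : M.E) : actE M (a • e) = actA M a * actE M e := by
  refine AddMonoidHom.ext fun y => ?_
  change actE M (a • e) y = a • actE M e y
  induction y using TensorAlg.induction' with
  | h0 => rw [map_zero, map_zero, smul_zero]
  | hA b => rw [actE_incPos, actE_incPos, ← incPos_smul, ← Bimod.smul_pcons]
  | hpos n e' x => rw [actE_incPos, actE_incPos, ← incPos_smul, ← Bimod.smul_pcons]
  | hneg n f x =>
    rw [actE_incNeg, actE_incNeg, ← Bimod.smul_tm, M.μ₁_left, mul_smul]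
  | hadd x y hx hy => rw [map_add, map_add, hx, hy, smul_add]

theorem actE_op_smul (a : A) (e : M.E) :
    actE M (MulOpposite.op a • e) = actE M e * actA M a := by
  refine AddMonoidHom.ext fun y => ?_
  change actE M (MulOpposite.op a • e) y = actE M e (a • y)
  induction y using TensorAlg.induction' with
  | h0 => rw [smul_zero, map_zero, map_zero]
  | hA b => rw [← incPos_smul, actE_incPos, actE_incPos, Bimod.pcons_smul]
  | hpos n e' x => rw [← incPos_smul, actE_incPos, actE_incPos, Bimod.pcons_smul]
  | hneg n f x =>
    rw [← incNeg_smul, Bimod.smul_pcons, actE_incNeg, actE_incNeg, Bimod.tm_smul]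
  | hadd x y hx hy => rw [smul_add, map_add, map_add, hx, hy]

theorem actF_smul (a : A) (f : M.F) : actF M (a • f) = actA M a * actF M f := by
  refine AddMonoidHom.ext fun y => ?_
  change actF M (a • f) y = a • actF M f y
  induction y using TensorAlg.induction' with
  | h0 => rw [map_zero, map_zero, smul_zero]
  | hA b =>
    change actF M (a • f) (incNeg M 0 (Bimod.pone _ b)) = a • actF M f (incNeg M 0 (Bimod.pone _ b))
    rw [actF_incNeg, actF_incNeg, ← incNeg_smul, ← Bimod.smul_pcons]
  | hpos n e x =>
    rw [actF_incPos, actF_incPos, ← Bimod.smul_tm, M.μ₂_left, mul_smul]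
  | hneg n f x => rw [actF_incNeg, actF_incNeg, ← incNeg_smul, ← Bimod.smul_pcons]
  | hadd x y hx hy => rw [map_add, map_add, hx, hy, smul_add]

theorem actF_op_smul (a : A) (f : M.F) :
    actF M (MulOpposite.op a • f) = actF M f * actA M a := by
  refine AddMonoidHom.ext fun y => ?_
  change actF M (MulOpposite.op a • f) y = actF M f (a • y)
  induction y using TensorAlg.induction' with
  | h0 => rw [smul_zero, map_zero, map_zero]
  | hA b =>
    change actF M (MulOpposite.op a • f) (incNeg M 0 (Bimod.pone _ b)) = actF M f (a • incNeg M 0 (Bimod.pone _ b))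
    rw [← incNeg_smul, actF_incNeg, actF_incNeg, Bimod.pcons_smul]
  | hpos n e x =>
    rw [← incPos_smul, Bimod.smul_pcons, actF_incPos, actF_incPos, Bimod.tm_smul]
  | hneg n f' x => rw [← incNeg_smul, actF_incNeg, actF_incNeg, Bimod.pcons_smul]
  | hadd x y hx hy => rw [smul_add, map_add, map_add, hx, hy]

theorem actE_mul_actF (e : M.E) (f : M.F) :
    actE M e * actF M f = actA M (M.μ₁ (Bimod.tm e f)) := by
  refine AddMonoidHom.ext fun y => ?_
  change actE M e (actF M f y) = M.μ₁ (Bimod.tm e f) • y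
  induction y using TensorAlg.induction' with
  | h0 => rw [map_zero, map_zero, smul_zero]
  | hA b =>
    change actE M e (actF M f (incNeg M 0 (Bimod.pone _ b))) = _ • incNeg M 0 (Bimod.pone _ b)
    rw [actF_incNeg, actE_incNeg]
  | hpos n e' x =>
    rw [actF_incPos, ← incPos_smul, actE_incPos, ← incPos_smul, Bimod.smul_pcons, M.assoc₁,
      Bimod.pcons_smul]
  | hneg n f' x => rw [actF_incNeg, actE_incNeg]
  | hadd x y hx hy => rw [map_add, map_add, hx, hy, smul_add]

theorem actF_mul_actE (f : M.F) (e : M.E) :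
    actF M f * actE M e = actA M (M.μ₂ (Bimod.tm f e)) := by
  refine AddMonoidHom.ext fun y => ?_
  change actF M f (actE M e y) = M.μ₂ (Bimod.tm f e) • y
  induction y using TensorAlg.induction' with
  | h0 => rw [map_zero, map_zero, smul_zero]
  | hA b => rw [actE_incPos, actF_incPos]
  | hpos n e' x => rw [actE_incPos, actF_incPos]
  | hneg n f' x =>
    rw [actE_incNeg, ← incNeg_smul, actF_incNeg, ← incNeg_smul, Bimod.smul_pcons, M.assoc₂,
      Bimod.pcons_smul]
  | hadd x y hx hy => rw [map_add, map_add, hx, hy, smul_add]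

end TensorAlg

/-- The extension of a multiplicative action of `E` to the tensor powers of `E`:
`e₁ ⊗ ⋯ ⊗ eₙ ↦ φ(e₁) ⋯ φ(eₙ)`. -/
noncomputable def powHomAux {R : Type*} [Ring R] (i : A →+* R) {E : Bimod A} (φ : E →+ R)
    (hl : ∀ (a : A) e, φ (a • e) = i a * φ e)
    (hr : ∀ (a : A) e, φ (MulOpposite.op a • e) = φ e * i a) :
    (n : ℕ) → {ψ : E.pow n →+ R // ∀ (a : A) x, ψ (a • x) = i a * ψ x}
  | 0 => ⟨i.toAddMonoidHom, map_mul i⟩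
  | n + 1 => ⟨Bimod.plift
      ((AddMonoidHom.compHom' (powHomAux i φ hl hr n).1).comp (AddMonoidHom.mul.comp φ))
      (fun e a x => by
        change φ (MulOpposite.op a • e) * (powHomAux i φ hl hr n).1 x
          = φ e * (powHomAux i φ hl hr n).1 (a • x)
        rw [hr, (powHomAux i φ hl hr n).2, mul_assoc]),
      fun a x => by
        induction x using Bimod.psucc_induction with
        | h0 => rw [smul_zero, map_zero, mul_zero]
        | ht e x =>
          change φ (a • e) * (powHomAux i φ hl hr n).1 x
            = i a * (φ e * (powHomAux i φ hl hr n).1 x)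
          rw [hl, mul_assoc]
        | ha x y hx hy => rw [smul_add, map_add, hx, hy, map_add, mul_add]⟩

namespace TensorAlg

variable (M : MoritaContext A)

/-- Left multiplication by `E^{⊗ n}`. -/
noncomputable def mulPos (n : ℕ) : M.E.pow n →+ AddMonoid.End M.TensorAlg :=
  (powHomAux (actA M) (actE M) (actE_smul M) (actE_op_smul M) n).1

/-- Left multiplication by `F^{⊗ n}`. -/
noncomputable def mulNeg (n : ℕ) : M.F.pow n →+ AddMonoid.End M.TensorAlg :=
  (powHomAux (actA M) (actF M) (actF_smul M) (actF_op_smul M) n).1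

/-- Left multiplication by `E^n`. -/
noncomputable def mul₀ : (n : ℤ) → M.piece n →+ AddMonoid.End M.TensorAlg
  | .ofNat n => mulPos M n
  | .negSucc n => mulNeg M (n + 1)

/-- The product of `⨁_n E^n`, as `x ↦ (y ↦ x y)`: it is `⊗` on factors of the same sign, and
`(e₁ ⊗ ⋯ ⊗ eₙ)(f₁ ⊗ ⋯ ⊗ fₘ)` contracts the innermost pair `eₙ ⊗ f₁` by `μ₁` and continues outwards
(and likewise with `μ₂` for the opposite order of signs). -/
noncomputable def mulHom : M.TensorAlg →+ AddMonoid.End M.TensorAlg :=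
  DirectSum.toAddMonoid (mul₀ M)

theorem mulHom_inc (n : ℤ) (x : M.piece n) : mulHom M (inc M n x) = mul₀ M n x :=
  DirectSum.toAddMonoid_of (mul₀ M) n x

theorem mulHom_incPos (n : ℕ) (x : M.E.pow n) : mulHom M (incPos M n x) = mulPos M n x :=
  mulHom_inc M (Int.ofNat n) x

theorem mulHom_incNeg (n : ℕ) (x : M.F.pow n) : mulHom M (incNeg M n x) = mulNeg M n x := by
  cases n with
  | zero => exact mulHom_inc M (Int.ofNat 0) x
  | succ n => exact mulHom_inc M (Int.negSucc n) x

theorem mulPos_tm (n : ℕ) (e : M.E) (x : M.E.pow n) :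
    mulPos M (n + 1) (Bimod.pcons e x) = actE M e * mulPos M n x := rfl

theorem mulNeg_tm (n : ℕ) (f : M.F) (x : M.F.pow n) :
    mulNeg M (n + 1) (Bimod.pcons f x) = actF M f * mulNeg M n x := rfl

theorem mulHom_smul (a : A) (y : M.TensorAlg) :
    mulHom M (a • y) = actA M a * mulHom M y := by
  induction y using TensorAlg.induction with
  | h0 => rw [smul_zero, map_zero, mul_zero]
  | hpos n x =>
    rw [← incPos_smul, mulHom_incPos, mulHom_incPos]
    exact (powHomAux (actA M) (actE M) (actE_smul M) (actE_op_smul M) n).2 a x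
  | hneg n x =>
    rw [← incNeg_smul, mulHom_incNeg, mulHom_incNeg]
    exact (powHomAux (actA M) (actF M) (actF_smul M) (actF_op_smul M) n).2 a x
  | hadd x y hx hy => rw [smul_add, map_add, hx, hy, map_add, mul_add]

theorem mulHom_actE (e : M.E) (y : M.TensorAlg) :
    mulHom M (actE M e y) = actE M e * mulHom M y := by
  induction y using TensorAlg.induction' with
  | h0 => rw [map_zero, map_zero, mul_zero]
  | hA a => rw [actE_incPos, mulHom_incPos, mulHom_incPos, mulPos_tm]
  | hpos n e' x => rw [actE_incPos, mulHom_incPos, mulHom_incPos, mulPos_tm]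
  | hneg n f x =>
    rw [actE_incNeg, mulHom_smul, mulHom_incNeg, mulHom_incNeg, mulNeg_tm, ← mul_assoc,
      actE_mul_actF]
  | hadd x y hx hy => rw [map_add, map_add, hx, hy, map_add, mul_add]

theorem mulHom_actF (f : M.F) (y : M.TensorAlg) :
    mulHom M (actF M f y) = actF M f * mulHom M y := by
  induction y using TensorAlg.induction' with
  | h0 => rw [map_zero, map_zero, mul_zero]
  | hA a =>
    change mulHom M (actF M f (incNeg M 0 (Bimod.pone _ a))) = actF M f * mulHom M (incNeg M 0 (Bimod.pone _ a))
    rw [actF_incNeg, mulHom_incNeg, mulHom_incNeg, mulNeg_tm]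
  | hpos n e x =>
    rw [actF_incPos, mulHom_smul, mulHom_incPos, mulHom_incPos, mulPos_tm, ← mul_assoc,
      actF_mul_actE]
  | hneg n f' x => rw [actF_incNeg, mulHom_incNeg, mulHom_incNeg, mulNeg_tm]
  | hadd x y hx hy => rw [map_add, map_add, hx, hy, map_add, mul_add]

/-- A set of operators that is closed under sums and under left multiplication by `E` and `F`,
and contains `A`, contains all left multiplications. -/
theorem mulHom_induction {p : AddMonoid.End M.TensorAlg → Prop} (h0 : p 0)
    (hA : ∀ a, p (actA M a)) (hE : ∀ e φ, p φ → p (actE M e * φ))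
    (hF : ∀ f φ, p φ → p (actF M f * φ)) (hadd : ∀ φ ψ, p φ → p ψ → p (φ + ψ))
    (x : M.TensorAlg) : p (mulHom M x) := by
  induction x using TensorAlg.induction with
  | h0 => rw [map_zero]; exact h0
  | hpos n x =>
    rw [mulHom_incPos]
    induction n with
    | zero =>
      induction x using Bimod.pzero_induction with
      | h a => exact hA a
    | succ n ih =>
      induction x using Bimod.psucc_induction with
      | h0 => rw [map_zero]; exact h0
      | ht e x => exact hE _ _ (ih x)
      | ha x y hx hy => rw [map_add]; exact hadd _ _ hx hy
  | hneg n x =>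
    rw [mulHom_incNeg]
    induction n with
    | zero =>
      induction x using Bimod.pzero_induction with
      | h a => exact hA a
    | succ n ih =>
      induction x using Bimod.psucc_induction with
      | h0 => rw [map_zero]; exact h0
      | ht e x => exact hF _ _ (ih x)
      | ha x y hx hy => rw [map_add]; exact hadd _ _ hx hy
  | hadd x y hx hy => rw [map_add]; exact hadd _ _ hx hy

theorem mulHom_mulHom (x y : M.TensorAlg) :
    mulHom M (mulHom M x y) = mulHom M x * mulHom M y := by
  revert y
  refine mulHom_induction M (p := fun φ => ∀ y, mulHom M (φ y) = φ * mulHom M y)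
    ?_ ?_ ?_ ?_ ?_ x
  · intro y; rw [AddMonoid.End.zero_apply, map_zero, zero_mul]
  · exact mulHom_smul M
  · intro e φ h y
    change mulHom M (actE M e (φ y)) = _
    rw [mulHom_actE, h, mul_assoc]
  · intro f φ h y
    change mulHom M (actF M f (φ y)) = _
    rw [mulHom_actF, h, mul_assoc]
  · intro φ ψ h1 h2 y
    change mulHom M (φ y + ψ y) = _
    rw [map_add, h1, h2, add_mul]

/-- The unit `1 ∈ A = E^0`. -/
noncomputable instance : One M.TensorAlg := ⟨incPos M 0 (Bimod.pone _ 1)⟩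

noncomputable instance : Mul M.TensorAlg := ⟨fun x y => mulHom M x y⟩

theorem mul_def (x y : M.TensorAlg) : x * y = mulHom M x y := rfl

theorem mulHom_one (x : M.TensorAlg) : mulHom M x (1 : M.TensorAlg) = x := by
  induction x using TensorAlg.induction with
  | h0 => rw [map_zero]; rfl
  | hpos n x =>
    rw [mulHom_incPos]
    induction n with
    | zero =>
      change (show A from x) • incPos M 0 (Bimod.pone _ 1) = _
      rw [← incPos_smul]
      exact congrArg (incPos M 0) (mul_one (show A from x))
    | succ n ih =>
      induction x using Bimod.psucc_induction with
      | h0 => rw [map_zero, map_zero]; rfl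
      | ht e x =>
        change actE M e (mulPos M n x 1) = _
        rw [ih, actE_incPos]
      | ha x y hx hy => rw [map_add, map_add]; exact congrArg₂ (· + ·) hx hy
  | hneg n x =>
    rw [mulHom_incNeg]
    induction n with
    | zero =>
      change (show A from x) • incNeg M 0 (Bimod.pone _ 1) = _
      rw [← incNeg_smul]
      exact congrArg (incNeg M 0) (mul_one (show A from x))
    | succ n ih =>
      induction x using Bimod.psucc_induction with
      | h0 => rw [map_zero, map_zero]; rfl
      | ht f x =>
        change actF M f (mulNeg M n x 1) = _
        rw [ih, actF_incNeg]
      | ha x y hx hy => rw [map_add, map_add]; exact congrArg₂ (· + ·) hx hy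
  | hadd x y hx hy => rw [map_add]; exact congrArg₂ (· + ·) hx hy

theorem mulHom_incPos_zero (a : A) (y : M.TensorAlg) :
    mulHom M (incPos M 0 (Bimod.pone _ a)) y = a • y := by
  rw [mulHom_incPos]; rfl

noncomputable instance : Ring M.TensorAlg where
  __ := (inferInstance : AddCommGroup M.TensorAlg)
  __ := (inferInstance : One M.TensorAlg)
  __ := (inferInstance : Mul M.TensorAlg)
  left_distrib x y z := map_add (mulHom M x) y z
  right_distrib x y z := by rw [mul_def, map_add]; rfl
  zero_mul x := by rw [mul_def, map_zero]; rfl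
  mul_zero x := map_zero (mulHom M x)
  mul_assoc x y z := by
    rw [mul_def, mul_def, mulHom_mulHom]; rfl
  one_mul x := (mulHom_incPos_zero M 1 x).trans (one_smul A x)
  mul_one := mulHom_one M
  zsmul := (inferInstance : AddCommGroup M.TensorAlg).zsmul

/-- The inclusion of `A` in degree `0`. -/
noncomputable def ofA : A →+* M.TensorAlg where
  toFun a := incPos M 0 (Bimod.pone _ a)
  map_one' := rfl
  map_mul' a b := by
    rw [mul_def, mulHom_incPos_zero, ← incPos_smul]; rfl
  map_zero' := map_zero (incPos M 0)
  map_add' := map_add (incPos M 0)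

theorem ofA_mul (a : A) (x : M.TensorAlg) : ofA M a * x = a • x := mulHom_incPos_zero M a x

theorem op_smul_one (a : A) : MulOpposite.op a • (1 : M.TensorAlg) = ofA M a := by
  change MulOpposite.op a • incPos M 0 (Bimod.pone _ 1) = incPos M 0 (Bimod.pone _ a)
  rw [← incPos_op_smul]
  exact congrArg (incPos M 0) (one_mul a)

theorem mulHom_op_smul (x y : M.TensorAlg) (a : A) :
    mulHom M x (MulOpposite.op a • y) = MulOpposite.op a • mulHom M x y := by
  revert y
  refine mulHom_induction M
    (p := fun φ => ∀ y, φ (MulOpposite.op a • y) = MulOpposite.op a • φ y) ?_ ?_ ?_ ?_ ?_ x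
  · intro y; rw [AddMonoid.End.zero_apply, AddMonoid.End.zero_apply, smul_zero]
  · intro b y
    change b • MulOpposite.op a • y = MulOpposite.op a • b • y
    induction y using TensorAlg.induction with
    | h0 => simp only [smul_zero]
    | hpos n x =>
      rw [← incPos_op_smul, ← incPos_smul, ← incPos_smul, ← incPos_op_smul, smul_comm]
    | hneg n x =>
      rw [← incNeg_op_smul, ← incNeg_smul, ← incNeg_smul, ← incNeg_op_smul, smul_comm]
    | hadd x y hx hy => rw [smul_add, smul_add, smul_add, smul_add, hx, hy]
  · intro e φ h y
    change actE M e (φ (MulOpposite.op a • y)) = MulOpposite.op a • actE M e (φ y)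
    rw [h]
    generalize φ y = z
    induction z using TensorAlg.induction' with
    | h0 => rw [smul_zero, map_zero, smul_zero]
    | hA b =>
      rw [← incPos_op_smul, actE_incPos, actE_incPos, ← incPos_op_smul, Bimod.op_smul_pcons]
    | hpos n e' x =>
      rw [← incPos_op_smul, actE_incPos, actE_incPos, ← incPos_op_smul, Bimod.op_smul_pcons,
        Bimod.op_smul_pcons, Bimod.op_smul_pcons]
    | hneg n f x =>
      rw [← incNeg_op_smul, Bimod.op_smul_pcons, actE_incNeg, actE_incNeg, ← incNeg_smul,
        ← incNeg_smul, ← incNeg_op_smul, smul_comm]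
    | hadd x y hx hy => rw [smul_add, map_add, map_add, smul_add, hx, hy]
  · intro f φ h y
    change actF M f (φ (MulOpposite.op a • y)) = MulOpposite.op a • actF M f (φ y)
    rw [h]
    generalize φ y = z
    induction z using TensorAlg.induction' with
    | h0 => rw [smul_zero, map_zero, smul_zero]
    | hA b =>
      change actF M f (MulOpposite.op a • incNeg M 0 (Bimod.pone _ b))
        = MulOpposite.op a • actF M f (incNeg M 0 (Bimod.pone _ b))
      rw [← incNeg_op_smul, actF_incNeg, actF_incNeg, ← incNeg_op_smul, Bimod.op_smul_pcons]
    | hpos n e x =>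
      rw [← incPos_op_smul, Bimod.op_smul_pcons, actF_incPos, actF_incPos, ← incPos_smul,
        ← incPos_smul, ← incPos_op_smul, smul_comm]
    | hneg n f' x =>
      rw [← incNeg_op_smul, actF_incNeg, actF_incNeg, ← incNeg_op_smul, Bimod.op_smul_pcons,
        Bimod.op_smul_pcons, Bimod.op_smul_pcons]
    | hadd x y hx hy => rw [smul_add, map_add, map_add, smul_add, hx, hy]
  · intro φ ψ h1 h2 y
    change φ _ + ψ _ = MulOpposite.op a • (φ y + ψ y)
    rw [h1, h2, smul_add]

theorem mul_ofA (x : M.TensorAlg) (a : A) : x * ofA M a = MulOpposite.op a • x := by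
  rw [← op_smul_one, mul_def, mulHom_op_smul, mulHom_one]

noncomputable instance : Algebra ℂ M.TensorAlg :=
  ((ofA M).comp (algebraMap ℂ A)).toAlgebra' (fun c x => by
    change ofA M (algebraMap ℂ A c) * x = x * ofA M (algebraMap ℂ A c)
    rw [ofA_mul, mul_ofA]
    induction x using TensorAlg.induction with
    | h0 => simp only [smul_zero]
    | hpos n x => rw [← incPos_smul, ← incPos_op_smul, Bimod.central]
    | hneg n x => rw [← incNeg_smul, ← incNeg_op_smul, Bimod.central]
    | hadd x y hx hy => rw [smul_add, smul_add, hx, hy])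

/-- The inclusion of `A` in degree `0`, as an algebra map. -/
noncomputable def ι : A →ₐ[ℂ] M.TensorAlg := { ofA M with commutes' := fun _ => rfl }

/-- The coaction in degree `n`. -/
noncomputable def coact₀ (n : ℤ) :
    M.piece n →+ M.TensorAlg ⊗[ℂ] AddMonoidAlgebra ℂ ℤ where
  toFun x := inc M n x ⊗ₜ[ℂ] AddMonoidAlgebra.single n (1 : ℂ)
  map_zero' := by rw [map_zero, TensorProduct.zero_tmul]
  map_add' x y := by rw [map_add, TensorProduct.add_tmul]

/-- The coaction as an additive map. -/
noncomputable def ρ₀ : M.TensorAlg →+ M.TensorAlg ⊗[ℂ] AddMonoidAlgebra ℂ ℤ :=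
  DirectSum.toAddMonoid (coact₀ M)

theorem ρ₀_inc (n : ℤ) (x : M.piece n) :
    ρ₀ M (inc M n x) = inc M n x ⊗ₜ[ℂ] AddMonoidAlgebra.single n (1 : ℂ) :=
  DirectSum.toAddMonoid_of (coact₀ M) n x

theorem ρ₀_incPos (n : ℕ) (x : M.E.pow n) :
    ρ₀ M (incPos M n x) = incPos M n x ⊗ₜ[ℂ] AddMonoidAlgebra.single (n : ℤ) (1 : ℂ) :=
  ρ₀_inc M (Int.ofNat n) x

theorem ρ₀_incNeg (n : ℕ) (x : M.F.pow n) :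
    ρ₀ M (incNeg M n x) = incNeg M n x ⊗ₜ[ℂ] AddMonoidAlgebra.single (-(n : ℤ)) (1 : ℂ) := by
  cases n with
  | zero => exact ρ₀_inc M (Int.ofNat 0) x
  | succ n => exact ρ₀_inc M (Int.negSucc n) x

theorem actE_one_mul (e : M.E) (x : M.TensorAlg) : actE M e 1 * x = actE M e x := by
  rw [mul_def, mulHom_actE]
  exact congrArg (actE M e) (one_mul x)

theorem actF_one_mul (f : M.F) (x : M.TensorAlg) : actF M f 1 * x = actF M f x := by
  rw [mul_def, mulHom_actF]
  exact congrArg (actF M f) (one_mul x)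

theorem ρ₀_smul (a : A) (y : M.TensorAlg) :
    ρ₀ M (a • y) = (ofA M a ⊗ₜ[ℂ] (1 : AddMonoidAlgebra ℂ ℤ)) * ρ₀ M y := by
  induction y using TensorAlg.induction with
  | h0 => rw [smul_zero, map_zero, mul_zero]
  | hpos n x =>
    rw [← incPos_smul, ρ₀_incPos, ρ₀_incPos, Algebra.TensorProduct.tmul_mul_tmul, one_mul,
      ofA_mul, incPos_smul]
  | hneg n x =>
    rw [← incNeg_smul, ρ₀_incNeg, ρ₀_incNeg, Algebra.TensorProduct.tmul_mul_tmul, one_mul,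
      ofA_mul, incNeg_smul]
  | hadd x y hx hy => rw [smul_add, map_add, hx, hy, map_add, mul_add]

theorem ρ₀_actE (e : M.E) (y : M.TensorAlg) :
    ρ₀ M (actE M e y)
      = (actE M e 1 ⊗ₜ[ℂ] AddMonoidAlgebra.single (1 : ℤ) (1 : ℂ)) * ρ₀ M y := by
  induction y using TensorAlg.induction' with
  | h0 => rw [map_zero, map_zero, mul_zero]
  | hA b =>
    rw [ρ₀_incPos, Algebra.TensorProduct.tmul_mul_tmul, actE_one_mul, actE_incPos, ρ₀_incPos,
      AddMonoidAlgebra.single_mul_single, one_mul]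
    rfl
  | hpos n e' x =>
    rw [ρ₀_incPos, Algebra.TensorProduct.tmul_mul_tmul, actE_one_mul, actE_incPos, ρ₀_incPos,
      AddMonoidAlgebra.single_mul_single, one_mul]
    congr 2
    push_cast
    ring
  | hneg n f x =>
    rw [ρ₀_incNeg, Algebra.TensorProduct.tmul_mul_tmul, actE_one_mul, actE_incNeg,
      ← incNeg_smul, ρ₀_incNeg, AddMonoidAlgebra.single_mul_single, one_mul]
    congr 2
    push_cast
    ring
  | hadd x y hx hy => rw [map_add, map_add, hx, hy, map_add, mul_add]

theorem ρ₀_actF (f : M.F) (y : M.TensorAlg) :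
    ρ₀ M (actF M f y)
      = (actF M f 1 ⊗ₜ[ℂ] AddMonoidAlgebra.single (-1 : ℤ) (1 : ℂ)) * ρ₀ M y := by
  induction y using TensorAlg.induction' with
  | h0 => rw [map_zero, map_zero, mul_zero]
  | hA b =>
    change ρ₀ M (actF M f (incNeg M 0 (Bimod.pone _ b)))
      = (actF M f 1 ⊗ₜ[ℂ] AddMonoidAlgebra.single (-1 : ℤ) (1 : ℂ))
        * ρ₀ M (incNeg M 0 (Bimod.pone _ b))
    rw [ρ₀_incNeg, Algebra.TensorProduct.tmul_mul_tmul, actF_one_mul, actF_incNeg, ρ₀_incNeg,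
      AddMonoidAlgebra.single_mul_single, one_mul]
    rfl
  | hpos n e x =>
    rw [ρ₀_incPos, Algebra.TensorProduct.tmul_mul_tmul, actF_one_mul, actF_incPos,
      ← incPos_smul, ρ₀_incPos, AddMonoidAlgebra.single_mul_single, one_mul]
    congr 2
    push_cast
    ring
  | hneg n f' x =>
    rw [ρ₀_incNeg, Algebra.TensorProduct.tmul_mul_tmul, actF_one_mul, actF_incNeg, ρ₀_incNeg,
      AddMonoidAlgebra.single_mul_single, one_mul]
    congr 2
    push_cast
    ring
  | hadd x y hx hy => rw [map_add, map_add, hx, hy, map_add, mul_add]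

theorem ρ₀_ofA (a : A) : ρ₀ M (ofA M a) = ofA M a ⊗ₜ[ℂ] (1 : AddMonoidAlgebra ℂ ℤ) :=
  ρ₀_incPos M 0 (Bimod.pone _ a)

theorem ρ₀_mul (x y : M.TensorAlg) : ρ₀ M (x * y) = ρ₀ M x * ρ₀ M y := by
  have key : ∀ y, ρ₀ M (mulHom M x y) = ρ₀ M (mulHom M x 1) * ρ₀ M y := by
    refine mulHom_induction M
      (p := fun φ => ∀ y, ρ₀ M (φ y) = ρ₀ M (φ 1) * ρ₀ M y) ?_ ?_ ?_ ?_ ?_ x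
    · intro y
      rw [AddMonoid.End.zero_apply, AddMonoid.End.zero_apply, map_zero, zero_mul]
    · intro a y
      change ρ₀ M (a • y) = ρ₀ M (a • 1) * ρ₀ M y
      rw [ρ₀_smul, ← ofA_mul, mul_one, ρ₀_ofA]
    · intro e φ h y
      change ρ₀ M (actE M e (φ y)) = ρ₀ M (actE M e (φ 1)) * ρ₀ M y
      rw [ρ₀_actE, ρ₀_actE, h, mul_assoc]
    · intro f φ h y
      change ρ₀ M (actF M f (φ y)) = ρ₀ M (actF M f (φ 1)) * ρ₀ M y
      rw [ρ₀_actF, ρ₀_actF, h, mul_assoc]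
    · intro φ ψ h1 h2 y
      change ρ₀ M (φ y + ψ y) = ρ₀ M (φ 1 + ψ 1) * ρ₀ M y
      rw [map_add, h1, h2, map_add, add_mul]
  rw [mul_def, key, mulHom_one]

/-- The coaction of the group algebra of `ℤ`: `x ↦ x ⊗ n` for `x` of degree `n`. -/
noncomputable def ρ : M.TensorAlg →ₐ[ℂ] M.TensorAlg ⊗[ℂ] AddMonoidAlgebra ℂ ℤ where
  toFun := ρ₀ M
  map_one' := ρ₀_ofA M 1
  map_mul' := ρ₀_mul M
  map_zero' := map_zero (ρ₀ M)
  map_add' := map_add (ρ₀ M)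
  commutes' c := ρ₀_ofA M (algebraMap ℂ A c)

theorem ρ_inc (n : ℤ) (x : M.piece n) :
    ρ M (inc M n x) = inc M n x ⊗ₜ[ℂ] AddMonoidAlgebra.single n (1 : ℂ) := ρ₀_inc M n x

end TensorAlg

end MoritaContext

/-! ## Hopf–Galois extensions -/

/-- A right `H`-comodule algebra `C` with a unital algebra map `ι : A → C` into its coinvariants. -/
structure ComodAlg (A : Type u) [Ring A] [Algebra ℂ A] (H : Type) [Ring H] [HopfAlgebra ℂ H] where
  carrier : Type u
  [ring : Ring carrier]
  [algebra : Algebra ℂ carrier]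
  ι : A →ₐ[ℂ] carrier
  /-- the coaction -/
  ρ : carrier →ₐ[ℂ] carrier ⊗[ℂ] H
  coassoc : ∀ c, TensorProduct.assoc ℂ carrier H H (ρ.toLinearMap.rTensor H (ρ c))
    = (Coalgebra.comul (R := ℂ) (A := H)).lTensor carrier (ρ c)
  counit : ∀ c, TensorProduct.rid ℂ carrier
    ((Coalgebra.counit (R := ℂ) (A := H)).lTensor carrier (ρ c)) = c
  ρ_ι : ∀ a, ρ (ι a) = ι a ⊗ₜ[ℂ] 1

namespace ComodAlg

attribute [instance] ComodAlg.ring ComodAlg.algebra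

variable {A : Type u} [Ring A] [Algebra ℂ A] {H : Type} [Ring H] [HopfAlgebra ℂ H]

/-- `C` as an `A`-bimodule. -/
def bimod (C : ComodAlg A H) : Bimod A where
  carrier := C.carrier
  leftModule := Module.compHom C.carrier C.ι.toRingHom
  rightModule := Module.compHom C.carrier C.ι.toRingHom.op
  smulComm :=
    letI := Module.compHom C.carrier C.ι.toRingHom
    letI := Module.compHom C.carrier C.ι.toRingHom.op
    ⟨fun a b x => (mul_assoc (C.ι a) x (C.ι b.unop)).symm⟩
  central c x := by
    change C.ι (algebraMap ℂ A c) * x = x * C.ι (algebraMap ℂ A c)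
    rw [AlgHom.commutes, Algebra.commutes]

/-- The canonical map `can : C ⊗_A C → C ⊗ H`, `can(c' ⊗ c) = (c' ⊗ 1) ρ(c)`. -/
noncomputable def can (C : ComodAlg A H) : C.bimod.tensor C.bimod →+ C.carrier ⊗[ℂ] H :=
  Bimod.tlift
    ((AddMonoidHom.compHom' C.ρ.toRingHom.toAddMonoidHom).comp
      (AddMonoidHom.mul.comp
        (Algebra.TensorProduct.includeLeft (R := ℂ) (S := ℂ) (A := C.carrier)
          (B := H)).toRingHom.toAddMonoidHom))
    (fun (c' : C.carrier) a (c : C.carrier) => by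
      change ((c' * C.ι a) ⊗ₜ[ℂ] (1 : H)) * C.ρ c = (c' ⊗ₜ[ℂ] (1 : H)) * C.ρ (C.ι a * c)
      rw [map_mul, C.ρ_ι, ← mul_assoc, Algebra.TensorProduct.tmul_mul_tmul, one_mul])

/-- `C` is an `H`-Hopf–Galois extension of `A`: the map `ι` identifies `A` with the
subalgebra of all coinvariants of `C`, and the canonical map is bijective. -/
structure IsHopfGalois (C : ComodAlg A H) : Prop where
  ι_injective : Function.Injective C.ι
  coinvariants : ∀ c : C.carrier, C.ρ c = c ⊗ₜ[ℂ] 1 → c ∈ Set.range C.ι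
  can_bijective : Function.Bijective C.can

/-- Isomorphism of comodule algebras under `A`. -/
def Isomorphic (C D : ComodAlg A H) : Prop :=
  ∃ f : C.carrier ≃ₐ[ℂ] D.carrier, (∀ a, f (C.ι a) = D.ι a) ∧
    ∀ c, D.ρ (f c) = Algebra.TensorProduct.map f.toAlgHom (AlgHom.id ℂ H) (C.ρ c)

/-- The degree `n` part `C_n = {c | ρ(c) = c ⊗ n}` of a comodule algebra over the group algebra
of `ℤ`. -/
def degreeSubgroup (C : ComodAlg A (AddMonoidAlgebra ℂ ℤ)) (n : ℤ) : AddSubgroup C.carrier where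
  carrier := {c | C.ρ c = c ⊗ₜ[ℂ] AddMonoidAlgebra.single n (1 : ℂ)}
  zero_mem' := by
    rw [Set.mem_ofPred_eq, map_zero, TensorProduct.zero_tmul]
  add_mem' {x y} hx hy := by
    rw [Set.mem_ofPred_eq] at *
    rw [map_add, hx, hy, TensorProduct.add_tmul]
  neg_mem' {x} hx := by
    rw [Set.mem_ofPred_eq] at *
    rw [map_neg, hx, TensorProduct.neg_tmul]

theorem ι_mul_mem (C : ComodAlg A (AddMonoidAlgebra ℂ ℤ)) (n : ℤ) (a : A)
    (c : C.degreeSubgroup n) : C.ι a * (c : C.carrier) ∈ C.degreeSubgroup n := by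
  have h : C.ρ (c : C.carrier) = _ := c.2
  change C.ρ _ = _
  rw [map_mul, h, C.ρ_ι, Algebra.TensorProduct.tmul_mul_tmul, one_mul]

theorem mul_ι_mem (C : ComodAlg A (AddMonoidAlgebra ℂ ℤ)) (n : ℤ) (a : A)
    (c : C.degreeSubgroup n) : (c : C.carrier) * C.ι a ∈ C.degreeSubgroup n := by
  have h : C.ρ (c : C.carrier) = _ := c.2
  change C.ρ _ = _
  rw [map_mul, h, C.ρ_ι, Algebra.TensorProduct.tmul_mul_tmul, mul_one]

instance degreeLeftModule (C : ComodAlg A (AddMonoidAlgebra ℂ ℤ)) (n : ℤ) :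
    Module A (C.degreeSubgroup n) where
  smul a c := ⟨C.ι a * c, C.ι_mul_mem n a c⟩
  one_smul c := Subtype.ext (by change C.ι 1 * (c : C.carrier) = c; rw [map_one, one_mul])
  mul_smul a b c := Subtype.ext (by
    change C.ι (a * b) * (c : C.carrier) = C.ι a * (C.ι b * c); rw [map_mul, mul_assoc])
  smul_zero a := Subtype.ext (mul_zero (C.ι a))
  smul_add a x y := Subtype.ext (mul_add (C.ι a) _ _)
  add_smul a b c := Subtype.ext (by
    change C.ι (a + b) * (c : C.carrier) = C.ι a * c + C.ι b * c; rw [map_add, add_mul])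
  zero_smul c := Subtype.ext (by
    change C.ι 0 * (c : C.carrier) = 0; rw [map_zero, zero_mul])

instance degreeRightModule (C : ComodAlg A (AddMonoidAlgebra ℂ ℤ)) (n : ℤ) :
    Module Aᵐᵒᵖ (C.degreeSubgroup n) where
  smul a c := ⟨c * C.ι a.unop, C.mul_ι_mem n a.unop c⟩
  one_smul c := Subtype.ext (by change (c : C.carrier) * C.ι 1 = c; rw [map_one, mul_one])
  mul_smul a b c := Subtype.ext (by
    change (c : C.carrier) * C.ι (b.unop * a.unop) = c * C.ι b.unop * C.ι a.unop
    rw [map_mul, mul_assoc])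
  smul_zero a := Subtype.ext (zero_mul (C.ι a.unop))
  smul_add a x y := Subtype.ext (add_mul _ _ (C.ι a.unop))
  add_smul a b c := Subtype.ext (by
    change (c : C.carrier) * C.ι (a.unop + b.unop) = c * C.ι a.unop + c * C.ι b.unop
    rw [map_add, mul_add])
  zero_smul c := Subtype.ext (by
    change (c : C.carrier) * C.ι 0 = 0; rw [map_zero, mul_zero])

/-- `C_n` as an `A`-bimodule. -/
def degree (C : ComodAlg A (AddMonoidAlgebra ℂ ℤ)) (n : ℤ) : Bimod A where
  carrier := C.degreeSubgroup n
  smulComm := ⟨fun a b c => Subtype.ext (mul_assoc (C.ι a) c (C.ι b.unop)).symm⟩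
  central c x := Subtype.ext (by
    change C.ι (algebraMap ℂ A c) * (x : C.carrier) = x * C.ι (algebraMap ℂ A c)
    rw [AlgHom.commutes, Algebra.commutes])

end ComodAlg

/-! ## The `ℤ`-graded tensor algebra of a weak left line module -/

/-- `⨁_n E^n` as a comodule algebra over the group algebra of `ℤ`. -/
noncomputable def MoritaContext.tensorAlg {A : Type u} [Ring A] [Algebra ℂ A]
    (M : MoritaContext A) : ComodAlg A (AddMonoidAlgebra ℂ ℤ) where
  carrier := M.TensorAlg
  ι := TensorAlg.ι M
  ρ := TensorAlg.ρ M
  coassoc c := by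
    induction c using TensorAlg.inc_induction with
    | h0 => simp only [map_zero]
    | hinc n x =>
      rw [TensorAlg.ρ_inc, LinearMap.rTensor_tmul, LinearMap.lTensor_tmul,
        AlgHom.toLinearMap_apply, TensorAlg.ρ_inc, TensorProduct.assoc_tmul,
        AddMonoidAlgebra.comul_single]
      simp
    | hadd x y hx hy => rw [map_add, map_add, map_add, hx, hy, map_add]
  counit c := by
    induction c using TensorAlg.inc_induction with
    | h0 => simp only [map_zero]
    | hinc n x =>
      rw [TensorAlg.ρ_inc, LinearMap.lTensor_tmul, AddMonoidAlgebra.counit_single]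
      simp
    | hadd x y hx hy => rw [map_add, map_add, map_add, hx, hy]
  ρ_ι a := TensorAlg.ρ₀_ofA M a

namespace Bimod

variable {A : Type u} [Ring A] [Algebra ℂ A]

/-- `ev ⊗ id` applied to `e ⊗ β`. -/
noncomputable def contract (L : Bimod A) (e : L) : L.dual.tensor L →+ L :=
  tlift ((smulAddHom A L).comp (appHom L e)) (fun α a x => by
    change (app α e * a) • x = app α e • a • x
    rw [mul_smul])

theorem contract_tm (L : Bimod A) (e : L) (α : L.dual) (x : L) :
    L.contract e (tm α x) = app α e • x := rfl

theorem contract_smul (L : Bimod A) (e : L) (a : A) (β : L.dual.tensor L) :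
    L.contract e (a • β) = L.contract (MulOpposite.op a • e) β := by
  induction β using tensor_induction with
  | h0 => rw [smul_zero, map_zero, map_zero]
  | ht α x => rfl
  | ha x y hx hy => rw [smul_add, map_add, hx, hy, map_add]

theorem contract_op_smul (L : Bimod A) (e : L) (a : A) (β : L.dual.tensor L) :
    L.contract e (MulOpposite.op a • β) = MulOpposite.op a • L.contract e β := by
  induction β using tensor_induction with
  | h0 => rw [smul_zero, map_zero, smul_zero]
  | ht α x => rw [op_smul_tm, contract_tm, contract_tm, smul_comm]
  | ha x y hx hy => rw [smul_add, map_add, hx, hy, map_add, smul_add]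

theorem contract_coev (L : Bimod A) (h : L.IsFGP) (e : L) (a : A) :
    L.contract e (L.coev h a) = MulOpposite.op a • e := by
  change L.contract e (a • ∑ i, tm ((Classical.choice h).cov i) ((Classical.choice h).vec i)) = _
  rw [contract_smul, map_sum]
  exact (Classical.choice h).sum_eq _

/-- `coev⁻¹ : L° ⊗_A L → A`. -/
noncomputable def coevInv {L : Bimod A} (h : L.IsWeakLeftLine) : L.dual.tensor L →+ A :=
  (AddEquiv.ofBijective (L.coev h.fgp) h.coev_bijective).symm.toAddMonoidHom

theorem op_coevInv_smul {L : Bimod A} (h : L.IsWeakLeftLine) (e : L) (β : L.dual.tensor L) :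
    MulOpposite.op (coevInv h β) • e = L.contract e β := by
  rw [← contract_coev L h.fgp]
  congr 1
  exact (AddEquiv.ofBijective (L.coev h.fgp) h.coev_bijective).apply_symm_apply β

theorem faithful {L : Bimod A} (h : L.IsWeakLeftLine) {a b : A}
    (hab : ∀ e : L, MulOpposite.op a • e = MulOpposite.op b • e) : a = b := by
  refine h.coev_bijective.1 ?_
  change (Classical.choice h.fgp).coev a = (Classical.choice h.fgp).coev b
  rw [DualBasis.coev_apply, DualBasis.coev_apply]
  refine Finset.sum_congr rfl fun i _ => ?_
  congr 2
  refine dual_ext fun e => ?_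
  rw [smul_app, smul_app, hab]

/-- The Morita context `(A, A, L, L°, ev, coev⁻¹)` of a weak left line module `L`. -/
noncomputable def context (L : Bimod A) (h : L.IsWeakLeftLine) : MoritaContext A where
  E := L
  F := L.dual
  μ₁ := L.ev
  μ₂ := coevInv h
  μ₁_left a x := by
    induction x using tensor_induction with
    | h0 => rw [smul_zero, map_zero, mul_zero]
    | ht e α => exact app_smul α a e
    | ha x y hx hy => rw [smul_add, map_add, hx, hy, map_add, mul_add]
  μ₁_right a x := by
    induction x using tensor_induction with
    | h0 => rw [smul_zero, map_zero, zero_mul]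
    | ht e α => rfl
    | ha x y hx hy => rw [smul_add, map_add, hx, hy, map_add, add_mul]
  μ₂_left a x := faithful h fun e => by
    rw [MulOpposite.op_mul, mul_smul, op_coevInv_smul, op_coevInv_smul, contract_smul]
  μ₂_right a x := faithful h fun e => by
    rw [MulOpposite.op_mul, mul_smul, op_coevInv_smul, op_coevInv_smul, contract_op_smul]
  assoc₁ e α e' := by
    rw [op_coevInv_smul]; rfl
  assoc₂ α e α' := dual_ext fun x => by
    rw [smul_app, op_coevInv_smul, contract_tm, app_smul]; rfl

/-- The `ℤ`-graded tensor algebra `T_ℤ(L) = ⋯ ⊕ L° ⊗_A L° ⊕ L° ⊕ A ⊕ L ⊕ L ⊗_A L ⊕ ⋯`, with the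
product given by `⊗_A`, `ev` and `coev⁻¹`. -/
noncomputable def TZ (L : Bimod A) (h : L.IsWeakLeftLine) : ComodAlg A (AddMonoidAlgebra ℂ ℤ) :=
  (L.context h).tensorAlg

end Bimod

/-! ## Isomorphism classes -/

section Classes

variable (A : Type u) [Ring A] [Algebra ℂ A]

/-- The `ℂ`-linear autoequivalences of the category of left `A`-modules, up to natural
isomorphism. -/
def autoequivalenceSetoid : Setoid (MoritaEquivalence ℂ A A) where
  r P Q := Nonempty (P.eqv.functor ≅ Q.eqv.functor)
  iseqv :=
    { refl := fun _ => ⟨Iso.refl _⟩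
      symm := fun ⟨f⟩ => ⟨f.symm⟩
      trans := fun ⟨f⟩ ⟨g⟩ => ⟨f.trans g⟩ }

/-- Left line modules over `A`. -/
def LeftLineModule : Type (u + 1) := {L : Bimod A // L.IsLeftLine}

/-- Left line modules up to isomorphism of bimodules. -/
def lineModuleSetoid : Setoid (LeftLineModule A) where
  r L N := L.1.Isomorphic N.1
  iseqv :=
    { refl := fun L => ⟨LinearEquiv.refl A L.1, fun _ _ => rfl⟩
      symm := fun {L N} ⟨f, hf⟩ => ⟨f.symm, fun a x => by
        rw [LinearEquiv.symm_apply_eq, hf, LinearEquiv.apply_symm_apply]⟩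
      trans := fun ⟨f, hf⟩ ⟨g, hg⟩ => ⟨f.trans g, fun a x => by
        rw [LinearEquiv.trans_apply, hf, hg, LinearEquiv.trans_apply]⟩ }

/-- Hopf–Galois extensions of `A` for the group algebra of `ℤ`. -/
def HopfGaloisExtension : Type (u + 1) :=
  {C : ComodAlg A (AddMonoidAlgebra ℂ ℤ) // C.IsHopfGalois}

/-- Hopf–Galois extensions of `A` up to isomorphism. -/
def hopfGaloisSetoid : Setoid (HopfGaloisExtension A) where
  r C D := C.1.Isomorphic D.1
  iseqv :=
    { refl := fun C => ⟨AlgEquiv.refl, fun _ => rfl, fun c => by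
        change _ = Algebra.TensorProduct.map (AlgHom.id ℂ _) (AlgHom.id ℂ _) (C.1.ρ c)
        rw [Algebra.TensorProduct.map_id]; rfl⟩
      symm := fun {C D} ⟨f, hf, hρ⟩ => ⟨f.symm, fun a => by
          rw [AlgEquiv.symm_apply_eq, hf], fun c => by
          obtain ⟨c, rfl⟩ := f.surjective c
          rw [AlgEquiv.symm_apply_apply, hρ]
          change _ = (((Algebra.TensorProduct.map f.symm.toAlgHom (AlgHom.id ℂ _)).comp
            (Algebra.TensorProduct.map f.toAlgHom (AlgHom.id ℂ _))) (C.1.ρ c))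
          rw [← Algebra.TensorProduct.map_comp]
          have h1 : f.symm.toAlgHom.comp f.toAlgHom = AlgHom.id ℂ _ := by
            ext x; exact f.symm_apply_apply x
          rw [h1, AlgHom.id_comp, Algebra.TensorProduct.map_id]; rfl⟩
      trans := fun {C D K} ⟨f, hf, hρ⟩ ⟨g, hg, hσ⟩ => ⟨f.trans g, fun a => by
          rw [AlgEquiv.trans_apply, hf, hg], fun c => by
          rw [AlgEquiv.trans_apply, hσ, hρ]
          change (((Algebra.TensorProduct.map g.toAlgHom (AlgHom.id ℂ _)).comp
            (Algebra.TensorProduct.map f.toAlgHom (AlgHom.id ℂ _))) (C.1.ρ c)) = _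
          rw [← Algebra.TensorProduct.map_comp]
          rfl⟩ }

end Classes

end NCLine

open NCLine

/-!
The three collections are compared through strict Morita contexts `(A, A, E, F, μ₁, μ₂)`.

In such a context one may write `1 = ∑ μ₂(fᵢ ⊗ eᵢ)`, and the associativity of the pairings then gives
`e = ∑ μ₁(e ⊗ fᵢ) eᵢ`. Hence the `eᵢ` and `μ₁(- ⊗ fᵢ)` form a dual basis of `E`, the bimodule `F`
is identified with `E°`, and `μ₁`, `μ₂` with `ev` and `coev⁻¹`, so that `E` is a left line module
(`MoritaContext.IsStrict.isLeftLine`). The same expression of `1` shows that the contraction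
`F ⊗ (E ⊗ X) → X` is bijective, so that `E ⊗ -` and `F ⊗ -` are inverse equivalences
(`MoritaContext.tensorEquivalence`).

Conversely, let `F` be a `ℂ`-linear autoequivalence with inverse `G`. The comparison map
`F(A) ⊗ X → F(X)` is an isomorphism, with an inverse obtained from the adjunction between `F` and
`G` (`wattsNatIso`). Together with the counit and the unit it gives pairings
`F(A) ⊗ G(A) → A` and `G(A) ⊗ F(A) → A`, whose compatibility is the triangle identity; so `F(A)` is
the first bimodule of a strict Morita context.

A comodule algebra over the group algebra of `ℤ` is a `ℤ`-graded algebra. If its coinvariants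
are `A`, then it is a Hopf–Galois extension if and only if it is strongly graded, that is,
`1 ∈ C₋ₙ Cₙ` for all `n` (`ComodAlg.IsHopfGalois.unitAt`, `ComodAlg.can_bijective_of_unitAt`).
In that case the products `C₁ ⊗ C₋₁ → C₀` and `C₋₁ ⊗ C₁ → C₀` form a strict Morita context, so `C₁`
is a left line module. For the tensor algebra of a strict Morita context, `1 ∈ C₋ₙ Cₙ` holds for
`n = ±1` because the pairings are surjective, and therefore for all `n`. Finally, an isomorphism
`L ≅ C₁` extends to an algebra map `T_ℤ(L) → C` by the universal property of the tensor algebra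
(`MoritaContext.HomTo.extAlgHom`), and every map of Hopf–Galois extensions of `A` is bijective
(`ComodAlg.bijective_of_comod_map`), so that `T_ℤ(L) ≅ C`.
-/

namespace NCLine

/-! ### Strict Morita contexts and left line modules -/

/-- Every element of a tensor product over `A` is a finite sum of pure tensors. -/
theorem BalTensor.exists_sum_tmul {A : Type u} [Ring A] {E : Type v} {F : Type w}
    [AddCommGroup E] [Module Aᵐᵒᵖ E] [AddCommGroup F] [Module A F] (z : BalTensor A E F) :
    ∃ (I : Type) (_ : Fintype I) (e : I → E) (f : I → F),
      z = ∑ i, BalTensor.tmul A (e i) (f i) := by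
  induction z using BalTensor.induction with
  | h0 => exact ⟨Empty, inferInstance, Empty.elim, Empty.elim, by simp⟩
  | ht e f => exact ⟨Unit, inferInstance, fun _ => e, fun _ => f, by simp⟩
  | ha x y hx hy =>
    obtain ⟨I, _, e, f, rfl⟩ := hx
    obtain ⟨J, _, e', f', rfl⟩ := hy
    exact ⟨I ⊕ J, inferInstance, Sum.elim e e', Sum.elim f f', by simp [Fintype.sum_sum_type]⟩

namespace Bimod

variable {A : Type u} [Ring A] [Algebra ℂ A]

theorem exists_sum_tm {E F : Bimod A} (z : E.tensor F) :
    ∃ (I : Type) (_ : Fintype I) (e : I → E) (f : I → F), z = ∑ i, tm (e i) (f i) :=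
  BalTensor.exists_sum_tmul z

end Bimod

namespace MoritaContext

variable {A : Type u} [Ring A] [Algebra ℂ A]

/-- The Morita context with the two bimodules interchanged. -/
def swap (M : MoritaContext A) : MoritaContext A where
  E := M.F
  F := M.E
  μ₁ := M.μ₂
  μ₂ := M.μ₁
  μ₁_left := M.μ₂_left
  μ₁_right := M.μ₂_right
  μ₂_left := M.μ₁_left
  μ₂_right := M.μ₁_right
  assoc₁ := M.assoc₂
  assoc₂ := M.assoc₁

theorem IsStrict.swap {M : MoritaContext A} (h : M.IsStrict) : M.swap.IsStrict := ⟨h.2, h.1⟩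

variable (M : MoritaContext A)

theorem IsStrict.exists_sum_μ₂_eq_one {M : MoritaContext A} (h : M.IsStrict) :
    ∃ (I : Type) (_ : Fintype I) (f : I → M.F) (e : I → M.E),
      ∑ i, M.μ₂ (Bimod.tm (f i) (e i)) = 1 := by
  obtain ⟨z, hz⟩ := h.2 1
  obtain ⟨I, _, f, e, rfl⟩ := Bimod.exists_sum_tm z
  exact ⟨I, inferInstance, f, e, by rw [← hz, map_sum]⟩

theorem IsStrict.exists_sum_μ₁_eq_one {M : MoritaContext A} (h : M.IsStrict) :
    ∃ (I : Type) (_ : Fintype I) (e : I → M.E) (f : I → M.F),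
      ∑ i, M.μ₁ (Bimod.tm (e i) (f i)) = 1 := h.swap.exists_sum_μ₂_eq_one

/-- The two ways of contracting `E ⊗ F ⊗ E ⊗ F` to `E ⊗ F` agree. -/
theorem μ₁_smul_eq (x y : M.E.tensor M.F) : M.μ₁ x • y = MulOpposite.op (M.μ₁ y) • x := by
  induction x using Bimod.tensor_induction with
  | h0 => rw [map_zero, zero_smul, smul_zero]
  | ha x x' hx hx' => rw [map_add, add_smul, hx, hx', smul_add]
  | ht e f =>
    induction y using Bimod.tensor_induction with
    | h0 => rw [map_zero, MulOpposite.op_zero, zero_smul, smul_zero]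
    | ha y y' hy hy' => rw [map_add, MulOpposite.op_add, add_smul, smul_add, hy, hy']
    | ht e' f' =>
      rw [Bimod.smul_tm, M.assoc₁, Bimod.tm_smul, M.assoc₂, Bimod.op_smul_tm]

/-- A surjective pairing is injective: if `μ₁(y) = 1`, then `x = x μ₁(y) = μ₁(x) y`. -/
theorem μ₁_injective (h : Function.Surjective M.μ₁) : Function.Injective M.μ₁ := by
  obtain ⟨y, hy⟩ := h 1
  refine (injective_iff_map_eq_zero _).2 fun x hx => ?_
  have := M.μ₁_smul_eq x y
  rwa [hx, hy, zero_smul, MulOpposite.op_one, one_smul, eq_comm] at this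

/-- The map `F → E°`, `f ↦ μ₁(- ⊗ f)`. -/
noncomputable def toDual (f : M.F) : M.E.dual :=
  show M.E →ₗ[A] A from
  { toFun := fun e => M.μ₁ (Bimod.tm e f)
    map_add' := fun e e' => by rw [map_add, AddMonoidHom.add_apply, map_add]
    map_smul' := fun a e => by rw [← Bimod.smul_tm, M.μ₁_left, RingHom.id_apply, smul_eq_mul] }

theorem app_toDual (f : M.F) (e : M.E) : Bimod.app (M.toDual f) e = M.μ₁ (Bimod.tm e f) := rfl

theorem toDual_op_smul (a : A) (f : M.F) :
    M.toDual (MulOpposite.op a • f) = MulOpposite.op a • M.toDual f :=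
  Bimod.dual_ext fun e => by
    rw [Bimod.app_op_smul, app_toDual, app_toDual, ← Bimod.op_smul_tm, M.μ₁_right]

theorem toDual_smul (a : A) (f : M.F) : M.toDual (a • f) = a • M.toDual f :=
  Bimod.dual_ext fun e => by
    rw [Bimod.smul_app, app_toDual, app_toDual, Bimod.tm_smul]

variable {M}

/-- If `∑ μ₂(fᵢ ⊗ eᵢ) = 1`, then `e = ∑ μ₁(e ⊗ fᵢ) eᵢ`. -/
theorem sum_μ₁_smul {I : Type} [Fintype I] {f : I → M.F} {e : I → M.E}
    (h : ∑ i, M.μ₂ (Bimod.tm (f i) (e i)) = 1) (x : M.E) :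
    ∑ i, M.μ₁ (Bimod.tm x (f i)) • e i = x := by
  simp_rw [M.assoc₁]
  rw [← Finset.sum_smul, ← Finset.op_sum, h, MulOpposite.op_one, one_smul]

/-- If `∑ μ₂(fᵢ ⊗ eᵢ) = 1`, then `f = ∑ fᵢ μ₁(eᵢ ⊗ f)`. -/
theorem sum_op_μ₁_smul {I : Type} [Fintype I] {f : I → M.F} {e : I → M.E}
    (h : ∑ i, M.μ₂ (Bimod.tm (f i) (e i)) = 1) (x : M.F) :
    ∑ i, MulOpposite.op (M.μ₁ (Bimod.tm (e i) x)) • f i = x := by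
  simp_rw [← M.assoc₂]
  rw [← Finset.sum_smul, h, one_smul]

theorem toDual_surjective (h : M.IsStrict) : Function.Surjective M.toDual := by
  obtain ⟨I, _, f, e, hfe⟩ := h.exists_sum_μ₂_eq_one
  intro α
  refine ⟨∑ i, MulOpposite.op (Bimod.app α (e i)) • f i, Bimod.dual_ext fun x => ?_⟩
  rw [app_toDual, map_sum, map_sum]
  conv_rhs => rw [← sum_μ₁_smul hfe x]
  change _ = (show M.E →ₗ[A] A from α) _
  rw [map_sum]
  refine Finset.sum_congr rfl fun i _ => ?_
  rw [← Bimod.op_smul_tm, M.μ₁_right, map_smul]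
  rfl

/-- The dual basis `(eᵢ, μ₁(- ⊗ fᵢ))` given by `∑ μ₂(fᵢ ⊗ eᵢ) = 1`. -/
noncomputable def dualBasis {I : Type} [Fintype I] {f : I → M.F} {e : I → M.E}
    (h : ∑ i, M.μ₂ (Bimod.tm (f i) (e i)) = 1) : M.E.DualBasis where
  n := Fintype.card I
  vec i := e ((Fintype.equivFin I).symm i)
  cov i := M.toDual (f ((Fintype.equivFin I).symm i))
  sum_eq x := by
    rw [Equiv.sum_comp (Fintype.equivFin I).symm
      (fun i => Bimod.app (M.toDual (f i)) x • e i)]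
    exact sum_μ₁_smul h x

/-- The coevaluation of `E` is the inverse of `μ₂` under the identification of `F` with `E°`. -/
theorem coev_μ₂ (hE : M.E.IsFGP) {I : Type} [Fintype I] {f : I → M.F} {e : I → M.E}
    (h : ∑ i, M.μ₂ (Bimod.tm (f i) (e i)) = 1) (f' : M.F) (e' : M.E) :
    M.E.coev hE (M.μ₂ (Bimod.tm f' e')) = Bimod.tm (M.toDual f') e' := by
  rw [Bimod.coev, Bimod.DualBasis.coev_eq _ (dualBasis h), Bimod.DualBasis.coev_apply]
  change ∑ i, Bimod.tm (_ • M.toDual (f ((Fintype.equivFin I).symm i)))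
    (e ((Fintype.equivFin I).symm i)) = _
  rw [Equiv.sum_comp (Fintype.equivFin I).symm
    (fun i => Bimod.tm (M.μ₂ (Bimod.tm f' e') • M.toDual (f i)) (e i))]
  simp_rw [← toDual_smul, M.assoc₂, toDual_op_smul, Bimod.tm_smul]
  rw [← map_sum, sum_μ₁_smul h]

theorem IsStrict.isLeftLine (h : M.IsStrict) : M.E.IsLeftLine := by
  obtain ⟨I, _, f, e, hfe⟩ := h.exists_sum_μ₂_eq_one
  have hE : M.E.IsFGP := ⟨dualBasis hfe⟩
  refine { fgp := hE, coev_bijective := ⟨?_, ?_⟩, ev_bijective := ⟨?_, ?_⟩ }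
  · refine (injective_iff_map_eq_zero _).2 fun a ha => ?_
    have h0 : ∀ x : M.E, MulOpposite.op a • x = 0 := fun x => by
      rw [← Bimod.contract_coev M.E hE, ha, map_zero]
    rw [← one_mul a, ← hfe, Finset.sum_mul]
    refine Finset.sum_eq_zero fun i _ => ?_
    rw [← M.μ₂_right, Bimod.op_smul_tm, h0, map_zero, map_zero]
  · intro z
    induction z using Bimod.tensor_induction with
    | h0 => exact ⟨0, map_zero _⟩
    | ha x y hx hy =>
      obtain ⟨a, rfl⟩ := hx
      obtain ⟨b, rfl⟩ := hy
      exact ⟨a + b, map_add _ a b⟩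
    | ht α x =>
      obtain ⟨f', rfl⟩ := toDual_surjective h α
      exact ⟨_, coev_μ₂ hE hfe f' x⟩
  · refine (injective_iff_map_eq_zero _).2 fun z hz => ?_
    obtain ⟨J, _, x, α, rfl⟩ := Bimod.exists_sum_tm z
    choose g hg using fun j => toDual_surjective h (α j)
    -- `ev` becomes `μ₁` under the identification of `F` with `E°`, through which `z` lifts.
    have key : ∑ j, Bimod.tm (x j) (g j) = 0 := by
      refine M.μ₁_injective h.1 ?_
      rw [map_zero, ← hz, map_sum, map_sum]
      refine Finset.sum_congr rfl fun j _ => ?_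
      rw [← hg j]; rfl
    let T : M.E.tensor M.F →+ M.E.tensor M.E.dual :=
      BalTensor.mapRight (E := M.E) (F := M.F) (F' := M.E.dual)
        { toFun := M.toDual
          map_add' := fun f f' => Bimod.dual_ext fun e => by
            change M.μ₁ (Bimod.tm e (f + f')) = M.μ₁ (Bimod.tm e f) + M.μ₁ (Bimod.tm e f')
            rw [map_add, map_add]
          map_smul' := M.toDual_smul }
    have hT := congrArg T key
    rw [map_zero, map_sum] at hT
    rw [← hT]
    refine Finset.sum_congr rfl fun j _ => ?_
    rw [← hg j]; rfl
  · intro a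
    obtain ⟨z, rfl⟩ := h.1 a
    obtain ⟨J, _, x, g, rfl⟩ := Bimod.exists_sum_tm z
    refine ⟨∑ j, Bimod.tm (x j) (M.toDual (g j)), ?_⟩
    rw [map_sum, map_sum]
    rfl

end MoritaContext

theorem Bimod.IsLeftLine.context_isStrict {A : Type u} [Ring A] [Algebra ℂ A] {L : Bimod A}
    (h : L.IsLeftLine) : (L.context h.toIsWeakLeftLine).IsStrict :=
  ⟨h.ev_bijective.2,
    (AddEquiv.ofBijective (L.coev h.fgp) h.coev_bijective).symm.surjective⟩

theorem Bimod.isLeftLine_iff {A : Type u} [Ring A] [Algebra ℂ A] (E : Bimod A) :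
    E.IsLeftLine ↔ ∃ M : MoritaContext A, M.IsStrict ∧ M.E = E :=
  ⟨fun h => ⟨E.context h.toIsWeakLeftLine, h.context_isStrict, rfl⟩,
    fun ⟨_, h, hE⟩ => hE ▸ h.isLeftLine⟩

/-! ### Tensoring with a bimodule of a strict Morita context -/

namespace MoritaContext

variable {A : Type u} [Ring A] [Algebra ℂ A] (M : MoritaContext A)

/-- The map `e ⊗ x ↦ μ₂(f ⊗ e) x`. -/
noncomputable def contractionAux (X : Type u) [AddCommGroup X] [Module A X] (f : M.F) :
    BalTensor A M.E X →+ X :=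
  BalTensor.lift ((smulAddHom A X).comp (M.μ₂.comp (Bimod.tm f))) (fun e a x => by
    change M.μ₂ (Bimod.tm f (MulOpposite.op a • e)) • x = M.μ₂ (Bimod.tm f e) • a • x
    rw [← Bimod.op_smul_tm, M.μ₂_right, mul_smul])

theorem contractionAux_tmul (X : Type u) [AddCommGroup X] [Module A X] (f : M.F) (e : M.E)
    (x : X) : M.contractionAux X f (BalTensor.tmul A e x) = M.μ₂ (Bimod.tm f e) • x := rfl

/-- The contraction `F ⊗ (E ⊗ X) → X` as an additive map. -/
noncomputable def contractionHom (X : Type u) [AddCommGroup X] [Module A X] :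
    BalTensor A M.F (BalTensor A M.E X) →+ X :=
  BalTensor.lift
    { toFun := M.contractionAux X
      map_zero' := BalTensor.hom_ext fun e x => by
        rw [contractionAux_tmul, map_zero, AddMonoidHom.zero_apply, map_zero, zero_smul,
          AddMonoidHom.zero_apply]
      map_add' := fun f f' => BalTensor.hom_ext fun e x => by
        rw [AddMonoidHom.add_apply, contractionAux_tmul, contractionAux_tmul,
          contractionAux_tmul, map_add, AddMonoidHom.add_apply, map_add, add_smul] }
    (fun f a z => by
      change M.contractionAux X _ _ = M.contractionAux X _ _
      induction z using BalTensor.induction with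
      | h0 => rw [smul_zero, map_zero, map_zero]
      | ht e x =>
        rw [BalTensor.smul_left, contractionAux_tmul, contractionAux_tmul, Bimod.tm_smul]
      | ha x y hx hy => rw [smul_add, map_add, map_add, hx, hy])

theorem contractionHom_tmul (X : Type u) [AddCommGroup X] [Module A X] (f : M.F)
    (z : BalTensor A M.E X) :
    M.contractionHom X (BalTensor.tmul A f z) = M.contractionAux X f z := rfl

/-- The contraction `F ⊗ (E ⊗ X) → X`, `f ⊗ (e ⊗ x) ↦ μ₂(f ⊗ e) x`. -/
noncomputable def contraction (X : Type u) [AddCommGroup X] [Module A X] :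
    BalTensor A M.F (BalTensor A M.E X) →ₗ[A] X where
  toFun := M.contractionHom X
  map_add' := map_add _
  map_smul' a z := by
    rw [RingHom.id_apply]
    induction z using BalTensor.induction with
    | h0 => rw [map_zero, smul_zero, smul_zero, map_zero]
    | ha x y hx hy => rw [smul_add, map_add, map_add, smul_add, hx, hy]
    | ht f z =>
      rw [BalTensor.smul_left, contractionHom_tmul, contractionHom_tmul]
      induction z using BalTensor.induction with
      | h0 => rw [map_zero, map_zero, smul_zero]
      | ha x y hx hy => rw [map_add, map_add, smul_add, hx, hy]
      | ht e x =>
        rw [contractionAux_tmul, contractionAux_tmul, ← Bimod.smul_tm, M.μ₂_left, mul_smul]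

theorem contraction_tmul (X : Type u) [AddCommGroup X] [Module A X] (f : M.F) (e : M.E) (x : X) :
    M.contraction X (BalTensor.tmul A f (BalTensor.tmul A e x)) = M.μ₂ (Bimod.tm f e) • x := rfl

variable {M}

/-- If `∑ μ₂(fᵢ ⊗ eᵢ) = 1`, then `x ↦ ∑ fᵢ ⊗ (eᵢ ⊗ x)` is inverse to the contraction. -/
theorem sum_tmul_contraction {X : Type u} [AddCommGroup X] [Module A X] {I : Type} [Fintype I]
    {f : I → M.F} {e : I → M.E} (h : ∑ i, M.μ₂ (Bimod.tm (f i) (e i)) = 1)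
    (z : BalTensor A M.F (BalTensor A M.E X)) :
    ∑ i, BalTensor.tmul A (f i) (BalTensor.tmul A (e i) (M.contraction X z)) = z := by
  induction z using BalTensor.induction with
  | h0 => simp
  | ha x y hx hy => simp only [map_add, Finset.sum_add_distrib, hx, hy]
  | ht f' z =>
    induction z using BalTensor.induction with
    | h0 => simp
    | ha x y hx hy => simp only [map_add, Finset.sum_add_distrib, hx, hy]
    | ht e' x =>
      simp_rw [contraction_tmul, ← BalTensor.smul_tmul, ← M.assoc₁, ← BalTensor.smul_left,
        ← BalTensor.smul_tmul]
      rw [← AddMonoidHom.finsetSum_apply, ← map_sum, sum_op_μ₁_smul h]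

theorem contraction_bijective (h : M.IsStrict) (X : Type u) [AddCommGroup X] [Module A X] :
    Function.Bijective (M.contraction X) := by
  obtain ⟨I, _, f, e, hfe⟩ := h.exists_sum_μ₂_eq_one
  refine ⟨fun z z' hz => ?_, fun x => ?_⟩
  · rw [← sum_tmul_contraction hfe z, hz, sum_tmul_contraction hfe]
  · refine ⟨∑ i, BalTensor.tmul A (f i) (BalTensor.tmul A (e i) x), ?_⟩
    simp_rw [map_sum, contraction_tmul]
    rw [← Finset.sum_smul, hfe, one_smul]

/-- Naturality of the contraction. The map `g'` stands for `id ⊗ g`, which `BalTensor.mapRight`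
provides only as an additive map. -/
theorem contraction_mapRight {X Y : Type u} [AddCommGroup X] [Module A X] [AddCommGroup Y]
    [Module A Y] (g : X →ₗ[A] Y) (g' : BalTensor A M.E X →ₗ[A] BalTensor A M.E Y)
    (hg' : ∀ z, g' z = BalTensor.mapRight g z) (z : BalTensor A M.F (BalTensor A M.E X)) :
    M.contraction Y (BalTensor.mapRight g' z) = g (M.contraction X z) := by
  induction z using BalTensor.induction with
  | h0 => rw [map_zero, map_zero, map_zero, map_zero]
  | ha x y hx hy => rw [map_add, map_add, map_add, map_add, hx, hy]
  | ht f z =>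
    rw [BalTensor.mapRight_tmul, hg']
    induction z using BalTensor.induction with
    | h0 => simp only [map_zero]
    | ha x y hx hy => simp only [map_add, hx, hy]
    | ht e x =>
      rw [BalTensor.mapRight_tmul, contraction_tmul, contraction_tmul, map_smul]

/-- The natural isomorphism `F ⊗ (E ⊗ -) ≅ id` of a strict Morita context. -/
noncomputable def contractionIso (h : M.IsStrict) :
    M.E.tensorFunctor ⋙ M.F.tensorFunctor ≅ 𝟭 (ModuleCat.{u} A) :=
  NatIso.ofComponents
    (fun X => (LinearEquiv.ofBijective (M.contraction X) (contraction_bijective h X)).toModuleIso)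
    (fun {X Y} g => by
      ext z
      exact contraction_mapRight g.hom (M.E.tensorFunctor.map g).hom (fun _ => rfl) z)

open scoped ModuleCat.Algebra in
instance (E : Bimod A) : E.tensorFunctor.Linear ℂ where
  map_smul {X Y} g c := by
    ext z
    change BalTensor.mapRight (E := E) (c • g).hom z
      = algebraMap ℂ A c • BalTensor.mapRight (E := E) g.hom z
    induction z using BalTensor.induction with
    | h0 => simp
    | ha x y hx hy => simp only [map_add, smul_add, hx, hy]
    | ht e x =>
      change BalTensor.tmul A e (algebraMap ℂ A c • g.hom x)
        = BalTensor.tmul A (algebraMap ℂ A c • e) (g.hom x)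
      rw [E.central, BalTensor.smul_tmul]

/-- The functor `E ⊗ -` of a strict Morita context, as a `ℂ`-linear autoequivalence with inverse
`F ⊗ -`. -/
noncomputable def tensorEquivalence (h : M.IsStrict) : MoritaEquivalence ℂ A A where
  eqv := CategoryTheory.Equivalence.mk M.E.tensorFunctor M.F.tensorFunctor (contractionIso h).symm
    (contractionIso h.swap)
  linear := inferInstanceAs (M.E.tensorFunctor.Linear ℂ)

end MoritaContext

/-! ### Linear endofunctors and bimodules -/

section Watts

open scoped ModuleCat.Algebra

variable {A : Type u} [Ring A]

/-- The module map `A → X` with `1 ↦ x`. -/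
noncomputable def elementHom {X : ModuleCat.{u} A} (x : X) : ModuleCat.of A A ⟶ X :=
  ModuleCat.ofHom (LinearMap.toSpanSingleton A X x)

theorem elementHom_apply_one {X : ModuleCat.{u} A} (x : X) : (elementHom x).hom (1 : A) = x :=
  one_smul A x

theorem elementHom_hom_one {X : ModuleCat.{u} A} (f : ModuleCat.of A A ⟶ X) :
    elementHom (f.hom (1 : A)) = f := by
  ext
  exact one_smul A _

theorem elementHom_comp {X Y : ModuleCat.{u} A} (x : X) (f : X ⟶ Y) :
    elementHom x ≫ f = elementHom (f.hom x) := by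
  ext
  change f.hom ((1 : A) • x) = (1 : A) • f.hom x
  rw [one_smul, one_smul]

theorem elementHom_add {X : ModuleCat.{u} A} (x y : X) :
    elementHom (x + y) = elementHom x + elementHom y := by
  ext
  exact smul_add (1 : A) x y

theorem elementHom_zero {X : ModuleCat.{u} A} : elementHom (0 : X) = 0 := by
  ext
  exact smul_zero (1 : A)

theorem elementHom_one : elementHom (X := ModuleCat.of A A) (1 : A) = 𝟙 _ :=
  elementHom_hom_one (𝟙 (ModuleCat.of A A))

theorem elementHom_mul (a b : A) : elementHom (X := ModuleCat.of A A) (a * b : A)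
    = elementHom (X := ModuleCat.of A A) a ≫ elementHom (X := ModuleCat.of A A) b :=
  (elementHom_comp (X := ModuleCat.of A A) (Y := ModuleCat.of A A) a (elementHom b)).symm

theorem elementHom_smul {X : ModuleCat.{u} A} (a : A) (x : X) :
    elementHom (a • x) = elementHom (X := ModuleCat.of A A) a ≫ elementHom x :=
  (elementHom_comp (X := ModuleCat.of A A) a (elementHom x)).symm

variable [Algebra ℂ A]

/-- The bimodule `F(A)` of a `ℂ`-linear endofunctor `F` of the category of left modules; the right
action of `a` is the image under `F` of the right multiplication by `a` on `A`. -/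
noncomputable def functorBimod (F : ModuleCat.{u} A ⥤ ModuleCat.{u} A) [F.Additive]
    [F.Linear ℂ] : Bimod A where
  carrier := F.obj (ModuleCat.of A A)
  rightModule :=
    { smul := fun a x => (F.map (elementHom (X := ModuleCat.of A A) a.unop)).hom x
      one_smul := fun x => by
        change (F.map (elementHom (X := ModuleCat.of A A) (1 : A))).hom x = x
        rw [elementHom_one, F.map_id]; rfl
      mul_smul := fun a b x => by
        change (F.map (elementHom (X := ModuleCat.of A A) (b.unop * a.unop : A))).hom x = _
        rw [elementHom_mul, F.map_comp]; rfl
      smul_zero := fun a => map_zero _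
      smul_add := fun a => map_add _
      add_smul := fun a b x => by
        change (F.map (elementHom (X := ModuleCat.of A A) (a.unop + b.unop : A))).hom x = _
        rw [elementHom_add (X := ModuleCat.of A A) a.unop b.unop, F.map_add]; rfl
      zero_smul := fun x => by
        change (F.map (elementHom (X := ModuleCat.of A A) (0 : A))).hom x = 0
        rw [elementHom_zero (X := ModuleCat.of A A), F.map_zero]; rfl }
  smulComm :=
    letI : SMul Aᵐᵒᵖ (F.obj (ModuleCat.of A A)) :=
      ⟨fun a x => (F.map (elementHom (X := ModuleCat.of A A) a.unop)).hom x⟩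
    ⟨fun a b x => (map_smul (F.map (elementHom (X := ModuleCat.of A A) b.unop)).hom a x).symm⟩
  central c x := by
    refine Eq.trans ?_ (congrArg (fun f => f.hom x)
      ((F.map_smul c (𝟙 (ModuleCat.of A A))).symm.trans (congrArg F.map ?_)))
    · rw [F.map_id]; rfl
    · refine ModuleCat.hom_ext (LinearMap.ext_ring ?_)
      change algebraMap ℂ A c * 1 = 1 * algebraMap ℂ A c
      rw [one_mul, mul_one]

variable (F : ModuleCat.{u} A ⥤ ModuleCat.{u} A) [F.Additive] [F.Linear ℂ]

/-- Naturally isomorphic functors have isomorphic bimodules. -/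
theorem functorBimod_isomorphic {F G : ModuleCat.{u} A ⥤ ModuleCat.{u} A} [F.Additive]
    [F.Linear ℂ] [G.Additive] [G.Linear ℂ] (i : F ≅ G) :
    (functorBimod F).Isomorphic (functorBimod G) :=
  ⟨(i.app (ModuleCat.of A A)).toLinearEquiv, fun a x =>
    congrArg (fun f => f.hom x) (i.hom.naturality (elementHom (X := ModuleCat.of A A) a))⟩

/-- The comparison map `F(A) ⊗ X → F(X)`, `l ⊗ x ↦ F(1 ↦ x)(l)`. -/
noncomputable def wattsHom (X : ModuleCat.{u} A) :
    BalTensor A (functorBimod F) X →+ F.obj X :=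
  BalTensor.lift
    (AddMonoidHom.mk' (fun l => AddMonoidHom.mk' (fun x : X => (F.map (elementHom x)).hom l)
      (fun x y => by rw [elementHom_add, F.map_add]; rfl))
      (fun l l' => by ext x; exact map_add (F.map (elementHom x)).hom l l'))
    (fun l a x => by
      change (F.map (elementHom x)).hom ((F.map (elementHom (X := ModuleCat.of A A) a)).hom l)
        = (F.map (elementHom (a • x))).hom l
      rw [elementHom_smul, F.map_comp]; rfl)

theorem wattsHom_tmul (X : ModuleCat.{u} A) (l : functorBimod F) (x : X) :
    wattsHom F X (BalTensor.tmul A l x) = (F.map (elementHom x)).hom l := rfl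

/-- The comparison map `F(A) ⊗ X → F(X)` as a module map. -/
noncomputable def watts (X : ModuleCat.{u} A) :
    (functorBimod F).tensorFunctor.obj X ⟶ F.obj X :=
  ModuleCat.ofHom (X := BalTensor A (functorBimod F) X)
    { toFun := wattsHom F X
      map_add' := map_add _
      map_smul' := fun a z => by
        rw [RingHom.id_apply]
        induction z using BalTensor.induction with
        | h0 => rw [smul_zero, map_zero, smul_zero]
        | ha x y hx hy => rw [smul_add, map_add, map_add, smul_add, hx, hy]
        | ht l x =>
          rw [BalTensor.smul_left, wattsHom_tmul, wattsHom_tmul]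
          exact map_smul (F.map (elementHom x)).hom a l }

/-- The map `l ↦ l ⊗ x`. -/
noncomputable def tmulRight {X : ModuleCat.{u} A} (x : X) :
    F.obj (ModuleCat.of A A) ⟶ (functorBimod F).tensorFunctor.obj X :=
  ModuleCat.ofHom (Y := BalTensor A (functorBimod F) X)
    { toFun := fun l => BalTensor.tmul A (E := functorBimod F) l x
      map_add' := fun l l' =>
        DFunLike.congr_fun (map_add (BalTensor.mk A (functorBimod F) X) l l') x
      map_smul' := fun _ _ => rfl }

theorem tmulRight_add {X : ModuleCat.{u} A} (x y : X) :
    tmulRight F (x + y) = tmulRight F x + tmulRight F y := by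
  ext l
  exact map_add (BalTensor.mk A (functorBimod F) X l) x y

theorem tmulRight_smul {X : ModuleCat.{u} A} (a : A) (x : X) :
    tmulRight F (a • x) = F.map (elementHom (X := ModuleCat.of A A) a) ≫ tmulRight F x := by
  ext l
  exact (BalTensor.smul_tmul (E := functorBimod F) a l x).symm

theorem tmulRight_watts {X : ModuleCat.{u} A} (x : X) :
    tmulRight F x ≫ watts F X = F.map (elementHom x) := by
  ext l; rfl

variable {F} {G : ModuleCat.{u} A ⥤ ModuleCat.{u} A} (adj : F ⊣ G)

/-- The map `X → G(F(A) ⊗ X)` sending `x` to the element that corresponds to `l ↦ l ⊗ x` under the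
adjunction. -/
noncomputable def wattsUnit (X : ModuleCat.{u} A) :
    X ⟶ G.obj ((functorBimod F).tensorFunctor.obj X) :=
  ModuleCat.ofHom
    { toFun := fun x => (adj.homEquiv _ _ (tmulRight F x)).hom (1 : A)
      map_add' := fun x y => by
        have := adj.right_adjoint_additive
        rw [tmulRight_add, adj.homEquiv_unit, G.map_add, Preadditive.comp_add,
          adj.homEquiv_unit, adj.homEquiv_unit]
        rfl
      map_smul' := fun a x => by
        rw [tmulRight_smul, adj.homEquiv_naturality_left, RingHom.id_apply]
        change (adj.homEquiv _ _ (tmulRight F x)).hom ((1 : A) * a) = _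
        rw [one_mul, ← map_smul, smul_eq_mul, mul_one] }

theorem elementHom_wattsUnit {X : ModuleCat.{u} A} (x : X) :
    elementHom x ≫ wattsUnit adj X = adj.homEquiv _ _ (tmulRight F x) := by
  exact (elementHom_comp x (wattsUnit adj X)).trans
    (elementHom_hom_one (adj.homEquiv _ _ (tmulRight F x)))

/-- A `ℂ`-linear functor that has a right adjoint is tensoring with a bimodule. The right adjoint
supplies the inverse of the comparison map `F(A) ⊗ X → F(X)`, so that no presentation of `X` is
needed. -/
noncomputable def wattsIso (X : ModuleCat.{u} A) :
    (functorBimod F).tensorFunctor.obj X ≅ F.obj X where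
  hom := watts F X
  inv := (adj.homEquiv _ _).symm (wattsUnit adj X)
  hom_inv_id := by
    ext z
    refine BalTensor.induction (A := A) (E := functorBimod F) (F := X)
      (p := fun z => (watts F X ≫ (adj.homEquiv _ _).symm (wattsUnit adj X)).hom z = z)
      (map_zero _) (fun l x => ?_) (fun x y hx hy => ?_) z
    · have h : F.map (elementHom x) ≫ (adj.homEquiv _ _).symm (wattsUnit adj X)
          = tmulRight F x := by
        rw [← adj.homEquiv_naturality_left_symm, elementHom_wattsUnit, Equiv.symm_apply_apply]
      exact congrArg (fun f => f.hom l) h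
    · exact (map_add _ x y).trans (congrArg₂ (· + ·) hx hy)
  inv_hom_id := by
    refine (adj.homEquiv _ _).injective ?_
    rw [adj.homEquiv_naturality_right, Equiv.apply_symm_apply]
    ext x
    have h : elementHom x ≫ wattsUnit adj X ≫ G.map (watts F X)
        = elementHom x ≫ adj.homEquiv _ _ (𝟙 (F.obj X)) := by
      rw [← Category.assoc, elementHom_wattsUnit, ← adj.homEquiv_naturality_right,
        tmulRight_watts, ← adj.homEquiv_naturality_left, Category.comp_id]
    rw [elementHom_comp, elementHom_comp] at h
    exact (elementHom_apply_one _).symm.trans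
      ((congrArg (fun f => f.hom (1 : A)) h).trans (elementHom_apply_one _))

/-- The natural isomorphism `F(A) ⊗ - ≅ F` for a `ℂ`-linear functor with a right adjoint. -/
noncomputable def wattsNatIso : (functorBimod F).tensorFunctor ≅ F :=
  NatIso.ofComponents (wattsIso adj) (fun {X Y} f => by
    ext z
    refine BalTensor.induction (A := A) (E := functorBimod F) (F := X)
      (p := fun z => ((functorBimod F).tensorFunctor.map f ≫ watts F Y).hom z
        = (watts F X ≫ F.map f).hom z)
      ((map_zero _).trans (map_zero _).symm) (fun l x => ?_) (fun x y hx hy => ?_) z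
    · change (F.map (elementHom (f.hom x))).hom l = (F.map f).hom ((F.map (elementHom x)).hom l)
      rw [← elementHom_comp, F.map_comp]; rfl
    · exact (map_add _ x y).trans ((congrArg₂ (· + ·) hx hy).trans (map_add _ x y).symm))

end Watts

/-! ### The Morita context of an autoequivalence -/

section Autoequivalence

open scoped ModuleCat.Algebra

variable {A : Type u} [Ring A] [Algebra ℂ A]

instance (P : MoritaEquivalence ℂ A A) : P.eqv.inverse.Additive :=
  P.eqv.inverse.additive_of_preserves_binary_products

instance (P : MoritaEquivalence ℂ A A) : P.eqv.inverse.Linear ℂ := P.symm.linear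

/-- The pairing `F(A) ⊗ G(A) ≅ F(G(A)) ≅ A` of an equivalence `F` with inverse `G`. -/
noncomputable def pairing (P : MoritaEquivalence ℂ A A) :
    (functorBimod P.eqv.functor).tensor (functorBimod P.eqv.inverse) →+ A :=
  (watts P.eqv.functor (P.eqv.inverse.obj (ModuleCat.of A A))
    ≫ P.eqv.counit.app (ModuleCat.of A A)).hom.toAddMonoidHom

variable (P : MoritaEquivalence ℂ A A)

/-- The right linearity of the pairing, as an identity of morphisms. -/
theorem map_elementHom_counit (a : A) (k : P.eqv.inverse.obj (ModuleCat.of A A)) :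
    P.eqv.functor.map (elementHom
          ((P.eqv.inverse.map (elementHom (X := ModuleCat.of A A) a)).hom k))
        ≫ P.eqv.counit.app (ModuleCat.of A A)
      = (P.eqv.functor.map (elementHom k) ≫ P.eqv.counit.app (ModuleCat.of A A))
        ≫ elementHom (X := ModuleCat.of A A) a := by
  rw [← elementHom_comp, P.eqv.functor.map_comp, Category.assoc, Category.assoc]
  exact congrArg (P.eqv.functor.map (elementHom k) ≫ ·) (P.eqv.counit_naturality _)

/-- The compatibility of the two pairings, as an identity of morphisms: the triangle identity and the
naturality of the counit. -/
theorem map_elementHom_unitInv (k : P.eqv.inverse.obj (ModuleCat.of A A))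
    (l : P.eqv.functor.obj (ModuleCat.of A A)) :
    P.eqv.functor.map (elementHom ((P.eqv.inverse.map (elementHom l)
        ≫ P.eqv.unitInv.app (ModuleCat.of A A)).hom k))
      = (P.eqv.functor.map (elementHom k) ≫ P.eqv.counit.app (ModuleCat.of A A))
        ≫ elementHom l := by
  rw [← elementHom_comp, P.eqv.functor.map_comp, P.eqv.functor.map_comp,
    ← P.eqv.counit_app_functor, Category.assoc]
  exact congrArg (P.eqv.functor.map (elementHom k) ≫ ·) (P.eqv.counit_naturality _)

theorem pairing_smul (a : A)
    (z : (functorBimod P.eqv.functor).tensor (functorBimod P.eqv.inverse)) :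
    pairing P (a • z) = a * pairing P z :=
  map_smul (watts P.eqv.functor (P.eqv.inverse.obj (ModuleCat.of A A))
    ≫ P.eqv.counit.app (ModuleCat.of A A)).hom a z

theorem pairing_op_smul (a : A)
    (z : (functorBimod P.eqv.functor).tensor (functorBimod P.eqv.inverse)) :
    pairing P (MulOpposite.op a • z) = pairing P z * a := by
  induction z using Bimod.tensor_induction with
  | h0 => rw [smul_zero, map_zero, zero_mul]
  | ha x y hx hy => rw [smul_add, map_add, map_add, add_mul, hx, hy]
  | ht l k =>
    exact congrArg (fun f => f.hom l) (map_elementHom_counit P a k)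

theorem pairing_surjective : Function.Surjective (pairing P) := by
  have h : IsIso (watts P.eqv.functor (P.eqv.inverse.obj (ModuleCat.of A A))) :=
    (wattsIso P.eqv.toAdjunction (P.eqv.inverse.obj (ModuleCat.of A A))).isIso_hom
  exact (asIso (watts P.eqv.functor (P.eqv.inverse.obj (ModuleCat.of A A))
    ≫ P.eqv.counit.app (ModuleCat.of A A))).toLinearEquiv.surjective

theorem pairing_assoc (l : functorBimod P.eqv.functor) (k : functorBimod P.eqv.inverse)
    (l' : functorBimod P.eqv.functor) :
    pairing P (Bimod.tm l k) • l' = MulOpposite.op (pairing P.symm (Bimod.tm k l')) • l := by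
  exact (congrArg (fun f => f.hom l) (map_elementHom_unitInv P k l')).symm

/-- The Morita context `(A, A, F(A), G(A))` of an equivalence `F` with inverse `G`. -/
noncomputable def equivalenceContext : MoritaContext A where
  E := functorBimod P.eqv.functor
  F := functorBimod P.eqv.inverse
  μ₁ := pairing P
  μ₂ := pairing P.symm
  μ₁_left := pairing_smul P
  μ₁_right := pairing_op_smul P
  μ₂_left := pairing_smul P.symm
  μ₂_right := pairing_op_smul P.symm
  assoc₁ := pairing_assoc P
  assoc₂ := pairing_assoc P.symm

theorem equivalenceContext_isStrict : (equivalenceContext P).IsStrict :=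
  ⟨pairing_surjective P, pairing_surjective P.symm⟩

theorem functorBimod_isLeftLine : (functorBimod P.eqv.functor).IsLeftLine :=
  (equivalenceContext_isStrict P).isLeftLine

end Autoequivalence

namespace Bimod

variable {A : Type u} [Ring A] [Algebra ℂ A]

theorem Isomorphic.symm {E F : Bimod A} : E.Isomorphic F → F.Isomorphic E :=
  fun ⟨f, hf⟩ => ⟨f.symm, fun a x => by
    rw [LinearEquiv.symm_apply_eq, hf, LinearEquiv.apply_symm_apply]⟩

theorem Isomorphic.trans {E F G : Bimod A} : E.Isomorphic F → F.Isomorphic G → E.Isomorphic G :=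
  fun ⟨f, hf⟩ ⟨g, hg⟩ => ⟨f.trans g, fun a x => by
    rw [LinearEquiv.trans_apply, hf, hg, LinearEquiv.trans_apply]⟩

/-- The map `f ⊗ id` for a map `f` of bimodules. -/
noncomputable def mapLeft {E F : Bimod A} (f : E →ₗ[A] F)
    (hf : ∀ (a : A) (x : E), f (MulOpposite.op a • x) = MulOpposite.op a • f x)
    (X : Type u) [AddCommGroup X] [Module A X] : BalTensor A E X →+ BalTensor A F X :=
  BalTensor.lift ((BalTensor.mk A F X).comp f.toAddMonoidHom) (fun e a x => by
    change BalTensor.tmul A (f (MulOpposite.op a • e)) x = BalTensor.tmul A (f e) (a • x)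
    rw [hf, BalTensor.smul_tmul])

theorem mapLeft_tmul {E F : Bimod A} (f : E →ₗ[A] F)
    (hf : ∀ (a : A) (x : E), f (MulOpposite.op a • x) = MulOpposite.op a • f x)
    (X : Type u) [AddCommGroup X] [Module A X] (e : E) (x : X) :
    mapLeft f hf X (BalTensor.tmul A e x) = BalTensor.tmul A (f e) x := rfl

/-- Isomorphic bimodules give naturally isomorphic functors. -/
theorem Isomorphic.tensorFunctor {E F : Bimod A} (h : E.Isomorphic F) :
    Nonempty (E.tensorFunctor ≅ F.tensorFunctor) := by
  obtain ⟨f, hf⟩ := h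
  have hf' : ∀ (a : A) (x : F), f.symm (MulOpposite.op a • x) = MulOpposite.op a • f.symm x :=
    fun a x => by rw [LinearEquiv.symm_apply_eq, hf, LinearEquiv.apply_symm_apply]
  have h1 : ∀ (X : ModuleCat.{u} A) (z : BalTensor A E X),
      mapLeft f.symm.toLinearMap hf' X (mapLeft f.toLinearMap hf X z) = z := fun X z => by
    induction z using BalTensor.induction with
    | h0 => rw [map_zero, map_zero]
    | ha x y hx hy => rw [map_add, map_add, hx, hy]
    | ht e x => simp [mapLeft_tmul]
  have h2 : ∀ (X : ModuleCat.{u} A) (z : BalTensor A F X),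
      mapLeft f.toLinearMap hf X (mapLeft f.symm.toLinearMap hf' X z) = z := fun X z => by
    induction z using BalTensor.induction with
    | h0 => rw [map_zero, map_zero]
    | ha x y hx hy => rw [map_add, map_add, hx, hy]
    | ht e x => simp [mapLeft_tmul]
  refine ⟨NatIso.ofComponents (fun X => LinearEquiv.toModuleIso
    (X₁ := BalTensor A E X) (X₂ := BalTensor A F X)
    { toFun := mapLeft f.toLinearMap hf X
      invFun := mapLeft f.symm.toLinearMap hf' X
      left_inv := h1 X
      right_inv := h2 X
      map_add' := map_add _
      map_smul' := fun a z => by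
        rw [RingHom.id_apply]
        induction z using BalTensor.induction with
        | h0 => rw [smul_zero, map_zero, smul_zero]
        | ha x y hx hy => rw [smul_add, map_add, map_add, smul_add, hx, hy]
        | ht e x =>
          rw [BalTensor.smul_left, mapLeft_tmul, mapLeft_tmul, BalTensor.smul_left]
          exact congrArg (fun e => BalTensor.tmul A e x) (map_smul f a e) }) ?_⟩
  intro X Y g
  ext z
  change mapLeft f.toLinearMap hf Y (BalTensor.mapRight g.hom z)
    = BalTensor.mapRight g.hom (mapLeft f.toLinearMap hf X z)
  refine DFunLike.congr_fun (f := (mapLeft f.toLinearMap hf Y).comp (BalTensor.mapRight g.hom))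
    (g := (BalTensor.mapRight g.hom).comp (mapLeft f.toLinearMap hf X)) ?_ z
  exact BalTensor.hom_ext fun e x => rfl

end Bimod

open scoped ModuleCat.Algebra in
/-- The bimodule of the functor `E ⊗ -` is `E ⊗ A ≅ E`. -/
theorem functorBimod_tensorFunctor {A : Type u} [Ring A] [Algebra ℂ A] (E : Bimod A)
    [E.tensorFunctor.Additive] : (functorBimod E.tensorFunctor).Isomorphic E := by
  let r : BalTensor A E A →+ E := BalTensor.lift
    (AddMonoidHom.mk' (fun e => AddMonoidHom.mk' (fun a : A => MulOpposite.op a • e)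
      (fun a b => by rw [MulOpposite.op_add, add_smul])) (fun e e' => by
        ext a; exact smul_add (MulOpposite.op a) e e'))
    (fun e a b => (mul_smul (MulOpposite.op b) (MulOpposite.op a) e).symm)
  refine ⟨{ toFun := r
            invFun := fun e => BalTensor.tmul A (E := E) e (1 : A)
            left_inv := fun z => ?_
            right_inv := fun e => one_smul Aᵐᵒᵖ e
            map_add' := map_add r
            map_smul' := fun a z => ?_ }, fun a z => ?_⟩
  · refine DFunLike.congr_fun (f := r.comp (DistribSMul.toAddMonoidHom (BalTensor A E A) a))
      (g := (DistribSMul.toAddMonoidHom E a).comp r) (BalTensor.hom_ext fun e b => ?_) z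
    exact (smul_comm a (MulOpposite.op b) e).symm
  · refine DFunLike.congr_fun (f := ((BalTensor.mk A E A).flip 1).comp r)
      (g := AddMonoidHom.id _) (BalTensor.hom_ext fun e a => ?_) z
    change BalTensor.tmul A (MulOpposite.op a • e) (1 : A) = BalTensor.tmul A e a
    rw [BalTensor.smul_tmul, smul_eq_mul, mul_one]
  · refine DFunLike.congr_fun (f := r.comp (BalTensor.mapRight
      (elementHom (X := ModuleCat.of A A) a).hom))
      (g := (DistribSMul.toAddMonoidHom E (MulOpposite.op a)).comp r)
      (BalTensor.hom_ext fun e b => ?_) z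
    exact mul_smul (MulOpposite.op a) (MulOpposite.op b) e

/-! ### The grading of a comodule algebra over the group algebra of `ℤ` -/

section HCoeff

variable (V : Type u) [AddCommGroup V] [Module ℂ V]

/-- The coefficient of the basis element `n` in an element of `V ⊗ ℂℤ`. -/
noncomputable def hcoeff (n : ℤ) : V ⊗[ℂ] AddMonoidAlgebra ℂ ℤ →ₗ[ℂ] V :=
  (TensorProduct.rid ℂ V).toLinearMap ∘ₗ
    (Finsupp.lapply n ∘ₗ (AddMonoidAlgebra.coeffLinearEquiv ℂ).toLinearMap).lTensor V

variable {V}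

theorem hcoeff_tmul (n : ℤ) (v : V) (p : AddMonoidAlgebra ℂ ℤ) :
    hcoeff V n (v ⊗ₜ p) = p.coeff n • v := rfl

theorem hcoeff_single (n m : ℤ) (v : V) :
    hcoeff V n (v ⊗ₜ AddMonoidAlgebra.single m (1 : ℂ)) = if m = n then v else 0 := by
  rw [hcoeff_tmul, AddMonoidAlgebra.coeff_single, Finsupp.single_apply]
  split_ifs
  · exact one_smul ℂ v
  · exact zero_smul ℂ v

@[elab_as_elim]
theorem tensor_single_induction {p : V ⊗[ℂ] AddMonoidAlgebra ℂ ℤ → Prop} (h0 : p 0)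
    (hs : ∀ v (n : ℤ), p (v ⊗ₜ AddMonoidAlgebra.single n (1 : ℂ)))
    (ha : ∀ x y, p x → p y → p (x + y)) (z : V ⊗[ℂ] AddMonoidAlgebra ℂ ℤ) : p z := by
  induction z with
  | zero => exact h0
  | add x y hx hy => exact ha x y hx hy
  | tmul v q =>
    induction q using AddMonoidAlgebra.induction_linear with
    | zero => rw [TensorProduct.tmul_zero]; exact h0
    | add q q' h h' => rw [TensorProduct.tmul_add]; exact ha _ _ h h'
    | single m r =>
      have h : v ⊗ₜ[ℂ] AddMonoidAlgebra.single m r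
          = (r • v) ⊗ₜ[ℂ] AddMonoidAlgebra.single m (1 : ℂ) := by
        rw [TensorProduct.smul_tmul, AddMonoidAlgebra.smul_single, smul_eq_mul, mul_one]
      rw [h]
      exact hs _ _

/-- An element of `V ⊗ ℂℤ` is the sum of its coefficients. Allowing every finite set of degrees that
contains `s` makes the statement additive in `z`. -/
theorem exists_eq_sum_hcoeff (z : V ⊗[ℂ] AddMonoidAlgebra ℂ ℤ) :
    ∃ s : Finset ℤ, ∀ t, s ⊆ t →
      z = ∑ n ∈ t, hcoeff V n z ⊗ₜ[ℂ] AddMonoidAlgebra.single n (1 : ℂ) := by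
  classical
  induction z using tensor_single_induction with
  | h0 => exact ⟨∅, fun t _ => by simp⟩
  | hs v m =>
    refine ⟨{m}, fun t ht => ?_⟩
    rw [Finset.sum_eq_single_of_mem m (ht (Finset.mem_singleton_self m)), hcoeff_single, if_pos rfl]
    intro n _ hn
    rw [hcoeff_single, if_neg hn.symm, TensorProduct.zero_tmul]
  | ha x y hx hy =>
    obtain ⟨s, hs⟩ := hx
    obtain ⟨s', hs'⟩ := hy
    refine ⟨s ∪ s', fun t ht => ?_⟩
    simp_rw [map_add, TensorProduct.add_tmul]
    rw [Finset.sum_add_distrib, ← hs t (Finset.union_subset_left ht),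
      ← hs' t (Finset.union_subset_right ht)]

end HCoeff

namespace ComodAlg

variable {A : Type u} [Ring A] [Algebra ℂ A] (C : ComodAlg A (AddMonoidAlgebra ℂ ℤ))

variable {C} in
theorem mem_degree {n : ℤ} {c : C.carrier} :
    c ∈ C.degreeSubgroup n ↔ C.ρ c = c ⊗ₜ[ℂ] AddMonoidAlgebra.single n (1 : ℂ) := Iff.rfl

variable {C} in
theorem mul_mem_degree {m n : ℤ} {x y : C.carrier} (hx : x ∈ C.degreeSubgroup m)
    (hy : y ∈ C.degreeSubgroup n) : x * y ∈ C.degreeSubgroup (m + n) := by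
  rw [mem_degree] at *
  rw [map_mul, hx, hy, Algebra.TensorProduct.tmul_mul_tmul, AddMonoidAlgebra.single_mul_single,
    one_mul]

theorem ι_mem_degree (a : A) : C.ι a ∈ C.degreeSubgroup 0 := C.ρ_ι a

/-- The projection of `C` to its part of degree `n`. -/
noncomputable def proj (n : ℤ) : C.carrier →ₗ[ℂ] C.carrier :=
  hcoeff C.carrier n ∘ₗ C.ρ.toLinearMap

theorem proj_apply (n : ℤ) (c : C.carrier) : C.proj n c = hcoeff C.carrier n (C.ρ c) := rfl

/-- By coassociativity the coefficients of `ρ(c)` are homogeneous. -/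
theorem proj_mem (n : ℤ) (c : C.carrier) : C.proj n c ∈ C.degreeSubgroup n := by
  let H := AddMonoidAlgebra ℂ ℤ
  -- Both sides of coassociativity are compared after taking the coefficient of `n` in the last
  -- tensor factor.
  let T : C.carrier ⊗[ℂ] (H ⊗[ℂ] H) →ₗ[ℂ] C.carrier ⊗[ℂ] H := (hcoeff H n).lTensor C.carrier
  have h1 : ∀ z : C.carrier ⊗[ℂ] H,
      T (TensorProduct.assoc ℂ C.carrier H H (C.ρ.toLinearMap.rTensor H z))
        = C.ρ (hcoeff C.carrier n z) := by
    intro z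
    induction z using tensor_single_induction with
    | h0 => simp only [map_zero]
    | ha x y hx hy => simp only [map_add, hx, hy]
    | hs v m =>
      rw [LinearMap.rTensor_tmul, hcoeff_single, AlgHom.toLinearMap_apply]
      have h2 : ∀ w : C.carrier ⊗[ℂ] H, T (TensorProduct.assoc ℂ C.carrier H H
          (w ⊗ₜ AddMonoidAlgebra.single m (1 : ℂ))) = if m = n then w else 0 := by
        intro w
        induction w with
        | zero => rw [TensorProduct.zero_tmul, map_zero, map_zero, ite_self]
        | add x y hx hy =>
          rw [TensorProduct.add_tmul, map_add, map_add, hx, hy]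
          split_ifs
          · rfl
          · exact add_zero _
        | tmul x p =>
          rw [TensorProduct.assoc_tmul]
          change x ⊗ₜ[ℂ] hcoeff H n (p ⊗ₜ[ℂ] AddMonoidAlgebra.single m (1 : ℂ)) = _
          rw [hcoeff_single]
          split_ifs
          · rfl
          · exact TensorProduct.tmul_zero _ _
      rw [h2]
      split_ifs
      · rfl
      · exact (map_zero C.ρ).symm
  have h3 : ∀ z : C.carrier ⊗[ℂ] H,
      T ((Coalgebra.comul (R := ℂ) (A := H)).lTensor C.carrier z)
        = hcoeff C.carrier n z ⊗ₜ[ℂ] AddMonoidAlgebra.single n (1 : ℂ) := by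
    intro z
    induction z using tensor_single_induction with
    | h0 => simp only [map_zero, TensorProduct.zero_tmul]
    | ha x y hx hy => simp only [map_add, hx, hy, TensorProduct.add_tmul]
    | hs v m =>
      have h4 : Coalgebra.comul (R := ℂ) (A := H) (AddMonoidAlgebra.single m (1 : ℂ))
          = AddMonoidAlgebra.single m (1 : ℂ) ⊗ₜ[ℂ] AddMonoidAlgebra.single m (1 : ℂ) := by
        rw [AddMonoidAlgebra.comul_single]
        simp
      rw [LinearMap.lTensor_tmul, h4, hcoeff_single]
      change v ⊗ₜ[ℂ] hcoeff H n (_ ⊗ₜ[ℂ] _) = _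
      rw [hcoeff_single]
      split_ifs with hmn
      · rw [hmn]
      · rw [TensorProduct.tmul_zero, TensorProduct.zero_tmul]
  rw [mem_degree, proj_apply, ← h1, C.coassoc, h3]

variable {C}

theorem proj_of_mem {m : ℤ} {c : C.carrier} (hc : c ∈ C.degreeSubgroup m) (n : ℤ) :
    C.proj n c = if m = n then c else 0 := by
  rw [proj_apply, mem_degree.1 hc, hcoeff_single]

theorem proj_self_of_mem {m : ℤ} {c : C.carrier} (hc : c ∈ C.degreeSubgroup m) :
    C.proj m c = c := by
  rw [proj_of_mem hc, if_pos rfl]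

/-- By counitality every element is the sum of its homogeneous parts. -/
theorem exists_eq_sum_proj (c : C.carrier) : ∃ s : Finset ℤ, c = ∑ n ∈ s, C.proj n c := by
  obtain ⟨s, hs⟩ := exists_eq_sum_hcoeff (C.ρ c)
  refine ⟨s, ?_⟩
  have h := C.counit c
  rw [hs s subset_rfl, map_sum, map_sum] at h
  refine h.symm.trans (Finset.sum_congr rfl fun n _ => ?_)
  rw [LinearMap.lTensor_tmul, AddMonoidAlgebra.counit_single]
  simp [proj_apply]

@[elab_as_elim]
theorem degree_induction {p : C.carrier → Prop} (h0 : p 0)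
    (hp : ∀ n, ∀ c ∈ C.degreeSubgroup n, p c) (ha : ∀ x y, p x → p y → p (x + y))
    (c : C.carrier) : p c := by
  obtain ⟨s, hs⟩ := C.exists_eq_sum_proj c
  rw [hs]
  exact Finset.sum_induction _ p ha h0 fun n _ => hp n _ (C.proj_mem n c)

theorem eq_zero_of_proj {c : C.carrier} (h : ∀ n, C.proj n c = 0) : c = 0 := by
  obtain ⟨s, hs⟩ := C.exists_eq_sum_proj c
  rw [hs]
  exact Finset.sum_eq_zero fun n _ => h n

theorem proj_mul_of_mem {n : ℤ} {y : C.carrier} (hy : y ∈ C.degreeSubgroup n) (m : ℤ)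
    (c : C.carrier) : C.proj m (c * y) = C.proj (m - n) c * y := by
  induction c using degree_induction with
  | h0 => simp only [zero_mul, map_zero]
  | ha x y hx hy => simp only [add_mul, map_add, hx, hy]
  | hp k c hc =>
    rw [proj_of_mem hc, proj_of_mem (mul_mem_degree hc hy), ite_mul, zero_mul]
    exact if_congr (by omega) rfl rfl

/-! ### Strong gradings and Hopf–Galois extensions -/

variable (C) in
/-- The unit of `C` lies in `C₋ₙ Cₙ`. -/
def UnitAt (n : ℤ) : Prop :=
  ∃ (I : Type) (_ : Fintype I) (x y : I → C.carrier),
    (∀ i, x i ∈ C.degreeSubgroup (-n)) ∧ (∀ i, y i ∈ C.degreeSubgroup n) ∧ ∑ i, x i * y i = 1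

theorem one_mem_degree : (1 : C.carrier) ∈ C.degreeSubgroup 0 := by
  rw [← map_one C.ι]
  exact C.ι_mem_degree 1

theorem unitAt_zero : C.UnitAt 0 :=
  ⟨Unit, inferInstance, fun _ => 1, fun _ => 1, fun _ => one_mem_degree, fun _ => one_mem_degree,
    by simp⟩

theorem UnitAt.add {m n : ℤ} (hm : C.UnitAt m) (hn : C.UnitAt n) : C.UnitAt (m + n) := by
  obtain ⟨I, _, x, y, hx, hy, h⟩ := hm
  obtain ⟨J, _, x', y', hx', hy', h'⟩ := hn
  refine ⟨I × J, inferInstance, fun p => x p.1 * x' p.2, fun p => y' p.2 * y p.1,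
    fun p => ?_, fun p => ?_, ?_⟩
  · rw [neg_add]
    exact mul_mem_degree (hx p.1) (hx' p.2)
  · rw [add_comm m n]
    exact mul_mem_degree (hy' p.2) (hy p.1)
  · rw [Fintype.sum_prod_type, ← h]
    refine Finset.sum_congr rfl fun i _ => ?_
    calc ∑ j, x i * x' j * (y' j * y i) = x i * (∑ j, x' j * y' j) * y i := by
          rw [Finset.mul_sum, Finset.sum_mul]
          exact Finset.sum_congr rfl fun j _ => by simp only [mul_assoc]
      _ = x i * y i := by rw [h', mul_one]

theorem unitAt_of_one_of_neg_one (h1 : C.UnitAt 1) (h2 : C.UnitAt (-1)) (n : ℤ) : C.UnitAt n := by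
  induction n using Int.induction_on with
  | zero => exact unitAt_zero
  | succ n ih => exact ih.add h1
  | pred n ih => exact ih.add h2

variable (C) in
/-- The pure tensors of `C ⊗_A C`. -/
noncomputable def ctm : C.carrier →+ C.carrier →+ C.bimod.tensor C.bimod :=
  Bimod.tm (E := C.bimod) (F := C.bimod)

theorem ctm_mul_ι (c' : C.carrier) (a : A) (c : C.carrier) :
    C.ctm (c' * C.ι a) c = C.ctm c' (C.ι a * c) :=
  Bimod.tm_smul (E := C.bimod) (F := C.bimod) a c' c

theorem exists_sum_ctm (z : C.bimod.tensor C.bimod) :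
    ∃ (I : Type) (_ : Fintype I) (x y : I → C.carrier), z = ∑ i, C.ctm (x i) (y i) :=
  Bimod.exists_sum_tm z

@[elab_as_elim]
theorem ctm_induction {p : C.bimod.tensor C.bimod → Prop} (h0 : p 0)
    (ht : ∀ c' c : C.carrier, p (C.ctm c' c)) (ha : ∀ x y, p x → p y → p (x + y))
    (z : C.bimod.tensor C.bimod) : p z :=
  Bimod.tensor_induction (E := C.bimod) (F := C.bimod) h0 ht ha z

theorem can_ctm (c' c : C.carrier) :
    C.can (C.ctm c' c) = (c' ⊗ₜ[ℂ] 1) * C.ρ c := rfl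

theorem can_ctm_of_mem {n : ℤ} (c' : C.carrier) {c : C.carrier} (hc : c ∈ C.degreeSubgroup n) :
    C.can (C.ctm c' c)
      = (c' * c) ⊗ₜ[ℂ] AddMonoidAlgebra.single n (1 : ℂ) := by
  rw [can_ctm, mem_degree.1 hc, Algebra.TensorProduct.tmul_mul_tmul, one_mul]

theorem hcoeff_can_ctm (n : ℤ) (c' c : C.carrier) :
    hcoeff C.carrier n (C.can (C.ctm c' c))
      = c' * C.proj n c := by
  rw [can_ctm, proj_apply]
  generalize C.ρ c = z
  induction z using tensor_single_induction with
  | h0 => simp only [map_zero, mul_zero]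
  | ha x y hx hy => simp only [map_add, mul_add, hx, hy]
  | hs v m =>
    rw [Algebra.TensorProduct.tmul_mul_tmul, one_mul, hcoeff_single, hcoeff_single, mul_ite,
      mul_zero]

/-- Surjectivity of the canonical map puts the unit of `C` into every `C₋ₙ Cₙ`: take the
component of degree `0` of the coefficient of `n` in a preimage of `1 ⊗ n`. -/
theorem IsHopfGalois.unitAt (h : C.IsHopfGalois) (n : ℤ) : C.UnitAt n := by
  obtain ⟨z, hz⟩ := h.can_bijective.2 ((1 : C.carrier) ⊗ₜ[ℂ] AddMonoidAlgebra.single n (1 : ℂ))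
  obtain ⟨I, _, x, y, rfl⟩ := exists_sum_ctm z
  refine ⟨I, inferInstance, fun i => C.proj (-n) (x i), fun i => C.proj n (y i),
    fun i => C.proj_mem _ _, fun i => C.proj_mem _ _, ?_⟩
  have h1 := congrArg (hcoeff C.carrier n) hz
  rw [map_sum, map_sum, hcoeff_single, if_pos rfl] at h1
  have h2 := congrArg (C.proj 0) h1
  rw [map_sum, proj_self_of_mem one_mem_degree] at h2
  rw [← h2]
  refine Finset.sum_congr rfl fun i _ => ?_
  rw [hcoeff_can_ctm, proj_mul_of_mem (C.proj_mem n (y i)), zero_sub]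

/-- Strongly graded algebras have a bijective canonical map, whose inverse sends `c ⊗ n` to
`∑ c xᵢ ⊗ yᵢ`, where `1 = ∑ xᵢ yᵢ` in `C₋ₙ Cₙ`. -/
theorem can_bijective_of_unitAt (h : ∀ n, C.UnitAt n)
    (h0 : ∀ c ∈ C.degreeSubgroup 0, c ∈ Set.range C.ι) : Function.Bijective C.can := by
  classical
  choose I hI x y hx hy hxy using h
  -- `J n c` is the preimage `∑ c xᵢ ⊗ yᵢ` of `c ⊗ n`.
  let J : ℤ → C.carrier →+ C.bimod.tensor C.bimod := fun n =>
    AddMonoidHom.mk' (fun c => ∑ i, C.ctm (c * x n i) (y n i)) (fun c c' => by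
      simp only [add_mul, map_add, AddMonoidHom.add_apply, Finset.sum_add_distrib])
  -- `c xᵢ` has degree `0`, so it lies in `A` and moves across the tensor product.
  have hJ : ∀ n c' c, c ∈ C.degreeSubgroup n → J n (c' * c) = C.ctm c' c := by
    intro n c' c hc
    have h1 : ∀ i, C.ctm (c' * c * x n i) (y n i) = C.ctm c' (c * x n i * y n i) := by
      intro i
      have h2 := mul_mem_degree hc (hx n i)
      rw [add_neg_cancel] at h2
      obtain ⟨a, ha⟩ := h0 _ h2
      rw [mul_assoc, ← ha]
      rw [ctm_mul_ι]
    change ∑ i, C.ctm (c' * c * x n i) (y n i) = _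
    simp_rw [h1, mul_assoc]
    rw [← map_sum, ← Finset.mul_sum, hxy, mul_one]
  constructor
  -- Every `z` is recovered from `can z` by a finite sum; the sets `r ⊇ s` make this additive in `z`.
  · have key : ∀ z, ∃ s : Finset ℤ, ∀ r, s ⊆ r →
        z = ∑ n ∈ r, J n (hcoeff C.carrier n (C.can z)) := by
      intro z
      have hadd : ∀ z z', (∃ s : Finset ℤ, ∀ r, s ⊆ r →
          z = ∑ n ∈ r, J n (hcoeff C.carrier n (C.can z))) → (∃ s : Finset ℤ, ∀ r, s ⊆ r →
          z' = ∑ n ∈ r, J n (hcoeff C.carrier n (C.can z'))) → (∃ s : Finset ℤ, ∀ r, s ⊆ r →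
          z + z' = ∑ n ∈ r, J n (hcoeff C.carrier n (C.can (z + z')))) := by
        rintro z z' ⟨s, hs⟩ ⟨s', hs'⟩
        refine ⟨s ∪ s', fun r hr => ?_⟩
        simp_rw [map_add]
        rw [Finset.sum_add_distrib, ← hs r (Finset.union_subset_left hr),
          ← hs' r (Finset.union_subset_right hr)]
      have hzero : ∃ s : Finset ℤ, ∀ r, s ⊆ r →
          (0 : C.bimod.tensor C.bimod)
            = ∑ n ∈ r, J n (hcoeff C.carrier n (C.can 0)) := ⟨∅, fun r _ => by simp⟩
      induction z using ctm_induction with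
      | h0 => exact hzero
      | ha z z' hz hz' => exact hadd z z' hz hz'
      | ht c' c =>
        refine degree_induction (C := C) (p := fun c => ∃ s : Finset ℤ, ∀ r, s ⊆ r →
          C.ctm c' c = ∑ n ∈ r, J n (hcoeff C.carrier n (C.can (C.ctm c' c)))) ?_ ?_ ?_ c
        · rw [map_zero]; exact hzero
        · intro m c hc
          refine ⟨{m}, fun r hr => ?_⟩
          rw [Finset.sum_eq_single_of_mem m (hr (Finset.mem_singleton_self m))]
          · rw [can_ctm_of_mem c' hc, hcoeff_single, if_pos rfl, hJ m c' c hc]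
          · intro n _ hn
            rw [can_ctm_of_mem c' hc, hcoeff_single, if_neg hn.symm, map_zero]
        · intro c c'' h h'
          rw [map_add]
          exact hadd _ _ h h'
    refine (injective_iff_map_eq_zero _).2 fun z hz => ?_
    obtain ⟨s, hs⟩ := key z
    rw [hs s subset_rfl]
    refine Finset.sum_eq_zero fun n _ => ?_
    rw [hz, map_zero, map_zero]
  · intro z
    induction z using tensor_single_induction with
    | h0 => exact ⟨0, map_zero _⟩
    | ha x y hx hy =>
      obtain ⟨z, rfl⟩ := hx
      obtain ⟨z', rfl⟩ := hy
      exact ⟨z + z', map_add _ _ _⟩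
    | hs c n =>
      refine ⟨∑ i, C.ctm (c * x n i) (y n i), ?_⟩
      rw [map_sum, Finset.sum_congr rfl fun i _ => can_ctm_of_mem (c * x n i) (hy n i)]
      simp_rw [mul_assoc]
      rw [← TensorProduct.sum_tmul, ← Finset.mul_sum, hxy, mul_one]

end ComodAlg

/-! ### The line module in degree one of a Hopf–Galois extension -/

namespace ComodAlg

variable {A : Type u} [Ring A] [Algebra ℂ A] {C : ComodAlg A (AddMonoidAlgebra ℂ ℤ)}

/-- The identification `A ≅ C₀`. -/
noncomputable def IsHopfGalois.degreeZeroEquiv (h : C.IsHopfGalois) : A ≃+ C.degreeSubgroup 0 :=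
  AddEquiv.ofBijective
    (AddMonoidHom.mk' (fun a => (⟨C.ι a, C.ι_mem_degree a⟩ : C.degreeSubgroup 0))
      (fun a b => Subtype.ext (map_add C.ι a b)))
    ⟨fun a b hab => h.ι_injective (congrArg Subtype.val hab), fun c => by
      obtain ⟨a, ha⟩ := h.coinvariants c c.2
      exact ⟨a, Subtype.ext ha⟩⟩

theorem IsHopfGalois.ι_degreeZeroEquiv_symm (h : C.IsHopfGalois) (c : C.degreeSubgroup 0) :
    C.ι (h.degreeZeroEquiv.symm c) = c :=
  congrArg Subtype.val (h.degreeZeroEquiv.apply_symm_apply c)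

theorem exists_ι_eq_of_mem (h : C.IsHopfGalois) {c : C.carrier} (hc : c ∈ C.degreeSubgroup 0) :
    ∃ a, C.ι a = c := h.coinvariants c hc

variable (C) in
/-- The product `C_m × C_n → C₀` for `m + n = 0`. -/
def degreeMul {m n : ℤ} (hmn : m + n = 0) : C.degree m →+ C.degree n →+ C.degreeSubgroup 0 :=
  AddMonoidHom.mk' (fun x => AddMonoidHom.mk' (fun y =>
      (⟨x.1 * y.1, hmn ▸ mul_mem_degree x.2 y.2⟩ : C.degreeSubgroup 0))
      (fun _ _ => Subtype.ext (mul_add _ _ _)))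
    (fun _ _ => by ext y; exact add_mul _ _ _)

/-- The product `C_m ⊗_A C_n → C₀ ≅ A` for `m + n = 0`. -/
noncomputable def IsHopfGalois.degreePairing (h : C.IsHopfGalois) {m n : ℤ} (hmn : m + n = 0) :
    (C.degree m).tensor (C.degree n) →+ A :=
  h.degreeZeroEquiv.symm.toAddMonoidHom.comp (Bimod.tlift (C.degreeMul hmn) (fun x a y =>
    Subtype.ext (mul_assoc (x : C.degreeSubgroup m).1 (C.ι a) (y : C.degreeSubgroup n).1)))

theorem IsHopfGalois.ι_degreePairing (h : C.IsHopfGalois) {m n : ℤ} (hmn : m + n = 0)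
    (x : C.degreeSubgroup m) (y : C.degreeSubgroup n) :
    C.ι (h.degreePairing hmn (Bimod.tm (E := C.degree m) (F := C.degree n) x y))
      = (x : C.carrier) * y := h.ι_degreeZeroEquiv_symm _

theorem IsHopfGalois.degreePairing_smul (h : C.IsHopfGalois) {m n : ℤ} (hmn : m + n = 0) (a : A)
    (z : (C.degree m).tensor (C.degree n)) :
    h.degreePairing hmn (a • z) = a * h.degreePairing hmn z := by
  induction z using Bimod.tensor_induction with
  | h0 => rw [smul_zero, map_zero, mul_zero]
  | ha x y hx hy => rw [smul_add, map_add, map_add, mul_add, hx, hy]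
  | ht x y =>
    refine h.ι_injective ?_
    rw [map_mul, Bimod.smul_tm]
    refine (h.ι_degreePairing hmn (a • (x : C.degreeSubgroup m)) y).trans ?_
    refine Eq.trans ?_ (congrArg (C.ι a * ·) (h.ι_degreePairing hmn x y).symm)
    exact mul_assoc _ _ _

theorem IsHopfGalois.degreePairing_op_smul (h : C.IsHopfGalois) {m n : ℤ} (hmn : m + n = 0)
    (a : A) (z : (C.degree m).tensor (C.degree n)) :
    h.degreePairing hmn (MulOpposite.op a • z) = h.degreePairing hmn z * a := by
  induction z using Bimod.tensor_induction with
  | h0 => rw [smul_zero, map_zero, zero_mul]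
  | ha x y hx hy => rw [smul_add, map_add, map_add, add_mul, hx, hy]
  | ht x y =>
    refine h.ι_injective ?_
    rw [map_mul, Bimod.op_smul_tm]
    refine (h.ι_degreePairing hmn x (MulOpposite.op a • (y : C.degreeSubgroup n))).trans ?_
    refine Eq.trans ?_ (congrArg (· * C.ι a) (h.ι_degreePairing hmn x y).symm)
    exact (mul_assoc _ _ _).symm

theorem IsHopfGalois.degreePairing_assoc (h : C.IsHopfGalois) {m n : ℤ} (hmn : m + n = 0)
    (hnm : n + m = 0) (x : C.degree m) (y : C.degree n) (x' : C.degree m) :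
    h.degreePairing hmn (Bimod.tm x y) • x'
      = MulOpposite.op (h.degreePairing hnm (Bimod.tm y x')) • x := by
  refine Subtype.ext ?_
  refine (congrArg (· * (x' : C.degreeSubgroup m).1) (h.ι_degreePairing hmn x y)).trans ?_
  refine Eq.trans ?_ (congrArg ((x : C.degreeSubgroup m).1 * ·) (h.ι_degreePairing hnm y x').symm)
  exact mul_assoc _ _ _

theorem IsHopfGalois.degreePairing_surjective (h : C.IsHopfGalois) {m n : ℤ} (hmn : m + n = 0) :
    Function.Surjective (h.degreePairing hmn) := by
  obtain rfl : m = -n := by omega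
  obtain ⟨I, _, x, y, hx, hy, hxy⟩ := h.unitAt n
  have h1 : h.degreePairing hmn (∑ i, Bimod.tm (E := C.degree (-n)) (F := C.degree n)
      (⟨x i, hx i⟩ : C.degreeSubgroup (-n)) (⟨y i, hy i⟩ : C.degreeSubgroup n)) = 1 := by
    refine h.ι_injective ?_
    rw [map_sum, map_sum, map_one, ← hxy]
    exact Finset.sum_congr rfl fun i _ => h.ι_degreePairing hmn ⟨x i, hx i⟩ ⟨y i, hy i⟩
  intro a
  exact ⟨a • _, (h.degreePairing_smul hmn a _).trans (by rw [h1, mul_one])⟩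

/-- The Morita context `(A, A, C₁, C₋₁)` of a Hopf–Galois extension, with the product of `C`. -/
noncomputable def IsHopfGalois.degreeContext (h : C.IsHopfGalois) : MoritaContext A where
  E := C.degree 1
  F := C.degree (-1)
  μ₁ := h.degreePairing (m := 1) (n := -1) rfl
  μ₂ := h.degreePairing (m := -1) (n := 1) rfl
  μ₁_left := h.degreePairing_smul rfl
  μ₁_right := h.degreePairing_op_smul rfl
  μ₂_left := h.degreePairing_smul rfl
  μ₂_right := h.degreePairing_op_smul rfl
  assoc₁ := h.degreePairing_assoc rfl rfl
  assoc₂ := h.degreePairing_assoc rfl rfl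

theorem IsHopfGalois.degree_one_isLeftLine (h : C.IsHopfGalois) : (C.degree 1).IsLeftLine :=
  MoritaContext.IsStrict.isLeftLine (M := h.degreeContext)
    ⟨h.degreePairing_surjective rfl, h.degreePairing_surjective rfl⟩

/-! ### Morphisms of Hopf–Galois extensions -/

theorem proj_map {C D : ComodAlg A (AddMonoidAlgebra ℂ ℤ)} (f : C.carrier →ₐ[ℂ] D.carrier)
    (hf : ∀ c, D.ρ (f c) = Algebra.TensorProduct.map f (AlgHom.id ℂ _) (C.ρ c)) (n : ℤ)
    (c : C.carrier) : D.proj n (f c) = f (C.proj n c) := by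
  rw [proj_apply, proj_apply, hf]
  generalize C.ρ c = z
  induction z using tensor_single_induction with
  | h0 => simp only [map_zero]
  | ha x y hx hy => simp only [map_add, hx, hy]
  | hs v m =>
    rw [Algebra.TensorProduct.map_tmul, AlgHom.id_apply, hcoeff_single, hcoeff_single]
    split_ifs
    · rfl
    · exact (map_zero f).symm

theorem map_mem_degree {C D : ComodAlg A (AddMonoidAlgebra ℂ ℤ)} (f : C.carrier →ₐ[ℂ] D.carrier)
    (hf : ∀ c, D.ρ (f c) = Algebra.TensorProduct.map f (AlgHom.id ℂ _) (C.ρ c)) {n : ℤ}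
    {c : C.carrier} (hc : c ∈ C.degreeSubgroup n) : f c ∈ D.degreeSubgroup n := by
  rw [mem_degree, hf, mem_degree.1 hc, Algebra.TensorProduct.map_tmul, AlgHom.id_apply]

/-- Every morphism of Hopf–Galois extensions of `A` is bijective: since `1 ∈ C₋ₙ Cₙ`, it is
determined on `Cₙ` by its restriction to the coinvariants. -/
theorem bijective_of_comod_map {C D : ComodAlg A (AddMonoidAlgebra ℂ ℤ)} (hC : C.IsHopfGalois)
    (hD : D.IsHopfGalois) (f : C.carrier →ₐ[ℂ] D.carrier) (hι : ∀ a, f (C.ι a) = D.ι a)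
    (hf : ∀ c, D.ρ (f c) = Algebra.TensorProduct.map f (AlgHom.id ℂ _) (C.ρ c)) :
    Function.Bijective f := by
  constructor
  · refine (injective_iff_map_eq_zero f).2 fun c hc => eq_zero_of_proj fun n => ?_
    have h1 : f (C.proj n c) = 0 := by rw [← proj_map f hf, hc, map_zero]
    obtain ⟨I, _, x, y, hx, -, hxy⟩ := hC.unitAt n
    rw [← mul_one (C.proj n c), ← hxy, Finset.mul_sum]
    refine Finset.sum_eq_zero fun i _ => ?_
    have h2 := mul_mem_degree (C.proj_mem n c) (hx i)
    rw [add_neg_cancel] at h2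
    obtain ⟨a, ha⟩ := exists_ι_eq_of_mem hC h2
    have h3 : a = 0 := hD.ι_injective (by rw [← hι, ha, map_mul, h1, zero_mul, map_zero])
    rw [← mul_assoc, ← ha, h3, map_zero, zero_mul]
  · intro d
    induction d using degree_induction with
    | h0 => exact ⟨0, map_zero f⟩
    | ha x y hx hy =>
      obtain ⟨c, rfl⟩ := hx
      obtain ⟨c', rfl⟩ := hy
      exact ⟨c + c', map_add f c c'⟩
    | hp n d hd =>
      obtain ⟨I, _, x, y, hx, -, hxy⟩ := hC.unitAt n
      have h1 : ∀ i, ∃ a, D.ι a = d * f (x i) := fun i => by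
        have h2 := mul_mem_degree hd (map_mem_degree f hf (hx i))
        rw [add_neg_cancel] at h2
        exact exists_ι_eq_of_mem hD h2
      choose a ha using h1
      refine ⟨∑ i, C.ι (a i) * y i, ?_⟩
      simp_rw [map_sum, map_mul, hι, ha, mul_assoc]
      rw [← Finset.mul_sum]
      simp_rw [← map_mul]
      rw [← map_sum, hxy, map_one, mul_one]

theorem Isomorphic.degree {C D : ComodAlg A (AddMonoidAlgebra ℂ ℤ)} (h : C.Isomorphic D) (n : ℤ) :
    (C.degree n).Isomorphic (D.degree n) := by
  obtain ⟨f, hι, hf⟩ := h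
  let g : C.degreeSubgroup n →ₗ[A] D.degreeSubgroup n :=
    { toFun := fun c => ⟨f c, map_mem_degree f.toAlgHom hf c.2⟩
      map_add' := fun c c' => Subtype.ext (map_add f c.1 c'.1)
      map_smul' := fun a c => Subtype.ext ((map_mul f (C.ι a) c.1).trans
        (congrArg (· * f c.1) (hι a))) }
  have hg : Function.Bijective g := by
    refine ⟨fun c c' hcc => Subtype.ext (f.injective (congrArg Subtype.val hcc)), fun d => ?_⟩
    obtain ⟨c, hc⟩ := f.surjective d.1
    refine ⟨⟨C.proj n c, C.proj_mem n c⟩, Subtype.ext ?_⟩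
    have h1 := proj_map f.toAlgHom hf n c
    exact h1.symm.trans ((congrArg (D.proj n) hc).trans (proj_self_of_mem d.2))
  exact ⟨LinearEquiv.ofBijective g hg, fun a c => Subtype.ext
    ((map_mul f (c : C.degreeSubgroup n).1 (C.ι a)).trans
      (congrArg (f (c : C.degreeSubgroup n).1 * ·) (hι a)))⟩

end ComodAlg

/-! ### The tensor algebra of a strict Morita context -/

namespace MoritaContext

variable {A : Type u} [Ring A] [Algebra ℂ A] {M : MoritaContext A}

open TensorAlg

theorem inc_mem_degree (n : ℤ) (x : M.piece n) : inc M n x ∈ M.tensorAlg.degreeSubgroup n :=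
  ρ_inc M n x

theorem proj_mem_range_inc (n : ℤ) (c : M.tensorAlg.carrier) :
    ∃ x, inc M n x = M.tensorAlg.proj n c := by
  refine TensorAlg.inc_induction (M := M) (p := fun c => ∃ x, inc M n x = M.tensorAlg.proj n c)
    ⟨0, (map_zero _).trans (map_zero _).symm⟩ (fun m x => ?_) (fun c c' => ?_) c
  · by_cases hmn : m = n
    · subst hmn
      exact ⟨x, (ComodAlg.proj_self_of_mem (inc_mem_degree m x)).symm⟩
    · refine ⟨0, ?_⟩
      rw [map_zero]
      exact ((ComodAlg.proj_of_mem (inc_mem_degree m x) n).trans (if_neg hmn)).symm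
  · rintro ⟨x, hx⟩ ⟨y, hy⟩
    exact ⟨x + y, (map_add _ x y).trans ((congrArg₂ (· + ·) hx hy).trans (map_add _ c c').symm)⟩

theorem tensorAlg_coinvariants {c : M.tensorAlg.carrier} (hc : c ∈ M.tensorAlg.degreeSubgroup 0) :
    c ∈ Set.range M.tensorAlg.ι := by
  obtain ⟨x, hx⟩ := proj_mem_range_inc 0 c
  exact ⟨x, hx.trans (ComodAlg.proj_self_of_mem hc)⟩

theorem tensorAlg_ι_injective : Function.Injective M.tensorAlg.ι := fun _ _ h =>
  DirectSum.of_injective (β := fun n : ℤ => (M.piece n : Type u)) 0 h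

theorem actE_one_mem (e : M.E) : actE M e 1 ∈ M.tensorAlg.degreeSubgroup 1 := by
  change actE M e (incPos M 0 (Bimod.pone _ 1)) ∈ _
  rw [actE_incPos]
  exact inc_mem_degree (M := M) 1 (Bimod.pcons e (Bimod.pone M.E 1))

theorem actF_one_mem (f : M.F) : actF M f 1 ∈ M.tensorAlg.degreeSubgroup (-1) := by
  change actF M f (incNeg M 0 (Bimod.pone _ 1)) ∈ _
  rw [actF_incNeg]
  exact inc_mem_degree (M := M) (-1) (Bimod.pcons f (Bimod.pone M.F 1))

theorem smul_one_eq_ofA (a : A) : a • (1 : M.TensorAlg) = ofA M a := by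
  rw [← ofA_mul, mul_one]

theorem actF_one_mul_actE_one (f : M.F) (e : M.E) :
    actF M f 1 * actE M e 1 = ofA M (M.μ₂ (Bimod.tm f e)) := by
  rw [actF_one_mul, ← smul_one_eq_ofA]
  exact DFunLike.congr_fun (actF_mul_actE M f e) 1

theorem actE_one_mul_actF_one (e : M.E) (f : M.F) :
    actE M e 1 * actF M f 1 = ofA M (M.μ₁ (Bimod.tm e f)) := by
  rw [actE_one_mul, ← smul_one_eq_ofA]
  exact DFunLike.congr_fun (actE_mul_actF M e f) 1

theorem IsStrict.tensorAlg_unitAt_one (h : M.IsStrict) : M.tensorAlg.UnitAt 1 := by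
  obtain ⟨I, _, f, e, hfe⟩ := h.exists_sum_μ₂_eq_one
  refine ⟨I, inferInstance, fun i => actF M (f i) 1, fun i => actE M (e i) 1,
    fun i => actF_one_mem (f i), fun i => actE_one_mem (e i), ?_⟩
  refine (Finset.sum_congr rfl fun i _ => actF_one_mul_actE_one (f i) (e i)).trans ?_
  rw [← map_sum, hfe]
  exact map_one (ofA M)

theorem IsStrict.tensorAlg_unitAt_neg_one (h : M.IsStrict) : M.tensorAlg.UnitAt (-1) := by
  obtain ⟨I, _, e, f, hef⟩ := h.exists_sum_μ₁_eq_one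
  refine ⟨I, inferInstance, fun i => actE M (e i) 1, fun i => actF M (f i) 1,
    fun i => actE_one_mem (e i), fun i => actF_one_mem (f i), ?_⟩
  refine (Finset.sum_congr rfl fun i _ => actE_one_mul_actF_one (e i) (f i)).trans ?_
  rw [← map_sum, hef]
  exact map_one (ofA M)

theorem IsStrict.tensorAlg_isHopfGalois (h : M.IsStrict) : M.tensorAlg.IsHopfGalois where
  ι_injective := tensorAlg_ι_injective
  coinvariants _ hc := tensorAlg_coinvariants hc
  can_bijective := ComodAlg.can_bijective_of_unitAt
    (ComodAlg.unitAt_of_one_of_neg_one h.tensorAlg_unitAt_one h.tensorAlg_unitAt_neg_one)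
    (fun _ hc => tensorAlg_coinvariants hc)

/-- The part of degree `1` of the tensor algebra is `E`. -/
theorem IsStrict.tensorAlg_degree_one (h : M.IsStrict) :
    M.E.Isomorphic (M.tensorAlg.degree 1) := by
  let g : M.E →ₗ[A] M.tensorAlg.degreeSubgroup 1 :=
    { toFun := fun e => ⟨actE M e 1, actE_one_mem e⟩
      map_add' := fun e e' => Subtype.ext
        (DFunLike.congr_fun (map_add (actE M) e e') (1 : M.TensorAlg))
      map_smul' := fun a e => Subtype.ext
        ((DFunLike.congr_fun (actE_smul M a e) (1 : M.TensorAlg)).trans (ofA_mul M a _).symm) }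
  have hg : Function.Bijective g := by
    constructor
    · refine (injective_iff_map_eq_zero g).2 fun e he => ?_
      have h0 : actE M e 1 = 0 := congrArg Subtype.val he
      obtain ⟨I, _, e', f, hef⟩ := h.exists_sum_μ₁_eq_one
      -- `ofA (μ₂(f ⊗ e)) = f e = 0` in the tensor algebra, and `e = ∑ e'ᵢ μ₂(fᵢ ⊗ e)`.
      have hz : ∀ f : M.F, M.μ₂ (Bimod.tm f e) = 0 := fun f => tensorAlg_ι_injective (M := M) <| by
        rw [map_zero]
        refine (actF_one_mul_actE_one f e).symm.trans ?_
        rw [h0, mul_zero]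
        rfl
      rw [← one_smul A e, ← hef, Finset.sum_smul]
      refine Finset.sum_eq_zero fun i _ => ?_
      rw [M.assoc₁, hz, MulOpposite.op_zero, zero_smul]
    · rintro ⟨(c : M.TensorAlg), hc⟩
      obtain ⟨I, _, f, e, hfe⟩ := h.exists_sum_μ₂_eq_one
      have h1 : ∀ i, ∃ a, ofA M a = c * actF M (f i) 1 := fun i =>
        tensorAlg_coinvariants (ComodAlg.mul_mem_degree hc (actF_one_mem (f i)))
      choose a ha using h1
      -- `c = ∑ c fᵢ eᵢ`, where `c fᵢ = aᵢ` has degree `0`.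
      refine ⟨∑ i, a i • e i, Subtype.ext ?_⟩
      change actE M (∑ i, a i • e i) 1 = c
      have h2 : ∀ i, actE M (a i • e i) 1 = c * ofA M (M.μ₂ (Bimod.tm (f i) (e i))) :=
        fun i => by
          rw [← actF_one_mul_actE_one, ← mul_assoc, ← ha, ofA_mul]
          exact DFunLike.congr_fun (actE_smul M (a i) (e i)) (1 : M.TensorAlg)
      have h3 : actE M (∑ i, a i • e i) 1 = ∑ i, actE M (a i • e i) 1 :=
        map_sum (AddMonoidHom.mk' (fun e => actE M e (1 : M.TensorAlg)) (fun e e' =>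
          DFunLike.congr_fun (map_add (actE M) e e') (1 : M.TensorAlg))) _ _
      rw [h3, Finset.sum_congr rfl fun i _ => h2 i, ← Finset.mul_sum, ← map_sum, hfe, map_one,
        mul_one]
  exact ⟨LinearEquiv.ofBijective g hg, fun a e => Subtype.ext <| by
    change actE M (MulOpposite.op a • e) 1 = actE M e 1 * ofA M a
    rw [mul_ofA, actE_op_smul]
    change actE M e (a • 1) = MulOpposite.op a • actE M e 1
    rw [smul_one_eq_ofA, ← op_smul_one, ← actE_one_mul M e (MulOpposite.op a • 1), mul_def,
      mulHom_op_smul, mulHom_one]⟩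

end MoritaContext

/-! ### The universal property of the tensor algebra -/

/-- A ring map `A → R` with additive maps `E → R` and `F → R` that turn the bimodule structures and
the two pairings of the Morita context into products in `R`. -/
structure MoritaContext.HomTo {A : Type u} [Ring A] [Algebra ℂ A] (M : MoritaContext A)
    (R : Type u) [Ring R] where
  i : A →+* R
  φ : M.E →+ R
  ψ : M.F →+ R
  φ_smul : ∀ (a : A) e, φ (a • e) = i a * φ e
  φ_op_smul : ∀ (a : A) e, φ (MulOpposite.op a • e) = φ e * i a
  ψ_smul : ∀ (a : A) f, ψ (a • f) = i a * ψ f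
  ψ_op_smul : ∀ (a : A) f, ψ (MulOpposite.op a • f) = ψ f * i a
  φ_mul_ψ : ∀ e f, φ e * ψ f = i (M.μ₁ (Bimod.tm e f))
  ψ_mul_φ : ∀ f e, ψ f * φ e = i (M.μ₂ (Bimod.tm f e))

namespace MoritaContext.HomTo

open TensorAlg

variable {A : Type u} [Ring A] [Algebra ℂ A] {M : MoritaContext A} {R : Type u} [Ring R]
  (h : M.HomTo R)

/-- The map `e₁ ⊗ ⋯ ⊗ eₙ ↦ φ(e₁) ⋯ φ(eₙ)`. -/
noncomputable def pos (n : ℕ) : M.E.pow n →+ R := (powHomAux h.i h.φ h.φ_smul h.φ_op_smul n).1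

/-- The map `f₁ ⊗ ⋯ ⊗ fₙ ↦ ψ(f₁) ⋯ ψ(fₙ)`. -/
noncomputable def neg (n : ℕ) : M.F.pow n →+ R := (powHomAux h.i h.ψ h.ψ_smul h.ψ_op_smul n).1

theorem pos_pcons (n : ℕ) (e : M.E) (x : M.E.pow n) :
    h.pos (n + 1) (Bimod.pcons e x) = h.φ e * h.pos n x := rfl

theorem neg_pcons (n : ℕ) (f : M.F) (x : M.F.pow n) :
    h.neg (n + 1) (Bimod.pcons f x) = h.ψ f * h.neg n x := rfl

/-- The extension to each homogeneous part of the tensor algebra. -/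
noncomputable def extPiece : (n : ℤ) → M.piece n →+ R
  | .ofNat n => h.pos n
  | .negSucc n => h.neg (n + 1)

/-- The extension to the tensor algebra, as an additive map. -/
noncomputable def ext : M.TensorAlg →+ R := DirectSum.toAddMonoid h.extPiece

theorem ext_inc (n : ℤ) (x : M.piece n) : h.ext (inc M n x) = h.extPiece n x :=
  DirectSum.toAddMonoid_of h.extPiece n x

theorem ext_incPos (n : ℕ) (x : M.E.pow n) : h.ext (incPos M n x) = h.pos n x :=
  h.ext_inc (Int.ofNat n) x

theorem ext_incNeg (n : ℕ) (x : M.F.pow n) : h.ext (incNeg M n x) = h.neg n x := by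
  cases n with
  | zero => exact h.ext_inc (Int.ofNat 0) x
  | succ n => exact h.ext_inc (Int.negSucc n) x

theorem ext_smul (a : A) (y : M.TensorAlg) : h.ext (a • y) = h.i a * h.ext y := by
  induction y using TensorAlg.induction with
  | h0 => rw [smul_zero, map_zero, mul_zero]
  | hpos n x =>
    rw [← incPos_smul, ext_incPos, ext_incPos]
    exact (powHomAux h.i h.φ h.φ_smul h.φ_op_smul n).2 a x
  | hneg n x =>
    rw [← incNeg_smul, ext_incNeg, ext_incNeg]
    exact (powHomAux h.i h.ψ h.ψ_smul h.ψ_op_smul n).2 a x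
  | hadd x y hx hy => rw [smul_add, map_add, map_add, mul_add, hx, hy]

theorem ext_actE (e : M.E) (y : M.TensorAlg) : h.ext (actE M e y) = h.φ e * h.ext y := by
  induction y using TensorAlg.induction' with
  | h0 => rw [map_zero, map_zero, mul_zero]
  | hA b => rw [actE_incPos, ext_incPos, ext_incPos, pos_pcons]
  | hpos n e' x => rw [actE_incPos, ext_incPos, ext_incPos, pos_pcons]
  | hneg n f x =>
    rw [actE_incNeg, ext_smul, ext_incNeg, ext_incNeg, neg_pcons, ← mul_assoc, h.φ_mul_ψ]
  | hadd x y hx hy => rw [map_add, map_add, map_add, mul_add, hx, hy]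

theorem ext_actF (f : M.F) (y : M.TensorAlg) : h.ext (actF M f y) = h.ψ f * h.ext y := by
  induction y using TensorAlg.induction' with
  | h0 => rw [map_zero, map_zero, mul_zero]
  | hA b =>
    change h.ext (actF M f (incNeg M 0 (Bimod.pone _ b)))
      = h.ψ f * h.ext (incNeg M 0 (Bimod.pone _ b))
    rw [actF_incNeg, ext_incNeg, ext_incNeg, neg_pcons]
  | hpos n e x =>
    rw [actF_incPos, ext_smul, ext_incPos, ext_incPos, pos_pcons, ← mul_assoc, h.ψ_mul_φ]
  | hneg n f' x => rw [actF_incNeg, ext_incNeg, ext_incNeg, neg_pcons]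
  | hadd x y hx hy => rw [map_add, map_add, map_add, mul_add, hx, hy]

theorem ext_mul (x y : M.TensorAlg) : h.ext (x * y) = h.ext x * h.ext y := by
  have key : ∀ y, h.ext (mulHom M x y) = h.ext (mulHom M x 1) * h.ext y := by
    refine mulHom_induction M (p := fun φ => ∀ y, h.ext (φ y) = h.ext (φ 1) * h.ext y)
      ?_ ?_ ?_ ?_ ?_ x
    · intro y
      rw [AddMonoid.End.zero_apply, AddMonoid.End.zero_apply, map_zero, zero_mul]
    · intro a y
      change h.ext (a • y) = h.ext (a • 1) * h.ext y
      have h1 : h.ext 1 = 1 := (h.ext_incPos 0 _).trans (map_one h.i)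
      rw [ext_smul, ext_smul, h1, mul_one]
    · intro e φ hφ y
      change h.ext (actE M e (φ y)) = h.ext (actE M e (φ 1)) * h.ext y
      rw [ext_actE, ext_actE, hφ, mul_assoc]
    · intro f φ hφ y
      change h.ext (actF M f (φ y)) = h.ext (actF M f (φ 1)) * h.ext y
      rw [ext_actF, ext_actF, hφ, mul_assoc]
    · intro φ ψ h1 h2 y
      change h.ext (φ y + ψ y) = h.ext (φ 1 + ψ 1) * h.ext y
      rw [map_add, h1, h2, map_add, add_mul]
  rw [mul_def, key, mulHom_one]

theorem ext_ofA (a : A) : h.ext (ofA M a) = h.i a := h.ext_incPos 0 _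

/-- The extension to the tensor algebra, as an algebra map. -/
noncomputable def extAlgHom [Algebra ℂ R]
    (hi : ∀ c : ℂ, h.i (algebraMap ℂ A c) = algebraMap ℂ R c) : M.TensorAlg →ₐ[ℂ] R where
  toFun := h.ext
  map_one' := (h.ext_ofA 1).trans (map_one h.i)
  map_mul' := h.ext_mul
  map_zero' := map_zero h.ext
  map_add' := map_add h.ext
  commutes' c := (h.ext_ofA _).trans (hi c)

/-- If `E` and `F` land in degrees `1` and `-1`, then the extension preserves degrees. -/
theorem extPiece_mem {C : ComodAlg A (AddMonoidAlgebra ℂ ℤ)} (h : M.HomTo C.carrier)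
    (hi : ∀ a, h.i a = C.ι a) (hφ : ∀ e, h.φ e ∈ C.degreeSubgroup 1)
    (hψ : ∀ f, h.ψ f ∈ C.degreeSubgroup (-1)) (n : ℤ) (x : M.piece n) :
    h.extPiece n x ∈ C.degreeSubgroup n := by
  have h0 : ∀ a, h.i a ∈ C.degreeSubgroup 0 := fun a => by rw [hi]; exact C.ι_mem_degree a
  have hpos : ∀ (n : ℕ) (x : M.E.pow n), h.pos n x ∈ C.degreeSubgroup n := by
    intro n
    induction n with
    | zero => exact h0
    | succ n ih =>
      intro x
      induction x using Bimod.psucc_induction with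
      | h0 => rw [map_zero]; exact zero_mem _
      | ha x y hx hy => rw [map_add]; exact add_mem hx hy
      | ht e x =>
        rw [pos_pcons, Nat.cast_succ, add_comm]
        exact ComodAlg.mul_mem_degree (hφ e) (ih x)
  have hneg : ∀ (n : ℕ) (x : M.F.pow n), h.neg n x ∈ C.degreeSubgroup (-n) := by
    intro n
    induction n with
    | zero => exact h0
    | succ n ih =>
      intro x
      induction x using Bimod.psucc_induction with
      | h0 => rw [map_zero]; exact zero_mem _
      | ha x y hx hy => rw [map_add]; exact add_mem hx hy
      | ht f x =>
        rw [neg_pcons, Nat.cast_succ, neg_add_rev]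
        exact ComodAlg.mul_mem_degree (hψ f) (ih x)
  cases n with
  | ofNat n => exact hpos n x
  | negSucc n => exact hneg (n + 1) x

theorem extAlgHom_ρ {C : ComodAlg A (AddMonoidAlgebra ℂ ℤ)} (h : M.HomTo C.carrier)
    (hi : ∀ a, h.i a = C.ι a) (hφ : ∀ e, h.φ e ∈ C.degreeSubgroup 1)
    (hψ : ∀ f, h.ψ f ∈ C.degreeSubgroup (-1))
    (hc : ∀ c : ℂ, h.i (algebraMap ℂ A c) = algebraMap ℂ C.carrier c) (y : M.TensorAlg) :
    C.ρ (h.extAlgHom hc y)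
      = Algebra.TensorProduct.map (h.extAlgHom hc) (AlgHom.id ℂ _) (M.tensorAlg.ρ y) := by
  induction y using TensorAlg.inc_induction with
  | h0 =>
    rw [map_zero, map_zero]
    exact ((congrArg _ (map_zero M.tensorAlg.ρ)).trans (map_zero _)).symm
  | hadd x y hx hy =>
    rw [map_add, map_add, hx, hy]
    exact ((congrArg _ (map_add M.tensorAlg.ρ x y)).trans (map_add _ _ _)).symm
  | hinc n x =>
    refine Eq.trans ?_ (congrArg (Algebra.TensorProduct.map (h.extAlgHom hc) (AlgHom.id ℂ _))
      (ρ_inc M n x)).symm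
    rw [Algebra.TensorProduct.map_tmul, AlgHom.id_apply]
    have h1 : h.extAlgHom hc (inc M n x) = h.extPiece n x := h.ext_inc n x
    rw [h1]
    exact ComodAlg.mem_degree.1 (extPiece_mem h hi hφ hψ n x)

end MoritaContext.HomTo

/-! ### The classification of Hopf–Galois extensions by their part of degree one -/

/-- A Hopf–Galois extension whose part of degree one is the first bimodule of a strict Morita
context is the tensor algebra of that context. The map `F → C₋₁` sends `f` to the unique element
whose left multiplications by `C₁ = E` are `e ↦ μ₁(e ⊗ f)`. -/
theorem MoritaContext.IsStrict.tensorAlg_isomorphic {A : Type u} [Ring A] [Algebra ℂ A]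
    {M : MoritaContext A} (hM : M.IsStrict) {C : ComodAlg A (AddMonoidAlgebra ℂ ℤ)}
    (hC : C.IsHopfGalois) (hE : M.E.Isomorphic (C.degree 1)) : M.tensorAlg.Isomorphic C := by
  obtain ⟨g, hg⟩ := hE
  let φ : M.E →+ C.carrier := (C.degreeSubgroup 1).subtype.comp g.toAddEquiv.toAddMonoidHom
  have φ_mem : ∀ e, φ e ∈ C.degreeSubgroup 1 := fun e => (g e).2
  have φ_smul : ∀ (a : A) e, φ (a • e) = C.ι a * φ e := fun a e =>
    congrArg Subtype.val (map_smul g a e)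
  have φ_op_smul : ∀ (a : A) e, φ (MulOpposite.op a • e) = φ e * C.ι a := fun a e =>
    congrArg Subtype.val (hg a e)
  have φ_surj : ∀ c ∈ C.degreeSubgroup 1, ∃ e, φ e = c := fun c hc => by
    obtain ⟨e, he⟩ := g.surjective (⟨c, hc⟩ : C.degreeSubgroup 1)
    exact ⟨e, congrArg Subtype.val he⟩
  have φ_inj : Function.Injective φ := Subtype.val_injective.comp g.injective
  obtain ⟨I, _, x, y, hx, hy, hxy⟩ := hC.unitAt 1
  choose e he using fun i => φ_surj (y i) (hy i)
  -- Elements of `C` are determined by their left multiples by `C₁`, as `1 ∈ C₋₁ C₁`.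
  have cancel : ∀ u v : C.carrier, (∀ e, φ e * u = φ e * v) → u = v := fun u v huv => by
    rw [← one_mul u, ← one_mul v, ← hxy, Finset.sum_mul, Finset.sum_mul]
    refine Finset.sum_congr rfl fun i _ => ?_
    rw [mul_assoc, mul_assoc, ← he, huv]
  let ψ : M.F →+ C.carrier := AddMonoidHom.mk' (fun f => ∑ i, x i * C.ι (M.μ₁ (Bimod.tm (e i) f)))
    (fun f f' => by
      rw [← Finset.sum_add_distrib]
      refine Finset.sum_congr rfl fun i _ => ?_
      rw [map_add, map_add, map_add, mul_add])
  have ψ_mem : ∀ f, ψ f ∈ C.degreeSubgroup (-1) := fun f => sum_mem fun i _ => by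
    have hm := ComodAlg.mul_mem_degree (hx i) (C.ι_mem_degree (M.μ₁ (Bimod.tm (e i) f)))
    rwa [add_zero] at hm
  have φψ : ∀ e' f, φ e' * ψ f = C.ι (M.μ₁ (Bimod.tm e' f)) := by
    intro e' f
    have h1 : ∀ i, ∃ a, C.ι a = φ e' * x i := fun i => by
      have hm := ComodAlg.mul_mem_degree (φ_mem e') (hx i)
      rw [add_neg_cancel] at hm
      exact ComodAlg.exists_ι_eq_of_mem hC hm
    choose b hb using h1
    -- `e' = ∑ bᵢ eᵢ`, since `φ(e') = ∑ φ(e') xᵢ yᵢ`.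
    have h2 : ∑ i, b i • e i = e' := φ_inj <| by
      rw [map_sum]
      simp_rw [φ_smul, hb, he, mul_assoc]
      rw [← Finset.mul_sum, hxy, mul_one]
    have h3 : ∀ i, φ e' * (x i * C.ι (M.μ₁ (Bimod.tm (e i) f)))
        = C.ι (M.μ₁ (Bimod.tm (b i • e i) f)) := fun i => by
      rw [← mul_assoc, ← hb, ← map_mul, ← M.μ₁_left, Bimod.smul_tm]
    have h4 : ∑ i, C.ι (M.μ₁ (Bimod.tm (b i • e i) f))
        = C.ι (M.μ₁ (Bimod.tm (∑ i, b i • e i) f)) := by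
      rw [map_sum, AddMonoidHom.finsetSum_apply, map_sum, map_sum]
    rw [← h2, ← h4, ← Finset.sum_congr rfl fun i _ => h3 i, h2]
    exact Finset.mul_sum _ _ _
  let h : M.HomTo C.carrier :=
    { i := C.ι.toRingHom
      φ := φ
      ψ := ψ
      φ_smul := φ_smul
      φ_op_smul := φ_op_smul
      ψ_smul := fun a f => cancel _ _ fun e' => by
        change _ = φ e' * (C.ι a * ψ f)
        rw [φψ, ← mul_assoc, ← φ_op_smul, φψ, Bimod.tm_smul]
      ψ_op_smul := fun a f => cancel _ _ fun e' => by
        change _ = φ e' * (ψ f * C.ι a)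
        rw [φψ, ← mul_assoc, φψ, ← map_mul, ← M.μ₁_right, Bimod.op_smul_tm]
      φ_mul_ψ := φψ
      ψ_mul_φ := fun f e'' => cancel _ _ fun e' => by
        change _ = φ e' * C.ι (M.μ₂ (Bimod.tm f e''))
        rw [← mul_assoc, φψ, ← φ_smul, M.assoc₁, φ_op_smul] }
  have hc : ∀ c : ℂ, h.i (algebraMap ℂ A c) = algebraMap ℂ C.carrier c := C.ι.commutes
  have hι : ∀ a, h.extAlgHom hc (M.tensorAlg.ι a) = C.ι a := h.ext_ofA
  have hρ := MoritaContext.HomTo.extAlgHom_ρ h (fun _ => rfl) φ_mem ψ_mem hc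
  exact ⟨AlgEquiv.ofBijective (h.extAlgHom hc)
    (ComodAlg.bijective_of_comod_map (C := M.tensorAlg) hM.tensorAlg_isHopfGalois hC
      (h.extAlgHom hc) hι hρ), hι, hρ⟩

namespace Bimod

variable {A : Type u} [Ring A] [Algebra ℂ A]

theorem IsLeftLine.TZ_isHopfGalois {L : Bimod A} (h : L.IsLeftLine) :
    (L.TZ h.toIsWeakLeftLine).IsHopfGalois := h.context_isStrict.tensorAlg_isHopfGalois

theorem IsLeftLine.TZ_degree_one {L : Bimod A} (h : L.IsLeftLine) :
    L.Isomorphic ((L.TZ h.toIsWeakLeftLine).degree 1) := h.context_isStrict.tensorAlg_degree_one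

theorem IsLeftLine.TZ_isomorphic {L : Bimod A} (h : L.IsLeftLine)
    {C : ComodAlg A (AddMonoidAlgebra ℂ ℤ)} (hC : C.IsHopfGalois)
    (hL : L.Isomorphic (C.degree 1)) : (L.TZ h.toIsWeakLeftLine).Isomorphic C :=
  h.context_isStrict.tensorAlg_isomorphic hC hL

theorem Isomorphic.refl (L : Bimod A) : L.Isomorphic L := ⟨LinearEquiv.refl A L, fun _ _ => rfl⟩

end Bimod

/-! ### The bijections between isomorphism classes -/

section Classification

variable (A : Type u) [Ring A] [Algebra ℂ A]

/-- Autoequivalences correspond to left line modules: `F` goes to `F(A)`, and `L` to `L ⊗ -`. -/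
noncomputable def autoequivalenceEquiv :
    Quotient (autoequivalenceSetoid A) ≃ Quotient (lineModuleSetoid A) where
  toFun := Quotient.lift
    (fun P => Quotient.mk _ ⟨functorBimod P.eqv.functor, functorBimod_isLeftLine P⟩)
    (fun _ _ ⟨i⟩ => Quotient.sound (functorBimod_isomorphic i))
  invFun := Quotient.lift
    (fun L => Quotient.mk _ (MoritaContext.tensorEquivalence L.2.context_isStrict))
    (fun _ _ h => Quotient.sound (Bimod.Isomorphic.tensorFunctor h))
  left_inv := by
    rintro ⟨P⟩
    exact Quotient.sound ⟨wattsNatIso P.eqv.toAdjunction⟩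
  right_inv := by
    rintro ⟨L⟩
    let P := MoritaContext.tensorEquivalence L.2.context_isStrict
    have h1 : L.1.tensorFunctor.Additive := inferInstanceAs P.eqv.functor.Additive
    exact Quotient.sound (functorBimod_tensorFunctor L.1)

/-- Left line modules correspond to Hopf–Galois extensions: `L` goes to `T_ℤ(L)`, and `C` to
`C₁`. -/
noncomputable def hopfGaloisEquiv :
    Quotient (lineModuleSetoid A) ≃ Quotient (hopfGaloisSetoid A) where
  toFun := Quotient.lift
    (fun L => Quotient.mk _ ⟨L.1.TZ L.2.toIsWeakLeftLine, L.2.TZ_isHopfGalois⟩)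
    (fun L N h => Quotient.sound (L.2.TZ_isomorphic N.2.TZ_isHopfGalois
      (Bimod.Isomorphic.trans h N.2.TZ_degree_one)))
  invFun := Quotient.lift
    (fun C => Quotient.mk _ ⟨C.1.degree 1, C.2.degree_one_isLeftLine⟩)
    (fun _ _ h => Quotient.sound (ComodAlg.Isomorphic.degree h 1))
  left_inv := by
    rintro ⟨L⟩
    exact Quotient.sound L.2.TZ_degree_one.symm
  right_inv := by
    rintro ⟨C⟩
    exact Quotient.sound (C.2.degree_one_isLeftLine.TZ_isomorphic C.2 (Bimod.Isomorphic.refl _))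

end Classification

end NCLine

open NCLine
theorem mainTheorem1 (A : Type u) [Ring A] [Algebra ℂ A] :
    (∀ E : Bimod A, E.IsLeftLine ↔ ∃ M : MoritaContext A, M.IsStrict ∧ M.E = E) ∧
    ∃ (hT : ∀ L : LeftLineModule A, (L.1.TZ L.2.toIsWeakLeftLine).IsHopfGalois)
      (Φ : Quotient (autoequivalenceSetoid A) ≃ Quotient (lineModuleSetoid A))
      (Ψ : Quotient (lineModuleSetoid A) ≃ Quotient (hopfGaloisSetoid A)),
      (∀ L : LeftLineModule A, ∃ P : MoritaEquivalence ℂ A A,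
        Nonempty (P.eqv.functor ≅ L.1.tensorFunctor) ∧
          Φ (Quotient.mk _ P) = Quotient.mk _ L) ∧
      (∀ L : LeftLineModule A,
        Ψ (Quotient.mk _ L) = Quotient.mk _ ⟨L.1.TZ L.2.toIsWeakLeftLine, hT L⟩) ∧
      (∀ C : HopfGaloisExtension A, ∃ h : (C.1.degree 1).IsLeftLine,
        Ψ.symm (Quotient.mk _ C) = Quotient.mk _ ⟨C.1.degree 1, h⟩) :=
  ⟨Bimod.isLeftLine_iff, fun L => L.2.TZ_isHopfGalois, autoequivalenceEquiv A, hopfGaloisEquiv A,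
    fun L => ⟨MoritaContext.tensorEquivalence L.2.context_isStrict, ⟨Iso.refl _⟩,
      (autoequivalenceEquiv A).apply_symm_apply (Quotient.mk _ L)⟩,
    fun _ => rfl, fun C => ⟨C.2.degree_one_isLeftLine, rfl⟩⟩
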